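/- **Setting.** Fix $T,\nu,\varepsilon>0$. Let $v_->0$, $u_-\in\mathbb R$, and let $(v_+,u_+,s)$ satisfy the Rankine–Hugoniot conditions $$-s(v_+-v_-)-(u_+-u_-)=0,\qquad -s(u_+-u_-)+(T+1)\Big(\tfrac1{v_+}-\tfrac1{v_-}\Big)=0,$$ with $s=\sqrt{(T+1)/(v_+v_-)}$ and the Lax condition $v_+>v_-$. A *shock profile* is a $C^\infty$ solution $(\bar v,\bar u,\bar\phi)$ on $\mathbb R$, $\bar v>0$, of $$-s\bar v_x-\bar u_x=0,\quad -s\bar u_x+\Big(\frac{T}{\bar v}\Big)_x=\Big(\frac{\nu\bar u_x}{\bar v}\Big)_x-\frac{\bar\phi_x}{\bar v},\quad -\varepsilon^2\Big(\frac{\bar\phi_x}{\bar v}\Big)_x=1-\bar v e^{\bar\phi},$$ with $(\bar v,\bar u,\bar\phi)(x)\to(v_\pm,u_\pm,-\ln v_\pm)$ as $x\to\pm\infty$. The linearized Navier–Stokes–Poisson operator about it is the operator on $L^2(\mathbb R)\times L^2(\mathbb R)$ (complex-valued functions) with domain $H^1(\mathbb R)\times H^2(\mathbb R)$, $$LU=\big(AU+BU_x+D(\mathcal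 A^{-1}\mathcal BU)_x+E(\mathcal A^{-1}\mathcal BU)_{xx}\big)_x ,\qquad U=(v,u)^{\rm tr},\quad \mathcal A^{-1}\mathcal BU:=(\mathcal A^{-1}\mathcal Bv,0)^{\rm tr},$$ where $$A=\begin{pmatrix}s&1\\ A_{21}&s\end{pmatrix},\quad A_{21}=\frac{T+1}{\bar v^2}-\frac{\nu\bar u_x}{\bar v^2}-\frac{\varepsilon^2\bar\phi_x^2}{\bar v^3}+\frac{\varepsilon^2}{\bar v}\Big(\frac{\bar\phi_x}{\bar v^2}\Big)_x+\frac{\varepsilon^2}{\bar v^2}\Big(\frac{\bar\phi_x}{\bar v}\Big)_x,$$ $$B=\begin{pmatrix}0&0\\ \frac{\varepsilon^2\bar\phi_x}{\bar v^3}&\frac{\nu}{\bar v}\end{pmatrix},\quad D=\begin{pmatrix}0&0\\ \frac{\varepsilon^2\bar\phi_x}{\bar v^2}+\frac{\varepsilon^2\bar v_x}{\bar v^3}&0\end{pmatrix},\quad E=\begin{pmatrix}0&0\\ -\frac{\varepsilon^2}{\bar v^2}&0\end{pmatrix},$$ and $\mathcal A^{-1}\mathcal Bv$ is the solution $\phi\in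 H^2(\mathbb R)$ of $\mathcal A\phi=\mathcal Bv$ with $$\mathcal A=\bar ve^{\bar\phi}+\frac{\varepsilon^2\bar v_x}{\bar v^2}\partial_x-\frac{\varepsilon^2}{\bar v}\partial_{xx},\qquad \mathcal B=-e^{\bar\phi}-\frac{\varepsilon^2\bar\phi_{xx}}{\bar v^2}+\frac{2\varepsilon^2\bar v_x\bar\phi_x}{\bar v^3}-\frac{\varepsilon^2\bar\phi_x}{\bar v^2}\partial_x .$$ The essential spectrum $\sigma_{\rm ess}(L)$ is the set of $\lambda\in\mathbb C$ such that $L-\lambda I$ is not Fredholm, or is Fredholm with nonzero index. **Proposition 3.1.** For all $T,\nu,\varepsilon>0$, $v_->0$ and $u_-\in\mathbb R$ there is a constant $\delta_1>0$ such that for all $(v_+,u_+,s)$ as above with $|v_+-v_-|<\delta_1$ and every shock profile $(\bar v,\bar u,\bar\phi)$ connecting $(v_-,u_-,-\ln v_-)$ to $(v_+,u_+,-\ln v_+)$, $$\sigma_{\rm ess}(L)\cap\{\lambda\in\mathbb C:\operatorname{Re}\lambda\ge 0\}=\{0\}.$$ -/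

import Mathlib

open MeasureTheory Filter Topology
open scoped ContDiff

noncomputable section

namespace NSP

/-! ### Shock profiles -/

/-- `(v, u, φ)` is a smooth travelling wave of speed `s` of the isothermal Navier-Stokes-Poisson
system (temperature `T`, viscosity `ν`, Debye length `ε`), written in the moving coordinate
`x = y - s t`, with positive specific volume, which connects the far-field states
`(vm, um, -log vm)` at `-∞` and `(vp, up, -log vp)` at `+∞`. -/
structure IsShockProfile (T ν ε s vm um vp up : ℝ) (v u φ : ℝ → ℝ) : Prop where
  smooth_v : ContDiff ℝ ∞ v
  smooth_u : ContDiff ℝ ∞ u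
  smooth_φ : ContDiff ℝ ∞ φ
  pos : ∀ x, 0 < v x
  mass : ∀ x, -s * deriv v x - deriv u x = 0
  momentum : ∀ x, -s * deriv u x + deriv (fun y => T / v y) x
      = deriv (fun y => ν * deriv u y / v y) x - deriv φ x / v x
  poisson : ∀ x, -ε ^ 2 * deriv (fun y => deriv φ y / v y) x = 1 - v x * Real.exp (φ x)
  lim_v_bot : Tendsto v atBot (𝓝 vm)
  lim_u_bot : Tendsto u atBot (𝓝 um)
  lim_φ_bot : Tendsto φ atBot (𝓝 (-Real.log vm))
  lim_v_top : Tendsto v atTop (𝓝 vp)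
  lim_u_top : Tendsto u atTop (𝓝 up)
  lim_φ_top : Tendsto φ atTop (𝓝 (-Real.log vp))

/-- The end states and the speed satisfy the Rankine-Hugoniot conditions, the speed is the
positive one (2-shock), and the Lax entropy condition `vm < vp` holds. -/
structure IsLaxTwoShock (T s vm um vp up : ℝ) : Prop where
  rankineHugoniot_mass : -s * (vp - vm) - (up - um) = 0
  rankineHugoniot_momentum : -s * (up - um) + (T + 1) * (1 / vp - 1 / vm) = 0
  speed : s = Real.sqrt ((T + 1) / (vp * vm))
  lax : vm < vp

/-! ### Weak derivatives -/

/-- The complex Hilbert space `L²(ℝ)`. -/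
abbrev L2 : Type := Lp ℂ 2 (volume : Measure ℝ)

/-- `g` is the weak derivative of `f` on `ℝ`: both are locally integrable, and
`∫ f η' = - ∫ g η` for all smooth compactly supported `η`. -/
def HasWeakDeriv (f g : ℝ → ℂ) : Prop :=
  LocallyIntegrable f ∧ LocallyIntegrable g ∧
    ∀ η : ℝ → ℝ, ContDiff ℝ ∞ η → HasCompactSupport η →
      ∫ x, f x * ((deriv η x : ℝ) : ℂ) = -∫ x, g x * (η x : ℂ)

/-! ### Coefficients of the linearized operator

The coefficient matrices are
`A = [[s, 1], [A₂₁, s]]`, `B = [[0, 0], [B₂₁, ν / v]]`, `D = [[0, 0], [D₂₁, 0]]`,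
`E = [[0, 0], [E₂₁, 0]]`. -/

/-- The entry `A₂₁`. -/
def coefA (T ν ε : ℝ) (v u φ : ℝ → ℝ) (x : ℝ) : ℝ :=
  (T + 1) / v x ^ 2 - ν * deriv u x / v x ^ 2 - ε ^ 2 * deriv φ x ^ 2 / v x ^ 3
    + ε ^ 2 / v x * deriv (fun y => deriv φ y / v y ^ 2) x
    + ε ^ 2 / v x ^ 2 * deriv (fun y => deriv φ y / v y) x

/-- The entry `B₂₁`. -/
def coefB (ε : ℝ) (v φ : ℝ → ℝ) (x : ℝ) : ℝ := ε ^ 2 * deriv φ x / v x ^ 3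

/-- The entry `D₂₁`. -/
def coefD (ε : ℝ) (v φ : ℝ → ℝ) (x : ℝ) : ℝ :=
  ε ^ 2 * deriv φ x / v x ^ 2 + ε ^ 2 * deriv v x / v x ^ 3

/-- The entry `E₂₁`. -/
def coefE (ε : ℝ) (v : ℝ → ℝ) (x : ℝ) : ℝ := -(ε ^ 2 / v x ^ 2)

/-- The expression `𝒜 p = v e^φ p + ε² v' / v² p' - ε² / v p''`, where `p'`, `p''` are the first two
(weak) derivatives of `p`. -/
def opA (ε : ℝ) (v φ : ℝ → ℝ) (p p' p'' : ℝ → ℂ) (x : ℝ) : ℂ :=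
  ((v x * Real.exp (φ x) : ℝ) : ℂ) * p x + ((ε ^ 2 * deriv v x / v x ^ 2 : ℝ) : ℂ) * p' x
    - ((ε ^ 2 / v x : ℝ) : ℂ) * p'' x

/-- The expression `ℬ w = (-e^φ - ε² φ'' / v² + 2 ε² v' φ' / v³) w - ε² φ' / v² w'`, where `w'` is
the (weak) derivative of `w`. -/
def opB (ε : ℝ) (v φ : ℝ → ℝ) (w w' : ℝ → ℂ) (x : ℝ) : ℂ :=
  ((-Real.exp (φ x) - ε ^ 2 * deriv (deriv φ) x / v x ^ 2
      + 2 * ε ^ 2 * deriv v x * deriv φ x / v x ^ 3 : ℝ) : ℂ) * w x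
    - ((ε ^ 2 * deriv φ x / v x ^ 2 : ℝ) : ℂ) * w' x

/-- The first component `s w + z` of the flux `A U + B U' + D p' + E p''`, with `U = (w, z)`. -/
def flux₁ (s : ℝ) (w z : ℝ → ℂ) (x : ℝ) : ℂ := (s : ℂ) * w x + z x

/-- The second component of the flux `A U + B U' + D p' + E p''`, with `U = (w, z)`. -/
def flux₂ (T ν ε s : ℝ) (v u φ : ℝ → ℝ) (w w' z z' p' p'' : ℝ → ℂ) (x : ℝ) : ℂ :=
  (coefA T ν ε v u φ x : ℂ) * w x + (s : ℂ) * z x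
    + (coefB ε v φ x : ℂ) * w' x + ((ν / v x : ℝ) : ℂ) * z' x
    + (coefD ε v φ x : ℂ) * p' x + (coefE ε v x : ℂ) * p'' x

/-! ### The linearized operator -/

/-- The relation `L U = F` for `U = (w, z)` with `w ∈ H¹(ℝ)`, `z ∈ H²(ℝ)`: there is
`p ∈ H²(ℝ)` with `𝒜 p = ℬ w` (that is, `p = 𝒜⁻¹ ℬ w`), and `F ∈ L² × L²` is the weak derivative of
the flux `A U + B U' + D p' + E p''`. The flux is differentiated as a whole: single terms, such as
`B₂₁ w'`, need not have a weak derivative in `L²`. -/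
def LinearizedRel (T ν ε s : ℝ) (v u φ : ℝ → ℝ) (U F : L2 × L2) : Prop :=
  ∃ w' z' z'' p p' p'' : L2,
    HasWeakDeriv U.1 w' ∧ HasWeakDeriv U.2 z' ∧ HasWeakDeriv z' z'' ∧
    HasWeakDeriv p p' ∧ HasWeakDeriv p' p'' ∧
    (∀ᵐ x : ℝ, opA ε v φ p p' p'' x = opB ε v φ U.1 w' x) ∧
    HasWeakDeriv (flux₁ s U.1 U.2) F.1 ∧
    HasWeakDeriv (flux₂ T ν ε s v u φ U.1 w' U.2 z' p' p'') F.2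

theorem HasWeakDeriv.congr {f f₁ g g₁ : ℝ → ℂ} (h : HasWeakDeriv f g)
    (hf : f =ᵐ[volume] f₁) (hg : g =ᵐ[volume] g₁) : HasWeakDeriv f₁ g₁ := by
  obtain ⟨h1, h2, h3⟩ := h
  refine ⟨?_, ?_, fun η hη hc => ?_⟩
  · intro x
    obtain ⟨t, ht, hi⟩ := h1 x
    exact ⟨t, ht, hi.congr (ae_restrict_of_ae hf)⟩
  · intro x
    obtain ⟨t, ht, hi⟩ := h2 x
    exact ⟨t, ht, hi.congr (ae_restrict_of_ae hg)⟩
  · have e1 : ∫ x, f₁ x * ((deriv η x : ℝ) : ℂ) = ∫ x, f x * ((deriv η x : ℝ) : ℂ) :=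
      integral_congr_ae (by filter_upwards [hf] with x hx; rw [hx])
    have e2 : ∫ x, g₁ x * (η x : ℂ) = ∫ x, g x * (η x : ℂ) :=
      integral_congr_ae (by filter_upwards [hg] with x hx; rw [hx])
    rw [e1, e2, h3 η hη hc]

theorem integrable_mul_test {f : ℝ → ℂ} (hf : LocallyIntegrable f) {η : ℝ → ℝ}
    (hη : Continuous η) (hc : HasCompactSupport η) :
    Integrable (fun x => f x * (η x : ℂ)) := by
  have hc' : HasCompactSupport (fun x => (η x : ℂ)) :=
    hc.comp_left (g := fun r : ℝ => (r : ℂ)) Complex.ofReal_zero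
  have h := hf.integrable_smul_left_of_hasCompactSupport
    (Complex.continuous_ofReal.comp hη) hc'
  refine h.congr (Eventually.of_forall fun x => ?_)
  simp [mul_comm]

theorem HasWeakDeriv.add {f₁ g₁ f₂ g₂ : ℝ → ℂ} (h₁ : HasWeakDeriv f₁ g₁)
    (h₂ : HasWeakDeriv f₂ g₂) :
    HasWeakDeriv (fun x => f₁ x + f₂ x) (fun x => g₁ x + g₂ x) := by
  refine ⟨h₁.1.add h₂.1, h₁.2.1.add h₂.2.1, fun η hη hc => ?_⟩
  have hd : Continuous (deriv η) := hη.continuous_deriv (by simp)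
  simp only [add_mul]
  rw [integral_add (integrable_mul_test h₁.1 hd hc.deriv) (integrable_mul_test h₂.1 hd hc.deriv),
    integral_add (integrable_mul_test h₁.2.1 hη.continuous hc)
      (integrable_mul_test h₂.2.1 hη.continuous hc), h₁.2.2 η hη hc, h₂.2.2 η hη hc]
  ring

theorem HasWeakDeriv.const_mul {f g : ℝ → ℂ} (c : ℂ) (h : HasWeakDeriv f g) :
    HasWeakDeriv (fun x => c * f x) (fun x => c * g x) := by
  refine ⟨h.1.smul c, h.2.1.smul c, fun η hη hc => ?_⟩
  simp only [mul_assoc]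
  rw [integral_const_mul, integral_const_mul, h.2.2 η hη hc]
  ring

theorem hasWeakDeriv_zero : HasWeakDeriv (fun _ => 0) (fun _ => 0) :=
  ⟨locallyIntegrable_zero, locallyIntegrable_zero, fun η _ _ => by simp⟩

/-- The graph of the linearized operator, as a subspace of `(L² × L²) × (L² × L²)`. -/
def linearizedGraph (T ν ε s : ℝ) (v u φ : ℝ → ℝ) :
    Submodule ℂ ((L2 × L2) × (L2 × L2)) where
  carrier := {q | LinearizedRel T ν ε s v u φ q.1 q.2}
  zero_mem' := by
    have h0 : (fun _ : ℝ => (0 : ℂ)) =ᵐ[volume] ((0 : L2) : ℝ → ℂ) :=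
      (Lp.coeFn_zero ℂ 2 volume).symm
    have hz : HasWeakDeriv ((0 : L2) : ℝ → ℂ) ((0 : L2) : ℝ → ℂ) :=
      hasWeakDeriv_zero.congr h0 h0
    refine ⟨0, 0, 0, 0, 0, 0, hz, hz, hz, hz, hz, ?_, ?_, ?_⟩
    · filter_upwards with x
      simp [opA, opB]
    · refine hasWeakDeriv_zero.congr ?_ h0
      filter_upwards with x
      simp [flux₁]
    · refine hasWeakDeriv_zero.congr ?_ h0
      filter_upwards with x
      simp [flux₂]
  add_mem' := by
    rintro ⟨⟨w₁, z₁⟩, ⟨F₁, G₁⟩⟩ ⟨⟨w₂, z₂⟩, ⟨F₂, G₂⟩⟩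
      ⟨w₁', z₁', z₁'', p₁, p₁', p₁'', a1, a2, a3, a4, a5, a6, a7, a8⟩
      ⟨w₂', z₂', z₂'', p₂, p₂', p₂'', b1, b2, b3, b4, b5, b6, b7, b8⟩
    have key : ∀ a b : L2, (fun x => a x + b x) =ᵐ[volume] ((a + b : L2) : ℝ → ℂ) :=
      fun a b => (Lp.coeFn_add a b).symm
    refine ⟨w₁' + w₂', z₁' + z₂', z₁'' + z₂'', p₁ + p₂, p₁' + p₂', p₁'' + p₂'',
      (a1.add b1).congr (key _ _) (key _ _), (a2.add b2).congr (key _ _) (key _ _),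
      (a3.add b3).congr (key _ _) (key _ _), (a4.add b4).congr (key _ _) (key _ _),
      (a5.add b5).congr (key _ _) (key _ _), ?_,
      (a7.add b7).congr ?_ (key _ _), (a8.add b8).congr ?_ (key _ _)⟩
    · filter_upwards [a6, b6, key w₁ w₂, key w₁' w₂', key p₁ p₂, key p₁' p₂', key p₁'' p₂'']
        with x h1 h2 e1 e2 e3 e4 e5
      have h := congrArg₂ (· + ·) h1 h2
      simp only [opA, opB] at h
      simp only [opA, opB, Prod.mk_add_mk, ← e1, ← e2, ← e3, ← e4, ← e5]
      linear_combination h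
    · filter_upwards [key w₁ w₂, key z₁ z₂] with x e1 e2
      simp only [flux₁, Prod.mk_add_mk, ← e1, ← e2]
      ring
    · filter_upwards [key w₁ w₂, key z₁ z₂, key w₁' w₂', key z₁' z₂', key p₁' p₂', key p₁'' p₂'']
        with x e1 e2 e3 e4 e5 e6
      simp only [flux₂, Prod.mk_add_mk, ← e1, ← e2, ← e3, ← e4, ← e5, ← e6]
      ring
  smul_mem' := by
    rintro c ⟨⟨w, z⟩, ⟨F, G⟩⟩ ⟨w', z', z'', p, p', p'', a1, a2, a3, a4, a5, a6, a7, a8⟩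
    have key : ∀ a : L2, (fun x => c * a x) =ᵐ[volume] ((c • a : L2) : ℝ → ℂ) :=
      fun a => (Lp.coeFn_smul c a).symm
    refine ⟨c • w', c • z', c • z'', c • p, c • p', c • p'',
      (a1.const_mul c).congr (key _) (key _), (a2.const_mul c).congr (key _) (key _),
      (a3.const_mul c).congr (key _) (key _), (a4.const_mul c).congr (key _) (key _),
      (a5.const_mul c).congr (key _) (key _), ?_,
      (a7.const_mul c).congr ?_ (key _), (a8.const_mul c).congr ?_ (key _)⟩
    · filter_upwards [a6, key w, key w', key p, key p', key p''] with x h1 e1 e2 e3 e4 e5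
      have h := congrArg (c * ·) h1
      simp only [opA, opB] at h
      simp only [opA, opB, Prod.smul_mk, ← e1, ← e2, ← e3, ← e4, ← e5]
      linear_combination h
    · filter_upwards [key w, key z] with x e1 e2
      simp only [flux₁, Prod.smul_mk, ← e1, ← e2]
      ring
    · filter_upwards [key w, key z, key w', key z', key p', key p''] with x e1 e2 e3 e4 e5 e6
      simp only [flux₂, Prod.smul_mk, ← e1, ← e2, ← e3, ← e4, ← e5, ← e6]
      ring

/-- The linearized operator
`L U = (A U)' + (B U')' + (D (𝒜⁻¹ ℬ U)')' + (E (𝒜⁻¹ ℬ U)'')'`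
as an unbounded operator on `L²(ℝ) × L²(ℝ)` with domain `H¹(ℝ) × H²(ℝ)`. (The product carries the
maximum norm, which is equivalent to the Hilbert norm.) The graph is single-valued when `v` is
smooth, positive and bounded away from `0` and `∞`: then `𝒜` is injective on `H²(ℝ)`, by the
energy identity `∫ (v e^φ |p|² + ε² / v |p'|²) = 0` for `𝒜 p = 0`, and weak derivatives are
unique. -/
def linearizedOperator (T ν ε s : ℝ) (v u φ : ℝ → ℝ) : (L2 × L2) →ₗ.[ℂ] (L2 × L2) :=
  (linearizedGraph T ν ε s v u φ).toLinearPMap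

/-! ### Essential spectrum -/

section EssentialSpectrum

variable {X : Type*} [NormedAddCommGroup X] [NormedSpace ℂ X]

/-- The map `S - μ : D(S) → X`. -/
def shifted (S : X →ₗ.[ℂ] X) (μ : ℂ) : S.domain →ₗ[ℂ] X :=
  S.toFun - μ • S.domain.subtype

/-- A closed operator (here a linear map from its domain `D`) is Fredholm if its kernel is
finite-dimensional and its range is closed and of finite codimension. -/
structure IsFredholmOp {D : Submodule ℂ X} (f : D →ₗ[ℂ] X) : Prop where
  finite_ker : FiniteDimensional ℂ (LinearMap.ker f)
  isClosed_range : IsClosed (LinearMap.range f : Set X)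
  finite_coker : FiniteDimensional ℂ (X ⧸ LinearMap.range f)

/-- The Fredholm index `dim ker - codim ran`; meaningful for Fredholm operators only. -/
def fredholmIndex {D : Submodule ℂ X} (f : D →ₗ[ℂ] X) : ℤ :=
  (Module.finrank ℂ (LinearMap.ker f) : ℤ) - (Module.finrank ℂ (X ⧸ LinearMap.range f) : ℤ)

/-- The essential spectrum of a closed, densely defined operator `S`: those `μ` for which
`S - μ` is not Fredholm, or is Fredholm of nonzero index. -/
def essentialSpectrum (S : X →ₗ.[ℂ] X) : Set ℂ :=
  {μ | ¬ IsFredholmOp (shifted S μ) ∨ fredholmIndex (shifted S μ) ≠ 0}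

end EssentialSpectrum

end NSP

end

noncomputable section

namespace NSP

/-! ### Absolutely continuous functions -/

section Primitives

/-! Case `μ ≠ 0`, `Re μ ≥ 0`. The resolvent equation `(L - μ) U = F` is equivalent to a first-order
system `Y' = M(x) Y + source` on `H¹(ℝ, ℂ⁵)`. The unknowns are `w`, `z`, the second flux component
`g`, the potential perturbation `p`, and the linearized field `r = p' / v - φ' w / v²`. In these
variables the nonlocal operator `𝒜⁻¹ℬ` becomes two local rows, and the terms in `w'` and `p''` drop
out of the flux (`IsShockProfile.flux₂_eq`). The Poisson equation and a first integral of the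
profile equations show that `v'`, `u'` and `φ'` tend to zero, so `M` converges at both ends to the
matrix of the equations frozen at a constant state `V`. An imaginary eigenvalue `i t` of the frozen
matrix would make `m = μ - i t s` a root of `m² + β m + γ` with `β, γ > 0` if `t ≠ 0`, which is
impossible for `Re m ≥ 0`; if `t = 0` it would force `μ = 0`. Hence the frozen matrix is hyperbolic
for every `V > 0` (`isHyperbolic_systemCLM`), and interpolating `V` joins the two limits by a path
of hyperbolic matrices. Such a system is Fredholm of index zero (`isFredholmZero_diffOp`), and
`IsFredholmZero.transfer` carries this over to `L - μ`. The Fredholm statement is proved by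
deformation instead of exponential dichotomies. A constant hyperbolic system is bijective by energy
estimates for it and its adjoint. Along the deformation to `M` the operators stay uniformly bounded
below on the `H¹` functions vanishing on a fine grid, a closed subspace of finite codimension,
because the decaying part of the coefficients is a small perturbation there. The codimension of its
image cannot change in small steps, which fixes the index (`isFredholmZero_of_path`). Case `μ = 0`.
The first row of `L` is an exact derivative, so the range lies in `derivativeRange × L²`. The space
`derivativeRange` is dense, proper and hence not closed, whereas a subspace containing a closed one
of finite codimension is closed. -/

theorem _root_.MeasureTheory.LocallyIntegrable.intervalIntegrable {E : Type*}
    [NormedAddCommGroup E] {g : ℝ → E} (hg : LocallyIntegrable g) (a b : ℝ) :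
    IntervalIntegrable g volume a b :=
  intervalIntegrable_iff.mpr <|
    (hg.integrableOn_isCompact isCompact_uIcc).mono_set Set.uIoc_subset_uIcc

variable {E₁ E₂ G : Type*} [NormedAddCommGroup E₁] [NormedSpace ℝ E₁]
  [NormedAddCommGroup E₂] [NormedSpace ℝ E₂]
  [NormedAddCommGroup G] [NormedSpace ℝ G]

/-- The variation sums of `f` are dominated termwise by those of `S`. This reduces absolute
continuity of vector-valued functions to that of a real primitive of norms. -/
theorem absolutelyContinuousOnInterval_of_dist_le {X : Type*} [PseudoMetricSpace X] {f : ℝ → X}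
    {S : ℝ → ℝ} {C a b : ℝ} (hS : AbsolutelyContinuousOnInterval S a b)
    (h : ∀ x ∈ Set.uIcc a b, ∀ y ∈ Set.uIcc a b, dist (f x) (f y) ≤ C * dist (S x) (S y)) :
    AbsolutelyContinuousOnInterval f a b := by
  unfold AbsolutelyContinuousOnInterval at hS ⊢
  have hS' := hS.const_mul C
  rw [mul_zero] at hS'
  refine squeeze_zero' (Eventually.of_forall fun _ => Finset.sum_nonneg fun _ _ => dist_nonneg)
    ?_ hS'
  have : ∀ᶠ I : ℕ × (ℕ → ℝ × ℝ) in AbsolutelyContinuousOnInterval.totalLengthFilter ⊓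
      𝓟 (AbsolutelyContinuousOnInterval.disjWithin a b),
      I ∈ AbsolutelyContinuousOnInterval.disjWithin a b :=
    eventually_inf_principal.mpr (by simp)
  filter_upwards [this] with I hI
  rw [Finset.mul_sum]
  exact Finset.sum_le_sum fun i hi => h _ (hI.1 i hi).1 _ (hI.1 i hi).2

theorem continuous_const_add_primitive [CompleteSpace E₁] {g : ℝ → E₁} (hg : LocallyIntegrable g)
    (c : E₁) (a : ℝ) : Continuous fun x => c + ∫ t in a..x, g t :=
  continuous_const.add
    (intervalIntegral.continuous_primitive (fun a b => hg.intervalIntegrable a b) a)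

theorem intervalIntegrable_bilinear (L : E₁ →L[ℝ] E₂ →L[ℝ] G) {g : ℝ → E₁} {Q : ℝ → E₂}
    (hg : LocallyIntegrable g) (hQ : Continuous Q) (a b : ℝ) :
    IntervalIntegrable (fun x => L (g x) (Q x)) volume a b := by
  obtain ⟨K, hK⟩ := (isCompact_uIcc (a := a) (b := b)).exists_bound_of_continuousOn
    hQ.continuousOn
  have hi := ((hg.intervalIntegrable a b).norm.const_mul (‖L‖ * K))
  refine hi.mono_fun ?_ ?_
  · exact L.aestronglyMeasurable_comp₂ (hg.intervalIntegrable a b).aestronglyMeasurable_restrict_uIoc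
      hQ.aestronglyMeasurable
  · refine (ae_restrict_iff' measurableSet_uIoc).2 (Eventually.of_forall fun x hx => ?_)
    have h1 := hK x (Set.uIoc_subset_uIcc hx)
    have h0 : 0 ≤ K := (norm_nonneg _).trans h1
    calc ‖L (g x) (Q x)‖ ≤ ‖L‖ * ‖g x‖ * ‖Q x‖ := L.le_opNorm₂ _ _
      _ ≤ ‖L‖ * ‖g x‖ * K := by gcongr
      _ = ‖L‖ * K * ‖g x‖ := by ring
      _ ≤ _ := le_abs_self _

/-- The fundamental theorem of calculus for a bilinear product of two primitives of locally
integrable functions. -/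
theorem integral_bilinear_primitive [CompleteSpace E₁] [CompleteSpace E₂] [CompleteSpace G]
    (L : E₁ →L[ℝ] E₂ →L[ℝ] G) {g₁ : ℝ → E₁}
    {g₂ : ℝ → E₂} (h₁ : LocallyIntegrable g₁) (h₂ : LocallyIntegrable g₂) (c₁ : E₁) (c₂ : E₂)
    (a b : ℝ) :
    ∫ x in a..b, (L (c₁ + ∫ t in (0 : ℝ)..x, g₁ t) (g₂ x)
        + L (g₁ x) (c₂ + ∫ t in (0 : ℝ)..x, g₂ t))
      = L (c₁ + ∫ t in (0 : ℝ)..b, g₁ t) (c₂ + ∫ t in (0 : ℝ)..b, g₂ t)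
        - L (c₁ + ∫ t in (0 : ℝ)..a, g₁ t) (c₂ + ∫ t in (0 : ℝ)..a, g₂ t) := by
  set P : ℝ → E₁ := fun x => c₁ + ∫ t in (0 : ℝ)..x, g₁ t with hP
  set Q : ℝ → E₂ := fun x => c₂ + ∫ t in (0 : ℝ)..x, g₂ t with hQ
  have hPc : Continuous P := continuous_const_add_primitive h₁ c₁ 0
  have hQc : Continuous Q := continuous_const_add_primitive h₂ c₂ 0
  set m : ℝ → G := fun x => L (P x) (g₂ x) + L (g₁ x) (Q x) with hm
  have hmi : ∀ a b, IntervalIntegrable m volume a b := fun a b =>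
    (intervalIntegrable_bilinear L.flip h₂ hPc a b).add (intervalIntegrable_bilinear L h₁ hQc a b)
  have hml : LocallyIntegrable m := by
    intro x
    refine ⟨Set.Icc (x - 1) (x + 1), Icc_mem_nhds (by linarith) (by linarith), ?_⟩
    exact (intervalIntegrable_iff_integrableOn_Icc_of_le (by linarith)).1 (hmi _ _)
  obtain ⟨K₁, hK₁⟩ := (isCompact_uIcc (a := a) (b := b)).exists_bound_of_continuousOn
    hPc.continuousOn
  obtain ⟨K₂, hK₂⟩ := (isCompact_uIcc (a := a) (b := b)).exists_bound_of_continuousOn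
    hQc.continuousOn
  set K := max K₁ K₂
  have hPK : ∀ x ∈ Set.uIcc a b, ‖P x‖ ≤ K := fun x hx => (hK₁ x hx).trans (le_max_left _ _)
  have hQK : ∀ x ∈ Set.uIcc a b, ‖Q x‖ ≤ K := fun x hx => (hK₂ x hx).trans (le_max_right _ _)
  have hK0 : 0 ≤ K := (norm_nonneg _).trans (hPK a Set.left_mem_uIcc)
  set n : ℝ → ℝ := fun x => ‖g₁ x‖ + ‖g₂ x‖ with hn
  have hni : ∀ a b, IntervalIntegrable n volume a b := fun a b =>
    (h₁.intervalIntegrable a b).norm.add (h₂.intervalIntegrable a b).norm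
  have hSac : AbsolutelyContinuousOnInterval (fun x => ∫ t in a..x, n t) a b :=
    (hni a b).absolutelyContinuousOnInterval_intervalIntegral Set.left_mem_uIcc
  set k : ℝ → G := fun x => L (P x) (Q x) - ∫ t in a..x, m t with hk
  have hkac : AbsolutelyContinuousOnInterval k a b := by
    -- One `‖L‖ * K` bounds the increment of the product (`b1`), the other the increment of the
    -- primitive of `m` (`b2`).
    refine absolutelyContinuousOnInterval_of_dist_le (C := 2 * (‖L‖ * K)) hSac ?_
    intro x hx y hy
    have eS : dist (∫ t in a..x, n t) (∫ t in a..y, n t) = |∫ t in y..x, n t| := by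
      rw [Real.dist_eq, intervalIntegral.integral_interval_sub_left (hni _ _) (hni _ _)]
    have eP : P x - P y = ∫ t in y..x, g₁ t := by
      simp only [hP]
      rw [add_sub_add_left_eq_sub, intervalIntegral.integral_interval_sub_left
        (h₁.intervalIntegrable _ _) (h₁.intervalIntegrable _ _)]
    have eQ : Q x - Q y = ∫ t in y..x, g₂ t := by
      simp only [hQ]
      rw [add_sub_add_left_eq_sub, intervalIntegral.integral_interval_sub_left
        (h₂.intervalIntegrable _ _) (h₂.intervalIntegrable _ _)]
    have bP : ‖P x - P y‖ ≤ |∫ t in y..x, ‖g₁ t‖| := by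
      rw [eP]; exact intervalIntegral.norm_integral_le_abs_integral_norm
    have bQ : ‖Q x - Q y‖ ≤ |∫ t in y..x, ‖g₂ t‖| := by
      rw [eQ]; exact intervalIntegral.norm_integral_le_abs_integral_norm
    have hsum : |∫ t in y..x, ‖g₁ t‖| + |∫ t in y..x, ‖g₂ t‖| = |∫ t in y..x, n t| := by
      have e : ∫ t in y..x, n t = (∫ t in y..x, ‖g₁ t‖) + ∫ t in y..x, ‖g₂ t‖ :=
        intervalIntegral.integral_add (h₁.intervalIntegrable _ _).norm
          (h₂.intervalIntegrable _ _).norm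
      rw [e]
      rcases le_total y x with h | h
      · rw [abs_of_nonneg (intervalIntegral.integral_nonneg h fun _ _ => norm_nonneg _),
          abs_of_nonneg (intervalIntegral.integral_nonneg h fun _ _ => norm_nonneg _),
          abs_of_nonneg (add_nonneg (intervalIntegral.integral_nonneg h fun _ _ => norm_nonneg _)
          (intervalIntegral.integral_nonneg h fun _ _ => norm_nonneg _))]
      · rw [intervalIntegral.integral_symm x y, intervalIntegral.integral_symm x y, ← neg_add,
          abs_neg, abs_neg, abs_neg,
          abs_of_nonneg (intervalIntegral.integral_nonneg h fun _ _ => norm_nonneg _),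
          abs_of_nonneg (intervalIntegral.integral_nonneg h fun _ _ => norm_nonneg _),
          abs_of_nonneg (add_nonneg (intervalIntegral.integral_nonneg h fun _ _ => norm_nonneg _)
          (intervalIntegral.integral_nonneg h fun _ _ => norm_nonneg _))]
    have b1 : ‖L (P x) (Q x) - L (P y) (Q y)‖ ≤ ‖L‖ * K * |∫ t in y..x, n t| := by
      have e : L (P x) (Q x) - L (P y) (Q y) = L (P x - P y) (Q x) + L (P y) (Q x - Q y) := by
        simp only [map_sub, sub_apply]; abel
      rw [e, ← hsum]
      calc _ ≤ ‖L‖ * ‖P x - P y‖ * ‖Q x‖ + ‖L‖ * ‖P y‖ * ‖Q x - Q y‖ :=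
            (norm_add_le _ _).trans (add_le_add (L.le_opNorm₂ _ _) (L.le_opNorm₂ _ _))
        _ ≤ ‖L‖ * |∫ t in y..x, ‖g₁ t‖| * K + ‖L‖ * K * |∫ t in y..x, ‖g₂ t‖| := by
            gcongr
            · exact hQK x hx
            · exact hPK y hy
        _ = _ := by ring
    have b2 : ‖∫ t in y..x, m t‖ ≤ ‖L‖ * K * |∫ t in y..x, n t| := by
      rw [← abs_of_nonneg (mul_nonneg (norm_nonneg L) hK0), ← abs_mul,
        ← intervalIntegral.integral_const_mul]
      refine intervalIntegral.norm_integral_le_abs_of_norm_le ?_ ((hni _ _).const_mul _)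
      refine (ae_restrict_iff' measurableSet_uIoc).2 (Eventually.of_forall fun t ht => ?_)
      have ht' : t ∈ Set.uIcc a b :=
        Set.uIcc_subset_uIcc hy hx (Set.uIoc_subset_uIcc ht)
      calc ‖m t‖ ≤ ‖L‖ * ‖P t‖ * ‖g₂ t‖ + ‖L‖ * ‖g₁ t‖ * ‖Q t‖ :=
            (norm_add_le _ _).trans (add_le_add (L.le_opNorm₂ _ _) (L.le_opNorm₂ _ _))
        _ ≤ ‖L‖ * K * ‖g₂ t‖ + ‖L‖ * ‖g₁ t‖ * K := by
            gcongr
            · exact hPK t ht'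
            · exact hQK t ht'
        _ = ‖L‖ * K * n t := by simp only [hn]; ring
    rw [eS, dist_eq_norm]
    have e : k x - k y = (L (P x) (Q x) - L (P y) (Q y)) - ∫ t in y..x, m t := by
      simp only [hk]
      rw [← intervalIntegral.integral_interval_sub_left (hmi a x) (hmi a y)]
      abel
    rw [e]
    linarith [norm_sub_le (L (P x) (Q x) - L (P y) (Q y)) (∫ t in y..x, m t)]
  have hder : ∀ᵐ x, x ∈ Set.uIcc a b → HasDerivAt k 0 x := by
    filter_upwards [LocallyIntegrable.ae_hasDerivAt_integral h₁, LocallyIntegrable.ae_hasDerivAt_integral h₂,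
      LocallyIntegrable.ae_hasDerivAt_integral hml] with x d₁ d₂ d₃ _
    have dP : HasDerivAt P (g₁ x) x := (d₁ 0).const_add c₁
    have dQ : HasDerivAt Q (g₂ x) x := (d₂ 0).const_add c₂
    have := (L.hasDerivAt_of_bilinear (fun _ => dP) (fun _ => dQ)).sub (d₃ a)
    exact this.congr_deriv (sub_self _)
  obtain ⟨C, hC⟩ := hkac.const_of_ae_hasDerivAt_zero hder
  have ha := hC a Set.left_mem_uIcc
  have hb := hC b Set.right_mem_uIcc
  have hab : k b = k a := hb.trans ha.symm
  simp only [hk, intervalIntegral.integral_same, sub_zero] at hab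
  rw [← hab]
  abel

end Primitives

/-! ### Weak derivatives of vector-valued functions -/

section WeakDeriv

variable {E : Type*} [NormedAddCommGroup E] [NormedSpace ℝ E]

/-- `g` is the weak derivative of the vector-valued function `u` on `ℝ`. -/
def WeakDeriv (u g : ℝ → E) : Prop :=
  LocallyIntegrable u ∧ LocallyIntegrable g ∧
    ∀ η : ℝ → ℝ, ContDiff ℝ ∞ η → HasCompactSupport η →
      ∫ x, deriv η x • u x = -∫ x, η x • g x

theorem hasWeakDeriv_iff_weakDeriv {u g : ℝ → ℂ} : HasWeakDeriv u g ↔ WeakDeriv u g := by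
  simp only [HasWeakDeriv, WeakDeriv, Complex.real_smul, mul_comm]

theorem integrable_test_smul {f : ℝ → E} (hf : LocallyIntegrable f) {η : ℝ → ℝ}
    (hη : Continuous η) (hc : HasCompactSupport η) : Integrable fun x => η x • f x :=
  hf.integrable_smul_left_of_hasCompactSupport hη hc

theorem WeakDeriv.congr {u u₁ g g₁ : ℝ → E} (h : WeakDeriv u g)
    (hu : u =ᵐ[volume] u₁) (hg : g =ᵐ[volume] g₁) : WeakDeriv u₁ g₁ := by
  obtain ⟨h1, h2, h3⟩ := h
  refine ⟨fun x => ?_, fun x => ?_, fun η hη hc => ?_⟩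
  · obtain ⟨t, ht, hi⟩ := h1 x
    exact ⟨t, ht, hi.congr (ae_restrict_of_ae hu)⟩
  · obtain ⟨t, ht, hi⟩ := h2 x
    exact ⟨t, ht, hi.congr (ae_restrict_of_ae hg)⟩
  · have e1 : ∫ x, deriv η x • u₁ x = ∫ x, deriv η x • u x :=
      integral_congr_ae (by filter_upwards [hu] with x hx; rw [hx])
    have e2 : ∫ x, η x • g₁ x = ∫ x, η x • g x :=
      integral_congr_ae (by filter_upwards [hg] with x hx; rw [hx])
    rw [e1, e2, h3 η hη hc]

theorem continuous_deriv_of_contDiff {η : ℝ → ℝ} (hη : ContDiff ℝ ∞ η) : Continuous (deriv η) :=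
  hη.continuous_deriv (by simp)

theorem WeakDeriv.add {u₁ g₁ u₂ g₂ : ℝ → E} (h₁ : WeakDeriv u₁ g₁) (h₂ : WeakDeriv u₂ g₂) :
    WeakDeriv (fun x => u₁ x + u₂ x) (fun x => g₁ x + g₂ x) := by
  refine ⟨h₁.1.add h₂.1, h₁.2.1.add h₂.2.1, fun η hη hc => ?_⟩
  have hd := continuous_deriv_of_contDiff hη
  simp only [smul_add]
  rw [integral_add (integrable_test_smul h₁.1 hd hc.deriv) (integrable_test_smul h₂.1 hd hc.deriv),
    integral_add (integrable_test_smul h₁.2.1 hη.continuous hc)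
      (integrable_test_smul h₂.2.1 hη.continuous hc), h₁.2.2 η hη hc, h₂.2.2 η hη hc]
  abel

theorem WeakDeriv.clm_comp [CompleteSpace E] {F : Type*} [NormedAddCommGroup F] [NormedSpace ℝ F]
    [CompleteSpace F] (L : E →L[ℝ] F) {u g : ℝ → E} (h : WeakDeriv u g) :
    WeakDeriv (fun x => L (u x)) (fun x => L (g x)) := by
  have key : ∀ f : ℝ → E, LocallyIntegrable f → LocallyIntegrable fun x => L (f x) := by
    intro f hf x
    obtain ⟨t, ht, hi⟩ := hf x
    exact ⟨t, ht, L.integrable_comp hi⟩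
  refine ⟨key _ h.1, key _ h.2.1, fun η hη hc => ?_⟩
  have hd := continuous_deriv_of_contDiff hη
  simp only [← map_smul]
  rw [L.integral_comp_comm (integrable_test_smul h.1 hd hc.deriv),
    L.integral_comp_comm (integrable_test_smul h.2.1 hη.continuous hc), h.2.2 η hη hc, map_neg]

/-- The product rule for a smooth function times a weakly differentiable function. -/
theorem WeakDeriv.smul_smooth {u g : ℝ → E} (h : WeakDeriv u g) {a : ℝ → ℝ}
    (ha : ContDiff ℝ ∞ a) :
    WeakDeriv (fun x => a x • u x) (fun x => deriv a x • u x + a x • g x) := by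
  have key : ∀ (b : ℝ → ℝ) (f : ℝ → E), Continuous b → LocallyIntegrable f →
      LocallyIntegrable fun x => b x • f x := fun b f hb hf =>
    (locallyIntegrableOn_univ.1 <|
      (locallyIntegrableOn_univ.2 hf).continuousOn_smul isOpen_univ.isLocallyClosed
        hb.continuousOn)
  have hda := continuous_deriv_of_contDiff ha
  refine ⟨key _ _ ha.continuous h.1, (key _ _ hda h.1).add (key _ _ ha.continuous h.2.1),
    fun η hη hc => ?_⟩
  have hdη := continuous_deriv_of_contDiff hη
  have hc' : HasCompactSupport fun x => η x * a x := hc.mul_right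
  have hηa : ContDiff ℝ ∞ fun x => η x * a x := hη.mul ha
  -- Testing `u` against `η a` moves the product rule onto test functions.
  have h3 := h.2.2 _ hηa hc'
  have e : ∀ x, deriv (fun y => η y * a y) x = deriv η x * a x + η x * deriv a x := fun x =>
    deriv_fun_mul (hη.differentiable (by simp) x) (ha.differentiable (by simp) x)
  have i1 : Integrable fun x => deriv η x • a x • u x :=
    integrable_test_smul (key _ _ ha.continuous h.1) hdη hc.deriv
  have i2 : Integrable fun x => η x • deriv a x • u x :=
    integrable_test_smul (key _ _ hda h.1) hη.continuous hc
  have i3 : Integrable fun x => η x • a x • g x :=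
    integrable_test_smul (key _ _ ha.continuous h.2.1) hη.continuous hc
  simp only [e, add_smul, mul_smul] at h3
  rw [integral_add i1 i2] at h3
  simp only [smul_add]
  rw [integral_add i2 i3, eq_sub_of_add_eq h3]
  abel

/-- Integration by parts on an interval containing the support of `η`, whose boundary terms vanish.
-/
theorem weakDeriv_const_add_primitive [CompleteSpace E] {g : ℝ → E} (hg : LocallyIntegrable g)
    (c : E) : WeakDeriv (fun x => c + ∫ t in (0 : ℝ)..x, g t) g := by
  have hPc := continuous_const_add_primitive hg c 0
  refine ⟨hPc.locallyIntegrable, hg, fun η hη hc => ?_⟩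
  have hd := continuous_deriv_of_contDiff hη
  obtain ⟨R, hR⟩ : ∃ R : ℝ, tsupport η ⊆ Set.Ioo (-R) R := by
    obtain ⟨R, hR⟩ := hc.isBounded.subset_ball 0
    exact ⟨R, by simpa [Real.ball_eq_Ioo] using hR⟩
  have hz : ∀ x, x ∉ Set.Ioo (-R) R → η x = 0 := fun x hx =>
    image_eq_zero_of_notMem_tsupport fun h => hx (hR h)
  have hz' : ∀ x, x ∉ Set.Ioo (-R) R → deriv η x = 0 := fun x hx =>
    image_eq_zero_of_notMem_tsupport fun h => hx (hR (tsupport_deriv_subset h))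
  have eη : ∀ x, η (-R) + ∫ t in (-R)..x, deriv η t = η x := fun x => by
    rw [intervalIntegral.integral_deriv_eq_sub (fun y _ => hη.differentiable (by simp) y)
      (hd.intervalIntegrable _ _)]
    abel
  have eη' : ∀ x, η 0 + ∫ t in (0 : ℝ)..x, deriv η t = η x := fun x => by
    rw [intervalIntegral.integral_deriv_eq_sub (fun y _ => hη.differentiable (by simp) y)
      (hd.intervalIntegrable _ _)]
    abel
  have h := integral_bilinear_primitive (ContinuousLinearMap.lsmul ℝ ℝ : ℝ →L[ℝ] E →L[ℝ] E)
    hd.locallyIntegrable hg (η 0) c (-R) R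
  simp only [eη', ContinuousLinearMap.lsmul_apply, hz R (by simp), hz (-R) (by simp), zero_smul,
    sub_zero] at h
  have i1 : Integrable fun x => deriv η x • (c + ∫ t in (0 : ℝ)..x, g t) :=
    integrable_test_smul hPc.locallyIntegrable hd hc.deriv
  have i2 : Integrable fun x => η x • g x := integrable_test_smul hg hη.continuous hc
  rw [intervalIntegral.integral_add i2.intervalIntegrable i1.intervalIntegrable,
    intervalIntegral.integral_eq_integral_of_support_subset,
    intervalIntegral.integral_eq_integral_of_support_subset] at h
  · exact eq_neg_of_add_eq_zero_right h
  · intro x hx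
    by_contra hx'
    exact hx (by simp [hz' x fun h => hx' ⟨h.1, h.2.le⟩])
  · intro x hx
    by_contra hx'
    exact hx (by simp [hz x fun h => hx' ⟨h.1, h.2.le⟩])

/-- A smooth function of compact support and mean zero is the derivative of a test function. -/
theorem exists_primitive_of_integral_eq_zero {θ : ℝ → ℝ} (hθ : ContDiff ℝ ∞ θ)
    (hc : HasCompactSupport θ) (h0 : ∫ x, θ x = 0) :
    ∃ η : ℝ → ℝ, ContDiff ℝ ∞ η ∧ HasCompactSupport η ∧ deriv η = θ := by
  obtain ⟨R, hR⟩ : ∃ R : ℝ, tsupport θ ⊆ Set.Ioo (-R) R := by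
    obtain ⟨R, hR⟩ := hc.isBounded.subset_ball 0
    exact ⟨R, by simpa [Real.ball_eq_Ioo] using hR⟩
  have hz : ∀ x, x ∉ Set.Ioo (-R) R → θ x = 0 := fun x hx =>
    image_eq_zero_of_notMem_tsupport fun h => hx (hR h)
  have hd : ∀ x, HasDerivAt (fun x => ∫ t in (-R)..x, θ t) (θ x) x := fun x =>
    hθ.continuous.integral_hasStrictDerivAt _ _ |>.hasDerivAt
  have hd' : deriv (fun x => ∫ t in (-R)..x, θ t) = θ := funext fun x => (hd x).deriv
  refine ⟨fun x => ∫ t in (-R)..x, θ t, ?_, ?_, hd'⟩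
  · rw [contDiff_infty_iff_deriv]
    exact ⟨fun x => (hd x).differentiableAt, hd'.symm ▸ hθ⟩
  · refine HasCompactSupport.intro (K := Set.Icc (-R) R) isCompact_Icc fun x hx => ?_
    have hx : x < -R ∨ R < x := by
      by_contra! h; exact hx h
    rcases hx with hx | hx
    · refine intervalIntegral.integral_zero_ae (Eventually.of_forall fun t ht => hz t fun h => ?_)
      rw [Set.uIoc_of_ge hx.le] at ht
      linarith [ht.2, h.1]
    · rw [intervalIntegral.integral_eq_integral_of_support_subset, h0]
      intro t ht
      by_contra ht'
      exact ht (hz t fun h => ht' ⟨h.1, h.2.le.trans hx.le⟩)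

/-- A locally integrable function with vanishing weak derivative is constant. -/
theorem ae_eq_const_of_weakDeriv_zero [CompleteSpace E] {w : ℝ → E} (hw : LocallyIntegrable w)
    (h : ∀ η : ℝ → ℝ, ContDiff ℝ ∞ η → HasCompactSupport η → ∫ x, deriv η x • w x = 0) :
    ∃ c : E, w =ᵐ[volume] fun _ => c := by
  let ψ₀ : ContDiffBump (0 : ℝ) := ⟨1, 2, zero_lt_one, one_lt_two⟩
  set ψ : ℝ → ℝ := ψ₀.normed volume
  have hψ : ContDiff ℝ ∞ ψ := ψ₀.contDiff_normed
  have hψc : HasCompactSupport ψ := ψ₀.hasCompactSupport_normed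
  have hψ1 : ∫ x, ψ x = 1 := ψ₀.integral_normed
  refine ⟨∫ x, ψ x • w x, ?_⟩
  set c := ∫ x, ψ x • w x with hcdef
  have hl : LocallyIntegrable fun x => w x - c := hw.sub (locallyIntegrable_const c)
  have := ae_eq_zero_of_integral_contDiff_smul_eq_zero hl (fun θ hθ hθc => ?_)
  · filter_upwards [this] with x hx
    exact sub_eq_zero.1 hx
  · set I := ∫ x, θ x
    have hiθ : Integrable θ := hθ.continuous.integrable_of_hasCompactSupport hθc
    have hiψ : Integrable ψ := hψ.continuous.integrable_of_hasCompactSupport hψc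
    -- Subtracting the multiple of the unit-mass bump `ψ` with the same integral makes the test
    -- function a derivative. The hypothesis then says `∫ θ w = (∫ θ) c` with `c = ∫ ψ w`.
    obtain ⟨η, hη, hηc, hd⟩ := exists_primitive_of_integral_eq_zero (θ := fun x => θ x - I * ψ x)
      (hθ.sub (contDiff_const.mul hψ)) (hθc.sub hψc.mul_left) (by
        rw [integral_sub hiθ (hiψ.const_mul _), integral_const_mul, hψ1, mul_one, sub_self])
    have h' := h η hη hηc
    rw [hd] at h'
    have i1 := integrable_test_smul hw hθ.continuous hθc
    have i2 := integrable_test_smul hw hψ.continuous hψc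
    simp only [sub_smul, mul_smul] at h'
    have i3 : Integrable fun x => I • ψ x • w x := i2.smul I
    rw [integral_sub i1 i3, integral_smul, ← hcdef] at h'
    simp only [smul_sub]
    rw [integral_sub i1 (hiθ.smul_const c), integral_smul_const]
    exact h'

/-- `u` and a primitive of `g` have the same weak derivative, so they differ by a constant. This
supplies the continuous representative used for point values and energy identities. -/
theorem weakDeriv_iff_primitive [CompleteSpace E] {u g : ℝ → E} (hg : LocallyIntegrable g) :
    WeakDeriv u g ↔ ∃ c : E, u =ᵐ[volume] fun x => c + ∫ t in (0 : ℝ)..x, g t := by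
  constructor
  · intro h
    have hp := weakDeriv_const_add_primitive hg 0
    obtain ⟨c, hc⟩ := ae_eq_const_of_weakDeriv_zero (h.1.sub hp.1) (fun η hη hηc => by
      have hd := continuous_deriv_of_contDiff hη
      simp only [Pi.sub_apply, smul_sub]
      rw [integral_sub (integrable_test_smul h.1 hd hηc.deriv)
        (integrable_test_smul hp.1 hd hηc.deriv), h.2.2 η hη hηc, hp.2.2 η hη hηc, sub_self])
    refine ⟨c, ?_⟩
    filter_upwards [hc] with x hx
    simp only [Pi.sub_apply, zero_add] at hx
    rw [← hx]; abel
  · rintro ⟨c, hc⟩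
    exact (weakDeriv_const_add_primitive hg c).congr hc.symm (ae_eq_refl _)

theorem WeakDeriv.unique [CompleteSpace E] {u g₁ g₂ : ℝ → E} (h₁ : WeakDeriv u g₁)
    (h₂ : WeakDeriv u g₂) : g₁ =ᵐ[volume] g₂ := by
  refine ae_eq_of_integral_contDiff_smul_eq h₁.2.1 h₂.2.1 fun η hη hc => ?_
  rw [← neg_inj, ← h₁.2.2 η hη hc, h₂.2.2 η hη hc]

end WeakDeriv

/-! ### The Sobolev space `H¹(ℝ, E)` -/

section Sobolev

theorem locallyIntegrable_coe {E : Type*} [NormedAddCommGroup E] (u : Lp E 2 (volume : Measure ℝ)) : LocallyIntegrable u :=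
  (Lp.memLp u).locallyIntegrable (by norm_num)

variable {E : Type*} [NormedAddCommGroup E] [InnerProductSpace ℂ E]

variable (E) in
/-- The Sobolev space `H¹(ℝ, E)`, as the graph of the weak derivative. -/
def sobolev : Submodule ℂ (Lp E 2 (volume : Measure ℝ) × Lp E 2 (volume : Measure ℝ)) where
  carrier := {q | WeakDeriv q.1 q.2}
  zero_mem' := by
    refine ⟨locallyIntegrable_coe _, locallyIntegrable_coe _, fun η _ _ => ?_⟩
    rw [integral_eq_zero_of_ae, integral_eq_zero_of_ae, neg_zero]
    · filter_upwards [Lp.coeFn_zero E 2 (volume : Measure ℝ)] with x hx; simp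
    · filter_upwards [Lp.coeFn_zero E 2 (volume : Measure ℝ)] with x hx; simp
  add_mem' := fun {a b} ha hb =>
    (WeakDeriv.add ha hb).congr (Lp.coeFn_add a.1 b.1).symm (Lp.coeFn_add a.2 b.2).symm
  smul_mem' := fun c a ha => by
    refine ⟨locallyIntegrable_coe _, locallyIntegrable_coe _, fun η hη hc => ?_⟩
    have h := ha.2.2 η hη hc
    have e1 : ∫ x, deriv η x • (c • a).1 x = ∫ x, c • deriv η x • a.1 x :=
      integral_congr_ae (by
        filter_upwards [Lp.coeFn_smul c a.1] with x hx
        rw [Prod.smul_fst, hx, Pi.smul_apply, smul_comm])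
    have e2 : ∫ x, η x • (c • a).2 x = ∫ x, c • η x • a.2 x :=
      integral_congr_ae (by
        filter_upwards [Lp.coeFn_smul c a.2] with x hx
        rw [Prod.smul_snd, hx, Pi.smul_apply, smul_comm])
    rw [e1, e2, integral_smul, integral_smul, h, smul_neg]

theorem mem_sobolev_iff {q : Lp E 2 (volume : Measure ℝ) × Lp E 2 (volume : Measure ℝ)} :
    q ∈ sobolev E ↔ WeakDeriv q.1 q.2 := Iff.rfl

theorem memLp_test_smul {η : ℝ → ℝ} (hη : Continuous η) (hc : HasCompactSupport η) (e : E) :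
    MemLp (fun x => η x • e) 2 (volume : Measure ℝ) :=
  (hη.smul continuous_const).memLp_of_hasCompactSupport hc.smul_right

theorem inner_toLp_smul [CompleteSpace E] {k : ℝ → ℝ} {e : E}
    (hk : MemLp (fun x => k x • e) 2 (volume : Measure ℝ)) (u : Lp E 2 (volume : Measure ℝ))
    (hi : Integrable fun x => k x • u x) :
    inner ℂ (hk.toLp _) u = inner ℂ e (∫ x, k x • u x) := by
  rw [L2.inner_def, ← integral_inner hi]
  refine integral_congr_ae ?_
  filter_upwards [hk.coeFn_toLp] with x hx
  rw [hx, ← Complex.coe_smul, ← Complex.coe_smul, inner_smul_left, inner_smul_right,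
    Complex.conj_ofReal]

/-- Testing in each direction `e` turns weak differentiability into the vanishing of continuous
functionals on `L² × L²`. This yields closedness of the graph, and later shows that a vector
orthogonal to a range is a weak solution of the adjoint system. -/
theorem mem_sobolev_iff_inner [CompleteSpace E]
    {q : Lp E 2 (volume : Measure ℝ) × Lp E 2 (volume : Measure ℝ)} :
    q ∈ sobolev E ↔ ∀ (η : ℝ → ℝ) (hη : ContDiff ℝ ∞ η) (hc : HasCompactSupport η) (e : E),
      inner ℂ ((memLp_test_smul (continuous_deriv_of_contDiff hη) hc.deriv e).toLp _) q.1
        + inner ℂ ((memLp_test_smul hη.continuous hc e).toLp _) q.2 = 0 := by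
  have key : ∀ (η : ℝ → ℝ) (hη : ContDiff ℝ ∞ η) (hc : HasCompactSupport η) (e : E),
      inner ℂ ((memLp_test_smul (continuous_deriv_of_contDiff hη) hc.deriv e).toLp _) q.1
        + inner ℂ ((memLp_test_smul hη.continuous hc e).toLp _) q.2
      = inner ℂ e ((∫ x, deriv η x • q.1 x) + ∫ x, η x • q.2 x) := fun η hη hc e => by
    rw [inner_toLp_smul _ _ (integrable_test_smul (locallyIntegrable_coe _)
        (continuous_deriv_of_contDiff hη) hc.deriv),
      inner_toLp_smul _ _ (integrable_test_smul (locallyIntegrable_coe _) hη.continuous hc),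
      inner_add_right]
  constructor
  · intro h η hη hc e
    rw [key η hη hc, h.2.2 η hη hc, neg_add_cancel, inner_zero_right]
  · intro h
    refine ⟨locallyIntegrable_coe _, locallyIntegrable_coe _, fun η hη hc => ?_⟩
    exact eq_neg_of_add_eq_zero_left
      (inner_self_eq_zero.1 ((key η hη hc _).symm.trans (h η hη hc _)))

theorem isClosed_sobolev [CompleteSpace E] :
    IsClosed (sobolev E : Set (Lp E 2 (volume : Measure ℝ) × Lp E 2 (volume : Measure ℝ))) := by
  have : (sobolev E : Set (Lp E 2 (volume : Measure ℝ) × Lp E 2 (volume : Measure ℝ)))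
      = ⋂ (η : ℝ → ℝ) (hη : ContDiff ℝ ∞ η) (hc : HasCompactSupport η) (e : E),
        {q | inner ℂ ((memLp_test_smul (continuous_deriv_of_contDiff hη) hc.deriv e).toLp _) q.1
        + inner ℂ ((memLp_test_smul hη.continuous hc e).toLp _) q.2 = 0} := by
    ext q
    simp only [Set.mem_iInter]
    exact mem_sobolev_iff_inner
  rw [this]
  refine isClosed_iInter fun η => isClosed_iInter fun hη => isClosed_iInter fun hc =>
    isClosed_iInter fun e => isClosed_eq (by fun_prop) continuous_const

instance [CompleteSpace E] : CompleteSpace (sobolev E) :=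
  isClosed_sobolev.completeSpace_coe

theorem test_mem_sobolev [CompleteSpace E] {η : ℝ → ℝ} (hη : ContDiff ℝ ∞ η)
    (hc : HasCompactSupport η) (e : E) :
    ((memLp_test_smul hη.continuous hc e).toLp _,
      (memLp_test_smul (continuous_deriv_of_contDiff hη) hc.deriv e).toLp _) ∈ sobolev E := by
  have hd := continuous_deriv_of_contDiff hη
  refine WeakDeriv.congr (u := fun x => η x • e) (g := fun x => deriv η x • e) ?_
    (memLp_test_smul hη.continuous hc e).coeFn_toLp.symm
    (memLp_test_smul hd hc.deriv e).coeFn_toLp.symm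
  have hl : LocallyIntegrable fun x => deriv η x • e :=
    (hd.smul continuous_const).locallyIntegrable
  rw [weakDeriv_iff_primitive hl]
  refine ⟨η 0 • e, Eventually.of_forall fun x => ?_⟩
  simp only
  rw [intervalIntegral.integral_smul_const, intervalIntegral.integral_deriv_eq_sub
    (fun y _ => hη.differentiable (by simp) y) (hd.intervalIntegrable _ _), ← add_smul]
  congr 1; ring

theorem exists_primitive_of_mem_sobolev [CompleteSpace E]
    {q : Lp E 2 (volume : Measure ℝ) × Lp E 2 (volume : Measure ℝ)} (hq : q ∈ sobolev E) :
    ∃ c : E, q.1 =ᵐ[volume] fun x => c + ∫ t in (0 : ℝ)..x, q.2 t :=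
  (weakDeriv_iff_primitive (locallyIntegrable_coe _)).1 hq

theorem mem_sobolev_of_primitive [CompleteSpace E]
    {q : Lp E 2 (volume : Measure ℝ) × Lp E 2 (volume : Measure ℝ)} {c : E}
    (h : q.1 =ᵐ[volume] fun x => c + ∫ t in (0 : ℝ)..x, q.2 t) : q ∈ sobolev E :=
  (weakDeriv_iff_primitive (locallyIntegrable_coe _)).2 ⟨c, h⟩

/-! #### The energy identity -/

/-- The real bilinear form `Re ⟪H x, y⟫`. -/
def reForm (H : E →L[ℂ] E) : E →L[ℝ] E →L[ℝ] ℝ :=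
  LinearMap.mkContinuous₂ (LinearMap.mk₂ ℝ (fun x y : E => (inner ℂ (H x) y).re)
    (fun x y z => by simp)
    (fun c x y => by simp [← Complex.coe_smul, mul_comm])
    (fun x y z => by simp)
    (fun c x y => by simp [← Complex.coe_smul])) ‖H‖
    (fun x y => by
      rw [LinearMap.mk₂_apply, Real.norm_eq_abs]
      exact (Complex.abs_re_le_norm _).trans ((norm_inner_le_norm _ _).trans
        (mul_le_mul_of_nonneg_right (H.le_opNorm x) (norm_nonneg y))))

theorem reForm_apply (H : E →L[ℂ] E) (x y : E) : reForm H x y = (inner ℂ (H x) y).re := rfl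

theorem integrable_reForm (H : E →L[ℂ] E) (u g : Lp E 2 (volume : Measure ℝ)) :
    Integrable fun x => reForm H (u x) (g x) := by
  have h := (L2.integrable_inner (𝕜 := ℂ) (H.compLp u) g).re
  refine h.congr ?_
  filter_upwards [H.coeFn_compLp u] with x hx
  rw [hx, reForm_apply]; rfl

/-- The integrand is half the derivative of the quadratic form `Re ⟪H u, u⟫`, so the integral is a
difference of its limits at the two ends. -/
theorem integral_reForm_eq_zero [CompleteSpace E]
    {q : Lp E 2 (volume : Measure ℝ) × Lp E 2 (volume : Measure ℝ)} (hq : q ∈ sobolev E)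
    (H : E →L[ℂ] E) (hH : ∀ x y, inner ℂ (H x) y = inner ℂ x (H y)) :
    ∫ x, reForm H (q.1 x) (q.2 x) = 0 := by
  obtain ⟨c, hc⟩ := exists_primitive_of_mem_sobolev hq
  set P : ℝ → E := fun x => c + ∫ t in (0 : ℝ)..x, q.2 t with hP
  have hg := locallyIntegrable_coe q.2
  have hsymm : ∀ x y, reForm H x y = reForm H y x := fun x y => by
    rw [reForm_apply, reForm_apply, hH, ← inner_conj_symm, Complex.conj_re]
  have hi : Integrable fun x => reForm H (P x) (q.2 x) :=
    (integrable_reForm H q.1 q.2).congr (by filter_upwards [hc] with x hx; rw [hx])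
  have hi2 : Integrable fun x => reForm H (P x) (P x) :=
    (integrable_reForm H q.1 q.1).congr (by filter_upwards [hc] with x hx; rw [hx])
  have hint : ∫ x, reForm H (q.1 x) (q.2 x) = ∫ x, reForm H (P x) (q.2 x) :=
    integral_congr_ae (by filter_upwards [hc] with x hx; rw [hx])
  have key : ∀ a b : ℝ, ∫ x in a..b, reForm H (P x) (q.2 x)
      = (reForm H (P b) (P b) - reForm H (P a) (P a)) / 2 := fun a b => by
    have h := integral_bilinear_primitive (reForm H) hg hg c c a b
    have e : ∀ x, reForm H (P x) (q.2 x) + reForm H (q.2 x) (P x)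
        = 2 * reForm H (P x) (q.2 x) := fun x => by rw [hsymm (q.2 x)]; ring
    change ∫ x in a..b, (reForm H (P x) (q.2 x) + reForm H (q.2 x) (P x))
      = reForm H (P b) (P b) - reForm H (P a) (P a) at h
    simp only [e] at h
    rw [intervalIntegral.integral_const_mul] at h
    linarith
  have htop : Tendsto (fun b => reForm H (P b) (P b)) atTop
      (𝓝 (reForm H (P 0) (P 0) + 2 * ∫ x in Set.Ioi 0, reForm H (P x) (q.2 x))) := by
    have h := intervalIntegral_tendsto_integral_Ioi 0 hi.integrableOn tendsto_id
    refine ((h.const_mul 2).const_add (reForm H (P 0) (P 0))).congr fun b => ?_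
    simp only [id, key]; ring
  have hbot : Tendsto (fun b => reForm H (P b) (P b)) atBot
      (𝓝 (reForm H (P 0) (P 0) - 2 * ∫ x in Set.Iic 0, reForm H (P x) (q.2 x))) := by
    have h := intervalIntegral_tendsto_integral_Iic 0 hi.integrableOn tendsto_id
    refine ((h.const_mul 2).const_sub (reForm H (P 0) (P 0))).congr fun b => ?_
    simp only [id, key]; ring
  -- The quadratic form is integrable and has limits at both ends, since its derivative is
  -- integrable; both limits must therefore be zero.
  have z1 := IntegrableAtFilter.eq_zero_of_tendsto (hi2.integrableAtFilter atTop)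
    (fun s hs => by
      obtain ⟨b, hb⟩ := mem_atTop_sets.1 hs
      exact top_le_iff.1 (Real.volume_Ici (a := b) ▸ measure_mono hb)) htop
  have z2 := IntegrableAtFilter.eq_zero_of_tendsto (hi2.integrableAtFilter atBot)
    (fun s hs => by
      obtain ⟨b, hb⟩ := mem_atBot_sets.1 hs
      exact top_le_iff.1 (Real.volume_Iic (a := b) ▸ measure_mono hb)) hbot
  rw [hint, ← intervalIntegral.integral_Iic_add_Ioi hi.integrableOn hi.integrableOn (b := 0)]
  linarith

/-! #### Point evaluation -/

theorem memLp_indicator_smul {k : ℝ → ℝ} (hk : Continuous k) (a b : ℝ) (e : E) :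
    MemLp (fun x => (Set.Ioc a b).indicator k x • e) 2 (volume : Measure ℝ) := by
  have : (fun x => (Set.Ioc a b).indicator k x • e)
      = (Set.Ioc a b).indicator fun x => k x • e := by
    ext x; by_cases hx : x ∈ Set.Ioc a b <;> simp [hx]
  rw [this, memLp_indicator_iff_restrict measurableSet_Ioc]
  obtain ⟨C, hC⟩ := (isCompact_Icc (a := a) (b := b)).exists_bound_of_continuousOn
    (hk.smul (continuous_const (y := e))).continuousOn
  have : IsFiniteMeasure ((volume : Measure ℝ).restrict (Set.Ioc a b)) :=
    ⟨by simp⟩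
  refine MemLp.of_bound (hk.smul continuous_const).aestronglyMeasurable C ?_
  exact (ae_restrict_iff' measurableSet_Ioc).2
    (Eventually.of_forall fun x hx => hC x (Set.Ioc_subset_Icc_self hx))

variable [FiniteDimensional ℂ E]

/-- Integration against a continuous function over an interval, as a functional on `L²`. -/
def weightedIntegral {k : ℝ → ℝ} (hk : Continuous k) (a b : ℝ) :
    Lp E 2 (volume : Measure ℝ) →L[ℂ] E :=
  ∑ i, (innerSL ℂ ((memLp_indicator_smul hk a b (stdOrthonormalBasis ℂ E i)).toLp _)).smulRight
    (stdOrthonormalBasis ℂ E i)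

theorem weightedIntegral_apply [CompleteSpace E] {k : ℝ → ℝ} (hk : Continuous k) {a b : ℝ}
    (hab : a ≤ b) (u : Lp E 2 (volume : Measure ℝ)) :
    weightedIntegral hk a b u = ∫ x in a..b, k x • u x := by
  have e : (fun x => (Set.Ioc a b).indicator k x • u x)
      = (Set.Ioc a b).indicator fun x => k x • u x := by
    ext x; by_cases hx : x ∈ Set.Ioc a b <;> simp [hx]
  have hi : Integrable fun x => (Set.Ioc a b).indicator k x • u x := by
    rw [e, integrable_indicator_iff measurableSet_Ioc]
    exact (intervalIntegrable_iff_integrableOn_Ioc_of_le hab).1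
      (((locallyIntegrable_coe u).intervalIntegrable a b).continuousOn_smul hk.continuousOn)
  have h : ∫ x, (Set.Ioc a b).indicator k x • u x = ∫ x in a..b, k x • u x := by
    rw [e, integral_indicator measurableSet_Ioc, intervalIntegral.integral_of_le hab]
  rw [weightedIntegral, ← h, ← (stdOrthonormalBasis ℂ E).sum_repr' (∫ x, _)]
  simp only [sum_apply, ContinuousLinearMap.smulRight_apply, innerSL_apply_apply]
  exact Finset.sum_congr rfl fun i _ => by rw [inner_toLp_smul _ _ hi]

/-- The value at `x₀` of the continuous representative of an `H¹` function. -/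
def pointEval (x₀ : ℝ) : sobolev E →L[ℂ] E :=
  (weightedIntegral (k := fun _ => 1) continuous_const x₀ (x₀ + 1)).comp
      ((ContinuousLinearMap.fst ℂ _ _).comp (sobolev E).subtypeL)
    + (weightedIntegral (k := fun y => y - (x₀ + 1)) (by fun_prop) x₀ (x₀ + 1)).comp
      ((ContinuousLinearMap.snd ℂ _ _).comp (sobolev E).subtypeL)

/-- Integrating the derivative of `(y - (x₀ + 1)) u(y)` over `[x₀, x₀ + 1]` gives `u(x₀) = ∫ u + ∫
(y - (x₀ + 1)) u'`: the weight has derivative one, vanishes at the right end and is `-1` at the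
left. In this form evaluation is continuous in the graph norm. -/
theorem ae_eq_pointEval [CompleteSpace E] (x₀ : ℝ) (q : sobolev E) :
    q.1.1 =ᵐ[volume] fun x => pointEval x₀ q + ∫ t in x₀..x, q.1.2 t := by
  obtain ⟨c, hc⟩ := exists_primitive_of_mem_sobolev q.2
  have hg := locallyIntegrable_coe q.1.2
  have hi := hg.intervalIntegrable
  have hPc := continuous_const_add_primitive hg c 0
  have key : pointEval x₀ q = c + ∫ t in (0 : ℝ)..x₀, q.1.2 t := by
    have h := integral_bilinear_primitive (ContinuousLinearMap.lsmul ℝ ℝ : ℝ →L[ℝ] E →L[ℝ] E)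
      (locallyIntegrable_const (1 : ℝ)) hg (-(x₀ + 1)) c x₀ (x₀ + 1)
    have e : ∀ x : ℝ, -(x₀ + 1) + ∫ _ in (0 : ℝ)..x, (1 : ℝ) = x - (x₀ + 1) := fun x => by
      rw [intervalIntegral.integral_const]; simp; ring
    simp only [e, ContinuousLinearMap.lsmul_apply, sub_self, zero_smul, zero_sub] at h
    rw [intervalIntegral.integral_add ((hi _ _).continuousOn_smul (by fun_prop))
      ((hPc.intervalIntegrable _ _).continuousOn_smul (by fun_prop))] at h
    have e1 : ∫ x in x₀..(x₀ + 1), (1 : ℝ) • q.1.1 x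
        = ∫ x in x₀..(x₀ + 1), (1 : ℝ) • (c + ∫ t in (0 : ℝ)..x, q.1.2 t) :=
      intervalIntegral.integral_congr_ae (by
        filter_upwards [hc] with x hx _
        rw [hx])
    simp only [pointEval, add_apply, ContinuousLinearMap.comp_apply,
      Submodule.subtypeL_apply, ContinuousLinearMap.coe_fst', ContinuousLinearMap.coe_snd']
    rw [weightedIntegral_apply _ (by linarith), weightedIntegral_apply _ (by linarith), e1,
      add_comm, h, ← neg_smul]
    simp
  rw [key]
  filter_upwards [hc] with x hx
  rw [hx, add_assoc, intervalIntegral.integral_add_adjacent_intervals (hi _ _) (hi _ _)]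

end Sobolev

/-! ### Fredholm operators of index zero -/

section FredholmZero

/-- A linear map is Fredholm of index zero: finite-dimensional kernel, closed range of the same
finite codimension. -/
structure IsFredholmZero {X Y : Type*} [AddCommGroup X] [Module ℂ X] [NormedAddCommGroup Y]
    [NormedSpace ℂ Y] (f : X →ₗ[ℂ] Y) : Prop where
  finite_ker : FiniteDimensional ℂ (LinearMap.ker f)
  isClosed_range : IsClosed (LinearMap.range f : Set Y)
  finite_coker : FiniteDimensional ℂ (Y ⧸ LinearMap.range f)
  finrank_eq : Module.finrank ℂ (LinearMap.ker f) = Module.finrank ℂ (Y ⧸ LinearMap.range f)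

variable {X Y : Type*}

/-- The map `f` induces `F : X ⧸ X₀ → Y ⧸ f(X₀)` between spaces of the same finite dimension.
Injectivity on `X₀` makes the kernels of `f` and `F` isomorphic, the cokernels always are, and
rank-nullity for `F` gives index zero. -/
theorem isFredholmZero_of_restrict [AddCommGroup X] [Module ℂ X] [NormedAddCommGroup Y]
    [NormedSpace ℂ Y] {f : X →ₗ[ℂ] Y} {X₀ : Submodule ℂ X} [FiniteDimensional ℂ (X ⧸ X₀)]
    (hinj : ∀ x ∈ X₀, f x = 0 → x = 0) (hcl : IsClosed (X₀.map f : Set Y))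
    (hfin : FiniteDimensional ℂ (Y ⧸ X₀.map f))
    (hdim : Module.finrank ℂ (Y ⧸ X₀.map f) = Module.finrank ℂ (X ⧸ X₀)) :
    IsFredholmZero f := by
  have hle : X₀.map f ≤ LinearMap.range f := LinearMap.map_le_range
  set F : (X ⧸ X₀) →ₗ[ℂ] (Y ⧸ X₀.map f) := X₀.mapQ (X₀.map f) f (Submodule.le_comap_map f X₀)
    with hF
  let k : LinearMap.ker f →ₗ[ℂ] LinearMap.ker F :=
    LinearMap.codRestrict (LinearMap.ker F) (X₀.mkQ.comp (LinearMap.ker f).subtype) (fun x => by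
      rw [LinearMap.mem_ker, LinearMap.comp_apply, hF, Submodule.mkQ_apply, Submodule.mapQ_apply,
        Submodule.subtype_apply, LinearMap.mem_ker.1 x.2, Submodule.Quotient.mk_zero])
  have kinj : Function.Injective k := by
    rw [← LinearMap.ker_eq_bot, LinearMap.ker_eq_bot']
    intro x hx
    have h1 : X₀.mkQ x.1 = 0 := congrArg Subtype.val hx
    rw [Submodule.mkQ_apply, Submodule.Quotient.mk_eq_zero] at h1
    exact Subtype.ext (hinj _ h1 x.2)
  have ksurj : Function.Surjective k := by
    rintro ⟨y, hy⟩
    obtain ⟨x, rfl⟩ := X₀.mkQ_surjective y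
    rw [LinearMap.mem_ker, hF, Submodule.mkQ_apply, Submodule.mapQ_apply,
      Submodule.Quotient.mk_eq_zero] at hy
    obtain ⟨x₀, hx₀, hfx⟩ := hy
    refine ⟨⟨x - x₀, by rw [LinearMap.mem_ker, map_sub, hfx, sub_self]⟩, Subtype.ext ?_⟩
    change X₀.mkQ (x - x₀) = X₀.mkQ x
    rw [map_sub, sub_eq_self, Submodule.mkQ_apply, Submodule.Quotient.mk_eq_zero]
    exact hx₀
  have kfin : FiniteDimensional ℂ (LinearMap.ker f) := FiniteDimensional.of_injective k kinj
  have kdim : Module.finrank ℂ (LinearMap.ker f) = Module.finrank ℂ (LinearMap.ker F) :=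
    (LinearEquiv.ofBijective k ⟨kinj, ksurj⟩).finrank_eq
  have hr : LinearMap.range F = (LinearMap.range f).map (X₀.map f).mkQ := by
    rw [hF, Submodule.range_mapQ]
  let e := Submodule.quotientQuotientEquivQuotient (X₀.map f) (LinearMap.range f) hle
  have cfin : FiniteDimensional ℂ (Y ⧸ LinearMap.range f) := e.finiteDimensional
  refine ⟨kfin, Submodule.isClosed_mono_of_finiteDimensional_quotient hcl hle, cfin, ?_⟩
  have h1 := LinearMap.finrank_range_add_finrank_ker F
  have h2 := Submodule.finrank_quotient_add_finrank (LinearMap.range F)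
  have h3 := e.finrank_eq
  rw [← hr] at h3
  omega

theorem isClosed_map_of_le_norm [NormedAddCommGroup X] [NormedSpace ℂ X] [CompleteSpace X]
    [NormedAddCommGroup Y] [NormedSpace ℂ Y] {T : X →L[ℂ] Y} {X₀ : Submodule ℂ X} (hX₀ : IsClosed (X₀ : Set X))
    {C : ℝ} (hT : ∀ x ∈ X₀, ‖x‖ ≤ C * ‖T x‖) : IsClosed (X₀.map T.toLinearMap : Set Y) := by
  have : CompleteSpace X₀ := hX₀.completeSpace_coe
  have h : AntilipschitzWith (Real.toNNReal C) (T.comp X₀.subtypeL) :=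
    AddMonoidHomClass.antilipschitz_of_bound _ fun x =>
      (hT x x.2).trans (mul_le_mul_of_nonneg_right (Real.le_coe_toNNReal C) (norm_nonneg _))
  have hc := h.isClosed_range (T.comp X₀.subtypeL).uniformContinuous
  convert hc using 1
  ext y
  simp

/-- A vector `A x` orthogonal to the image of `B` is orthogonal to `B x`. Pythagoras then gives `‖A
x‖ ≤ ‖A x - B x‖ ≤ θ ‖A x‖` with `θ < 1`. -/
theorem eq_zero_of_mem_map_of_mem_orthogonal [AddCommGroup X] [Module ℂ X]
    [NormedAddCommGroup Y] [InnerProductSpace ℂ Y] {A B : X →ₗ[ℂ] Y}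
    {X₀ : Submodule ℂ X} {θ : ℝ} (hθ : θ < 1) (h : ∀ x ∈ X₀, ‖A x - B x‖ ≤ θ * ‖A x‖) :
    ∀ y ∈ X₀.map A, y ∈ (X₀.map B)ᗮ → y = 0 := by
  rintro _ ⟨x, hx, rfl⟩ hy
  have h0 : inner ℂ (B x) (A x) = 0 := hy _ ⟨x, hx, rfl⟩
  have h1 : ‖A x - B x‖ ^ 2 = ‖A x‖ ^ 2 + ‖B x‖ ^ 2 := by
    rw [norm_sub_sq (𝕜 := ℂ), inner_eq_zero_symm.1 h0]
    simp
  have h2 := h x hx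
  have h3 : ‖A x‖ ≤ ‖A x - B x‖ :=
    abs_le_of_sq_le_sq' (by nlinarith [sq_nonneg ‖B x‖]) (norm_nonneg _) |>.2
  have h4 : ‖A x‖ = 0 := by nlinarith [norm_nonneg (A x)]
  exact norm_eq_zero.1 h4

variable [NormedAddCommGroup Y] [InnerProductSpace ℂ Y] [CompleteSpace Y]

/-- For closed `S` the quotient `Y ⧸ S` is isomorphic to `Sᗮ`, which embeds in `Y ⧸ R` because it
meets `R` only in zero. -/
theorem finrank_quotient_le_of_inf_orthogonal {R S : Submodule ℂ Y} (hS : IsClosed (S : Set Y))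
    [FiniteDimensional ℂ (Y ⧸ R)] (h : ∀ y ∈ R, y ∈ Sᗮ → y = 0) :
    FiniteDimensional ℂ (Y ⧸ S) ∧ Module.finrank ℂ (Y ⧸ S) ≤ Module.finrank ℂ (Y ⧸ R) := by
  have : CompleteSpace S := hS.completeSpace_coe
  let e : (Y ⧸ S) ≃ₗ[ℂ] Sᗮ := Submodule.quotientEquivOfIsCompl S Sᗮ S.isCompl_orthogonal
  let k : Sᗮ →ₗ[ℂ] Y ⧸ R := R.mkQ.comp Sᗮ.subtype
  have kinj : Function.Injective k := by
    rw [← LinearMap.ker_eq_bot, LinearMap.ker_eq_bot']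
    intro x hx
    have h1 : R.mkQ x.1 = 0 := hx
    rw [Submodule.mkQ_apply, Submodule.Quotient.mk_eq_zero] at h1
    exact Subtype.ext (h _ h1 x.2)
  have : FiniteDimensional ℂ Sᗮ := FiniteDimensional.of_injective k kinj
  exact ⟨e.symm.finiteDimensional, e.finrank_eq ▸ LinearMap.finrank_le_finrank_of_injective kinj⟩

variable [NormedAddCommGroup X] [NormedSpace ℂ X] [CompleteSpace X]

/-- Deforming a bijective operator through operators that are bounded below on a common closed
subspace of finite codimension produces a Fredholm operator of index zero. -/
theorem isFredholmZero_of_path {T : ℕ → X →L[ℂ] Y} {X₀ : Submodule ℂ X}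
    (hX₀ : IsClosed (X₀ : Set X)) [FiniteDimensional ℂ (X ⧸ X₀)] {C θ : ℝ} (hθ : θ < 1)
    (hC : ∀ k, ∀ x ∈ X₀, ‖x‖ ≤ C * ‖T k x‖)
    (hl : ∀ k, ∀ x ∈ X₀, ‖T k x - T (k + 1) x‖ ≤ θ * ‖T k x‖)
    (hr : ∀ k, ∀ x ∈ X₀, ‖T k x - T (k + 1) x‖ ≤ θ * ‖T (k + 1) x‖)
    (h0 : Function.Bijective (T 0)) (n : ℕ) : IsFredholmZero (T n).toLinearMap := by
  have hcl := fun k => isClosed_map_of_le_norm hX₀ (hC k)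
  have key : FiniteDimensional ℂ (Y ⧸ X₀.map (T n).toLinearMap) ∧
      Module.finrank ℂ (Y ⧸ X₀.map (T n).toLinearMap) = Module.finrank ℂ (X ⧸ X₀) := by
    induction n with
    | zero =>
      let e : X ≃ₗ[ℂ] Y := LinearEquiv.ofBijective (T 0).toLinearMap h0
      let E : (X ⧸ X₀) ≃ₗ[ℂ] Y ⧸ X₀.map (T 0).toLinearMap :=
        Submodule.Quotient.equiv X₀ (X₀.map (T 0).toLinearMap) e rfl
      exact ⟨E.finiteDimensional, E.finrank_eq.symm⟩
    | succ k ih =>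
      obtain ⟨ih1, ih2⟩ := ih
      -- The comparison is made in both directions, once with `hl` and once with `hr`, so the
      -- codimension of the image of `X₀` is the same at `k` and `k + 1`.
      obtain ⟨f1, f2⟩ := finrank_quotient_le_of_inf_orthogonal (hcl (k + 1))
        (eq_zero_of_mem_map_of_mem_orthogonal hθ (hl k))
      obtain ⟨g1, g2⟩ := finrank_quotient_le_of_inf_orthogonal (hcl k)
        (eq_zero_of_mem_map_of_mem_orthogonal (A := (T (k + 1)).toLinearMap) hθ (fun x hx => by
          rw [norm_sub_rev]; exact hr k x hx))
      exact ⟨f1, by omega⟩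
  refine isFredholmZero_of_restrict (fun x hx h => ?_) (hcl n) key.1 key.2
  have := hC n x hx
  rw [show T n x = 0 from h, norm_zero, mul_zero] at this
  exact norm_le_zero_iff.1 this

end FredholmZero

/-! ### First-order systems on the line -/

section Systems

variable {E : Type*} [NormedAddCommGroup E] [InnerProductSpace ℂ E]

variable (E) in
/-- Bounded measurable coefficient matrices. -/
def BddCoeff : Type _ :=
  {M : ℝ → E →L[ℂ] E // StronglyMeasurable M ∧ ∃ C, ∀ x, ‖M x‖ ≤ C}

instance : CoeFun (BddCoeff E) fun _ => ℝ → E →L[ℂ] E := ⟨Subtype.val⟩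

theorem BddCoeff.memLp_apply (M : BddCoeff E) (u : Lp E 2 (volume : Measure ℝ)) :
    MemLp (fun x => M x (u x)) 2 (volume : Measure ℝ) := by
  obtain ⟨C, hC⟩ := M.2.2
  refine (Lp.memLp u).of_le_mul (c := C) ?_ (Eventually.of_forall fun x =>
    (M x).le_of_opNorm_le (hC x) _)
  exact (ContinuousLinearMap.id ℂ (E →L[ℂ] E)).aestronglyMeasurable_comp₂
    M.2.1.aestronglyMeasurable (Lp.aestronglyMeasurable u)

/-- Multiplication by a bounded coefficient matrix on `L²`. -/
def mulOp (M : BddCoeff E) :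
    Lp E 2 (volume : Measure ℝ) →L[ℂ] Lp E 2 (volume : Measure ℝ) :=
  LinearMap.mkContinuousOfExistsBound
    { toFun := fun u => (M.memLp_apply u).toLp _
      map_add' := fun u v => by
        rw [← MemLp.toLp_add, MemLp.toLp_eq_toLp_iff]
        filter_upwards [Lp.coeFn_add u v] with x hx
        rw [hx, Pi.add_apply, Pi.add_apply, map_add]
      map_smul' := fun c u => by
        rw [RingHom.id_apply, ← MemLp.toLp_const_smul, MemLp.toLp_eq_toLp_iff]
        filter_upwards [Lp.coeFn_smul c u] with x hx
        rw [hx, Pi.smul_apply, Pi.smul_apply, map_smul] }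
    (by
      obtain ⟨C, hC⟩ := M.2.2
      refine ⟨C, fun u => Lp.norm_le_mul_norm_of_ae_le_mul ?_⟩
      filter_upwards [(M.memLp_apply u).coeFn_toLp] with x hx
      change ‖(M.memLp_apply u).toLp _ x‖ ≤ _
      rw [hx]
      exact (M x).le_of_opNorm_le (hC x) _)

theorem coeFn_mulOp (M : BddCoeff E) (u : Lp E 2 (volume : Measure ℝ)) :
    mulOp M u =ᵐ[volume] fun x => M x (u x) :=
  (M.memLp_apply u).coeFn_toLp

theorem norm_mulOp_le {M : BddCoeff E} {C : ℝ} (hC : ∀ x, ‖M x‖ ≤ C)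
    (u : Lp E 2 (volume : Measure ℝ)) : ‖mulOp M u‖ ≤ C * ‖u‖ := by
  refine Lp.norm_le_mul_norm_of_ae_le_mul ?_
  filter_upwards [coeFn_mulOp M u] with x hx
  rw [hx]
  exact (M x).le_of_opNorm_le (hC x) _

theorem norm_mulOp_sub_le {M N : BddCoeff E} {C : ℝ} (hC : ∀ x, ‖M x - N x‖ ≤ C)
    (u : Lp E 2 (volume : Measure ℝ)) : ‖mulOp M u - mulOp N u‖ ≤ C * ‖u‖ := by
  refine Lp.norm_le_mul_norm_of_ae_le_mul ?_
  filter_upwards [coeFn_mulOp M u, coeFn_mulOp N u, Lp.coeFn_sub (mulOp M u) (mulOp N u)]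
    with x h1 h2 h3
  rw [h3, Pi.sub_apply, h1, h2, ← sub_apply]
  exact (M x - N x).le_of_opNorm_le (hC x) _

/-- The operator `u ↦ u' - M u` from `H¹` to `L²`. -/
def diffOp (M : BddCoeff E) : sobolev E →L[ℂ] Lp E 2 (volume : Measure ℝ) :=
  (ContinuousLinearMap.snd ℂ _ _).comp (sobolev E).subtypeL
    - (mulOp M).comp ((ContinuousLinearMap.fst ℂ _ _).comp (sobolev E).subtypeL)

theorem diffOp_apply (M : BddCoeff E) (q : sobolev E) : diffOp M q = q.1.2 - mulOp M q.1.1 := rfl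

/-- Since `u' = (u' - M u) + M u`, control of `u` in `L²` also controls `u'`, hence the graph norm.
-/
theorem exists_norm_le_diffOp {M : BddCoeff E} {K c : ℝ} (hK : ∀ x, ‖M x‖ ≤ K) (hc : 0 < c)
    {q : sobolev E} (h : c * ‖q.1.1‖ ≤ ‖diffOp M q‖) :
    ‖q‖ ≤ (1 + (K + 1) / c) * ‖diffOp M q‖ := by
  have hK0 : 0 ≤ K := (norm_nonneg _).trans (hK 0)
  have h1 : ‖q.1.1‖ ≤ ‖diffOp M q‖ / c := by rw [le_div_iff₀ hc, mul_comm]; exact h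
  have h2 : ‖q.1.2‖ ≤ ‖diffOp M q‖ + K * ‖q.1.1‖ := by
    have e : q.1.2 = diffOp M q + mulOp M q.1.1 := by rw [diffOp_apply]; abel
    rw [e]
    exact (norm_add_le _ _).trans (add_le_add le_rfl (norm_mulOp_le hK _))
  have h3 : K * ‖q.1.1‖ ≤ K * (‖diffOp M q‖ / c) := mul_le_mul_of_nonneg_left h1 hK0
  have h4 : (1 + (K + 1) / c) * ‖diffOp M q‖
      = ‖diffOp M q‖ + K * (‖diffOp M q‖ / c) + ‖diffOp M q‖ / c := by ring
  have h5 : 0 ≤ ‖diffOp M q‖ / c := by positivity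
  have h6 : 0 ≤ K * (‖diffOp M q‖ / c) := by positivity
  rw [h4]
  refine max_le (?_ : ‖q.1.1‖ ≤ _) (?_ : ‖q.1.2‖ ≤ _)
  · linarith [norm_nonneg (diffOp M q)]
  · linarith

/-- A constant coefficient matrix. -/
def constCoeff (A : E →L[ℂ] E) : BddCoeff E :=
  ⟨fun _ => A, stronglyMeasurable_const, ‖A‖, fun _ => le_rfl⟩

/-- A matrix without purely imaginary eigenvalues. -/
def IsHyperbolic (A : E →L[ℂ] E) : Prop :=
  ∀ (t : ℝ) (x : E), A x = ((t : ℂ) * Complex.I) • x → x = 0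

theorem mulOp_constCoeff (A : E →L[ℂ] E) (u : Lp E 2 (volume : Measure ℝ)) :
    mulOp (constCoeff A) u = A.compLp u := by
  refine Lp.ext ?_
  filter_upwards [coeFn_mulOp (constCoeff A) u, A.coeFn_compLp u] with x h1 h2
  rw [h1, h2]; rfl

variable [CompleteSpace E]

/-- The coefficient `x ↦ -(M x)†` of the adjoint system. -/
def BddCoeff.negAdjoint (M : BddCoeff E) : BddCoeff E :=
  ⟨fun x => -ContinuousLinearMap.adjoint (M x),
    (ContinuousLinearMap.adjoint.continuous.comp_stronglyMeasurable M.2.1).neg, by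
      obtain ⟨C, hC⟩ := M.2.2
      exact ⟨C, fun x => by rw [norm_neg, LinearIsometryEquiv.norm_map]; exact hC x⟩⟩

theorem inner_mulOp (M : BddCoeff E) (u v : Lp E 2 (volume : Measure ℝ)) :
    inner ℂ (mulOp M u) v = -inner ℂ u (mulOp M.negAdjoint v) := by
  rw [L2.inner_def, L2.inner_def, ← integral_neg]
  refine integral_congr_ae ?_
  filter_upwards [coeFn_mulOp M u, coeFn_mulOp M.negAdjoint v] with x h1 h2
  rw [h1, h2]
  simp [BddCoeff.negAdjoint, ContinuousLinearMap.adjoint_inner_right]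

/-- Solvability of `u' - M u = f` follows from lower bounds for the system and its adjoint. -/
theorem bijective_diffOp {M : BddCoeff E} {c : ℝ} (hc : 0 < c)
    (h₁ : ∀ q : sobolev E, c * ‖q.1.1‖ ≤ ‖diffOp M q‖)
    (h₂ : ∀ q : sobolev E, c * ‖q.1.1‖ ≤ ‖diffOp M.negAdjoint q‖) :
    Function.Bijective (diffOp M) := by
  obtain ⟨K, hK⟩ := M.2.2
  have hb : ∀ q, ‖q‖ ≤ (1 + (K + 1) / c) * ‖diffOp M q‖ := fun q =>
    exists_norm_le_diffOp hK hc (h₁ q)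
  have hcl : IsClosed (LinearMap.range (diffOp M).toLinearMap :
      Set (Lp E 2 (volume : Measure ℝ))) := by
    have := isClosed_map_of_le_norm (T := diffOp M) (X₀ := ⊤) isClosed_univ fun x _ => hb x
    rwa [Submodule.map_top] at this
  refine ⟨?_, ?_⟩
  · refine (injective_iff_map_eq_zero _).2 fun q hq => ?_
    have := hb q
    rw [hq, norm_zero, mul_zero] at this
    exact norm_le_zero_iff.1 this
  · rw [← ContinuousLinearMap.coe_coe, ← LinearMap.range_eq_top]
    have : CompleteSpace (LinearMap.range (diffOp M).toLinearMap) := hcl.completeSpace_coe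
    rw [← Submodule.orthogonal_eq_bot_iff, Submodule.eq_bot_iff]
    intro h hh
    -- If `h` is orthogonal to the range, pairing with test functions says that `h` has weak
    -- derivative `-M† h`. Thus `h` is in `H¹`, solves the adjoint system, and vanishes by `h₂`.
    have hmem : ((h, mulOp M.negAdjoint h) :
        Lp E 2 (volume : Measure ℝ) × Lp E 2 (volume : Measure ℝ)) ∈ sobolev E := by
      rw [mem_sobolev_iff_inner]
      intro η hη hηc e
      have h0 : inner ℂ (diffOp M ⟨_, test_mem_sobolev hη hηc e⟩) h = 0 := hh _ ⟨_, rfl⟩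
      rw [diffOp_apply, inner_sub_left, inner_mulOp, sub_neg_eq_add] at h0
      exact h0
    have h3 := h₂ ⟨_, hmem⟩
    rw [diffOp_apply, sub_self, norm_zero] at h3
    have h4 : ‖h‖ ≤ 0 := by
      by_contra! hpos
      have := mul_pos hc hpos
      change c * ‖h‖ ≤ 0 at h3
      linarith
    exact norm_le_zero_iff.1 h4

/-! #### Energy estimates -/

theorem re_inner_compLp_eq_zero (q : sobolev E) {H : E →L[ℂ] E}
    (hH : ∀ x y, inner ℂ (H x) y = inner ℂ x (H y)) :
    (inner ℂ (H.compLp q.1.1) q.1.2).re = 0 := by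
  rw [← integral_reForm_eq_zero q.2 H hH, L2.inner_def]
  have := integral_re (𝕜 := ℂ) (L2.integrable_inner (𝕜 := ℂ) (H.compLp q.1.1) q.1.2)
  refine this.symm.trans (integral_congr_ae ?_)
  filter_upwards [H.coeFn_compLp q.1.1] with x hx
  rw [hx, reForm_apply]; rfl

/-- The equation is paired with `H u`: the term `Re ⟪H u, u'⟫` integrates to zero, leaving only the
coercive term. -/
theorem le_norm_diffOp_of_coercive {M : BddCoeff E} {H : E →L[ℂ] E} {c : ℝ}
    (hH : ∀ x y, inner ℂ (H x) y = inner ℂ x (H y))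
    (h : ∀ x e, c * ‖e‖ ^ 2 ≤ (inner ℂ (H e) (M x e)).re) (q : sobolev E) :
    c * ‖q.1.1‖ ≤ ‖H‖ * ‖diffOp M q‖ := by
  have h0 := re_inner_compLp_eq_zero q hH
  have h1 : c * ‖q.1.1‖ ^ 2 ≤ (inner ℂ (H.compLp q.1.1) (mulOp M q.1.1)).re := by
    have e1 : (inner ℂ (H.compLp q.1.1) (mulOp M q.1.1)).re
        = ∫ x, (inner ℂ (H.compLp q.1.1 x) (mulOp M q.1.1 x)).re := by
      rw [L2.inner_def]
      exact (integral_re (𝕜 := ℂ) (L2.integrable_inner (𝕜 := ℂ) _ _)).symm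
    have e2 : ‖q.1.1‖ ^ 2 = ∫ x, ‖q.1.1 x‖ ^ 2 := by
      have := L2.inner_def (𝕜 := ℂ) q.1.1 q.1.1
      rw [inner_self_eq_norm_sq_to_K] at this
      simp only [inner_self_eq_norm_sq_to_K] at this
      have e3 : ∫ x, ((‖q.1.1 x‖ : ℂ)) ^ 2 = ((∫ x, ‖q.1.1 x‖ ^ 2 : ℝ) : ℂ) := by
        rw [← integral_complex_ofReal]; simp
      exact Complex.ofReal_injective (by
        rw [← e3]; push_cast; exact this)
    rw [e1, e2, ← integral_const_mul]
    refine integral_mono_ae ?_ ?_ ?_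
    · have := (memLp_two_iff_integrable_sq_norm (Lp.aestronglyMeasurable q.1.1)).1
        (Lp.memLp q.1.1)
      exact this.const_mul c
    · exact (L2.integrable_inner (𝕜 := ℂ) (H.compLp q.1.1) (mulOp M q.1.1)).re
    · filter_upwards [H.coeFn_compLp q.1.1, coeFn_mulOp M q.1.1] with x hx hx'
      rw [hx, hx']
      exact h x _
  have h2 : (inner ℂ (H.compLp q.1.1) (diffOp M q)).re
      = -(inner ℂ (H.compLp q.1.1) (mulOp M q.1.1)).re := by
    rw [diffOp_apply, inner_sub_right, Complex.sub_re, h0, zero_sub]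
  have h3 : -(inner ℂ (H.compLp q.1.1) (diffOp M q)).re ≤ ‖H‖ * ‖q.1.1‖ * ‖diffOp M q‖ :=
    calc _ ≤ ‖(inner ℂ (H.compLp q.1.1) (diffOp M q) : ℂ)‖ :=
          (neg_le_abs _).trans (Complex.abs_re_le_norm _)
      _ ≤ ‖H.compLp q.1.1‖ * ‖diffOp M q‖ := norm_inner_le_norm _ _
      _ ≤ _ := mul_le_mul_of_nonneg_right (H.norm_compLp_le _) (norm_nonneg _)
  rcases (norm_nonneg q.1.1).eq_or_lt with h4 | h4
  · rw [← h4, mul_zero]; positivity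
  · refine le_of_mul_le_mul_right ?_ h4
    calc c * ‖q.1.1‖ * ‖q.1.1‖ = c * ‖q.1.1‖ ^ 2 := by ring
      _ ≤ ‖H‖ * ‖q.1.1‖ * ‖diffOp M q‖ := by linarith
      _ = _ := by ring

theorem bijective_diffOp_of_coercive {M : BddCoeff E} {H H' : E →L[ℂ] E} {c : ℝ} (hc : 0 < c)
    (hH : ∀ x y, inner ℂ (H x) y = inner ℂ x (H y))
    (hH' : ∀ x y, inner ℂ (H' x) y = inner ℂ x (H' y))
    (h : ∀ x e, c * ‖e‖ ^ 2 ≤ (inner ℂ (H e) (M x e)).re)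
    (h' : ∀ x e, c * ‖e‖ ^ 2 ≤ (inner ℂ (H' e) (M.negAdjoint x e)).re) :
    Function.Bijective (diffOp M) := by
  set k := ‖H‖ + ‖H'‖ + 1
  have hk : 0 < k := by positivity
  refine bijective_diffOp (div_pos hc hk) (fun q => ?_) (fun q => ?_)
  · rw [div_mul_eq_mul_div, div_le_iff₀ hk]
    have := le_norm_diffOp_of_coercive hH h q
    nlinarith [norm_nonneg H', norm_nonneg (diffOp M q), norm_nonneg H]
  · rw [div_mul_eq_mul_div, div_le_iff₀ hk]
    have := le_norm_diffOp_of_coercive hH' h' q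
    nlinarith [norm_nonneg H', norm_nonneg (diffOp M.negAdjoint q), norm_nonneg H]

/-! #### Constant hyperbolic coefficients -/

theorem compLp_mem_sobolev {F : Type*} [NormedAddCommGroup F] [InnerProductSpace ℂ F]
    [CompleteSpace F] (A : E →L[ℂ] F) (q : sobolev E) :
    ((A.compLp q.1.1, A.compLp q.1.2) :
      Lp F 2 (volume : Measure ℝ) × Lp F 2 (volume : Measure ℝ)) ∈ sobolev F :=
  (WeakDeriv.clm_comp (A.restrictScalars ℝ) q.2).congr
    (EventuallyEq.symm (A.coeFn_compLp _)) (EventuallyEq.symm (A.coeFn_compLp _))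

/-- Pairing with `u` itself gives `Re ⟪u, u' - m u⟫ = -Re m ‖u‖²`. This is the scalar case of the
estimate for hyperbolic matrices. -/
theorem abs_re_mul_norm_le (m : ℂ) (q : sobolev E) :
    |m.re| * ‖q.1.1‖ ≤ ‖q.1.2 - m • q.1.1‖ := by
  have h0 := re_inner_compLp_eq_zero q (H := ContinuousLinearMap.id ℂ E) fun _ _ => rfl
  have e : (ContinuousLinearMap.id ℂ E).compLp q.1.1 = q.1.1 := by
    refine Lp.ext ?_
    filter_upwards [(ContinuousLinearMap.id ℂ E).coeFn_compLp q.1.1] with x h1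
    rw [h1]; rfl
  rw [e] at h0
  have h1 : (inner ℂ q.1.1 (q.1.2 - m • q.1.1)).re = -(m.re * ‖q.1.1‖ ^ 2) := by
    have e3 : (inner ℂ q.1.1 q.1.1 : ℂ) = ((‖q.1.1‖ ^ 2 : ℝ) : ℂ) := by
      rw [inner_self_eq_norm_sq_to_K]; simp
    rw [inner_sub_right, inner_smul_right, Complex.sub_re, h0, e3, zero_sub,
      Complex.re_mul_ofReal]
  have h2 : |m.re| * ‖q.1.1‖ ^ 2 ≤ ‖q.1.1‖ * ‖q.1.2 - m • q.1.1‖ :=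
    calc |m.re| * ‖q.1.1‖ ^ 2 = |(inner ℂ q.1.1 (q.1.2 - m • q.1.1)).re| := by
          rw [h1, abs_neg, abs_mul, abs_of_nonneg (sq_nonneg ‖q.1.1‖)]
      _ ≤ _ := (Complex.abs_re_le_norm _).trans (norm_inner_le_norm _ _)
  rcases (norm_nonneg q.1.1).eq_or_lt with h4 | h4
  · rw [← h4, mul_zero]; positivity
  · refine le_of_mul_le_mul_right ?_ h4
    linarith

/-- Induction on the roots, which replaces a spectral decomposition of `A`. If `P` is the product
over the previous roots and `f = u' - A u`, then `(P u)' - m P u = P f + (A - m) P u`. The scalar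
estimate thus bounds `P u` by `f` and the next, longer product applied to `u`. -/
theorem exists_norm_le_of_roots (A : E →L[ℂ] E) (s : Multiset ℂ) (hs : ∀ m ∈ s, m.re ≠ 0) :
    ∃ C, 0 ≤ C ∧ ∀ q : sobolev E, ‖q.1.1‖ ≤ C * (‖diffOp (constCoeff A) q‖ +
      ‖(Polynomial.aeval A (s.map fun m => Polynomial.X - Polynomial.C m).prod).compLp q.1.1‖) := by
  induction s using Multiset.induction with
  | empty =>
    refine ⟨1, zero_le_one, fun q => ?_⟩
    have e : (1 : E →L[ℂ] E).compLp q.1.1 = q.1.1 := by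
      refine Lp.ext ?_
      filter_upwards [(1 : E →L[ℂ] E).coeFn_compLp q.1.1] with x h1
      rw [h1]; rfl
    simp only [Multiset.map_zero, Multiset.prod_zero, map_one, e]
    linarith [norm_nonneg (diffOp (constCoeff A) q)]
  | cons m s ih =>
    obtain ⟨C, hC, h⟩ := ih fun m' hm' => hs m' (Multiset.mem_cons_of_mem hm')
    set P := Polynomial.aeval A (s.map fun m => Polynomial.X - Polynomial.C m).prod with hP
    have hm : 0 < |m.re| := abs_pos.2 (hs m (Multiset.mem_cons_self m s))
    have eP : Polynomial.aeval A ((m ::ₘ s).map fun m => Polynomial.X - Polynomial.C m).prod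
        = (A - m • 1) * P := by
      rw [Multiset.map_cons, Multiset.prod_cons, map_mul, ← hP]
      simp [Algebra.algebraMap_eq_smul_one]
    have comm : A * P = P * A := by
      have h1 := Polynomial.aeval_X (R := ℂ) A
      have := Commute.all (Polynomial.X : Polynomial ℂ)
        (s.map fun m => Polynomial.X - Polynomial.C m).prod
      have := congrArg (Polynomial.aeval A) this.eq
      rwa [map_mul, map_mul, h1, ← hP] at this
    refine ⟨C * (1 + (‖P‖ + 1) / |m.re|), by positivity, fun q => ?_⟩
    rw [eP]
    have hq := abs_re_mul_norm_le m ⟨_, compLp_mem_sobolev P q⟩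
    have e2 : P.compLp q.1.2 - m • P.compLp q.1.1
        = P.compLp (diffOp (constCoeff A) q) + ((A - m • 1) * P).compLp q.1.1 := by
      rw [diffOp_apply, mulOp_constCoeff]
      refine Lp.ext ?_
      filter_upwards [P.coeFn_compLp q.1.2, P.coeFn_compLp q.1.1, A.coeFn_compLp q.1.1,
        P.coeFn_compLp (q.1.2 - A.compLp q.1.1), ((A - m • 1) * P).coeFn_compLp q.1.1,
        Lp.coeFn_sub q.1.2 (A.compLp q.1.1),
        Lp.coeFn_sub (P.compLp q.1.2) (m • P.compLp q.1.1),
        Lp.coeFn_smul m (P.compLp q.1.1),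
        Lp.coeFn_add (P.compLp (q.1.2 - A.compLp q.1.1)) (((A - m • 1) * P).compLp q.1.1)]
        with x h1 h2 h3 h4 h5 h6 h7 h8 h9
      rw [h7, h9, Pi.sub_apply, Pi.add_apply, h8, Pi.smul_apply, h1, h2, h4, h5, h6, Pi.sub_apply,
        h3]
      have : P (A (q.1.1 x)) = A (P (q.1.1 x)) := congrArg (fun L : E →L[ℂ] E => L (q.1.1 x)) comm.symm
      simp [this]
    have e3 : ‖P.compLp q.1.2 - m • P.compLp q.1.1‖
        ≤ ‖P‖ * ‖diffOp (constCoeff A) q‖ + ‖((A - m • 1) * P).compLp q.1.1‖ := by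
      rw [e2]
      exact (norm_add_le _ _).trans (add_le_add (P.norm_compLp_le _) le_rfl)
    set a := ‖diffOp (constCoeff A) q‖
    set b := ‖((A - m • 1) * P).compLp q.1.1‖
    have ha : 0 ≤ a := norm_nonneg _
    have hb : 0 ≤ b := norm_nonneg _
    have e4 : ‖P.compLp q.1.1‖ ≤ (‖P‖ * a + b) / |m.re| := by
      rw [le_div_iff₀ hm, mul_comm]
      exact hq.trans e3
    have e5 : (‖P‖ * a + b) / |m.re| ≤ (‖P‖ + 1) * (a + b) / |m.re| := by
      gcongr
      nlinarith [norm_nonneg P, mul_nonneg (norm_nonneg P) hb]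
    calc ‖q.1.1‖ ≤ C * (a + ‖P.compLp q.1.1‖) := h q
      _ ≤ C * ((a + b) + (‖P‖ + 1) * (a + b) / |m.re|) := by
          gcongr
          · linarith
          · exact e4.trans e5
      _ = _ := by ring

variable [FiniteDimensional ℂ E]

/-- The preceding estimate is applied to the roots of the minimal polynomial. They are eigenvalues,
hence not imaginary, and the full product annihilates `u`. -/
theorem IsHyperbolic.exists_le_norm_diffOp {A : E →L[ℂ] E} (hA : IsHyperbolic A) :
    ∃ c, 0 < c ∧ ∀ q : sobolev E, c * ‖q.1.1‖ ≤ ‖diffOp (constCoeff A) q‖ := by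
  set p := minpoly ℂ (A : E →ₗ[ℂ] E) with hp
  have hint : IsIntegral ℂ (A : E →ₗ[ℂ] E) := Algebra.IsIntegral.isIntegral _
  have hm : p.Monic := minpoly.monic hint
  have hroots : p = (p.roots.map fun m => Polynomial.X - Polynomial.C m).prod :=
    (IsAlgClosed.splits p).eq_prod_roots_of_monic hm
  have hs : ∀ m ∈ p.roots, m.re ≠ 0 := by
    intro m hmr hre
    have h1 := Module.End.hasEigenvalue_of_isRoot (f := (A : E →ₗ[ℂ] E))
      (Polynomial.isRoot_of_mem_roots hmr)
    obtain ⟨x, hx⟩ := h1.exists_hasEigenvector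
    refine hx.2 (hA m.im x ?_)
    have h2 : A x = m • x := hx.apply_eq_smul
    rw [h2]
    congr 1
    apply Complex.ext <;> simp [hre]
  have h0 : Polynomial.aeval A p = 0 := by
    have h1 : Polynomial.aeval (A : E →ₗ[ℂ] E) p = 0 := minpoly.aeval _ _
    let F : (E →L[ℂ] E) →ₐ[ℂ] Module.End ℂ E :=
      AlgHom.ofLinearMap (ContinuousLinearMap.coeLM ℂ) rfl fun _ _ => rfl
    have h2 : F (Polynomial.aeval A p) = 0 := (Polynomial.aeval_algHom_apply F A p).symm.trans h1
    exact ContinuousLinearMap.coe_injective h2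
  obtain ⟨C, hC, h⟩ := exists_norm_le_of_roots A p.roots hs
  rw [← hroots, h0] at h
  refine ⟨(C + 1)⁻¹, by positivity, fun q => ?_⟩
  have e : (0 : E →L[ℂ] E).compLp q.1.1 = 0 := by
    refine Lp.ext ?_
    filter_upwards [(0 : E →L[ℂ] E).coeFn_compLp q.1.1,
      Lp.coeFn_zero E 2 (volume : Measure ℝ)] with x h1 h2
    rw [h1, h2]; rfl
  have hq := h q
  rw [e, norm_zero, add_zero] at hq
  rw [inv_mul_le_iff₀ (by positivity)]
  linarith [norm_nonneg (diffOp (constCoeff A) q)]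

/-- An eigenvector of `-A†` for `i t` is orthogonal to the range of `A - i t`, which is everything
because `A - i t` is injective in finite dimension. -/
theorem IsHyperbolic.neg_adjoint {A : E →L[ℂ] E} (hA : IsHyperbolic A) :
    IsHyperbolic (-ContinuousLinearMap.adjoint A) := by
  intro t x hx
  set B : E →L[ℂ] E := A - ((t : ℂ) * Complex.I) • 1 with hB
  have hinj : Function.Injective B := (injective_iff_map_eq_zero _).2 fun y hy => by
    refine hA t y (sub_eq_zero.1 ?_)
    simpa [hB] using hy
  have hsurj : Function.Surjective B :=
    LinearMap.surjective_of_injective (f := (B : E →ₗ[ℂ] E)) hinj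
  obtain ⟨y, hy⟩ := hsurj x
  have h1 : inner ℂ x (B y) = 0 := by
    have h2 : ContinuousLinearMap.adjoint A x = -(((t : ℂ) * Complex.I) • x) := by
      rw [← hx]; simp
    have h3 : B y = A y - ((t : ℂ) * Complex.I) • y := rfl
    rw [h3, inner_sub_right, ← ContinuousLinearMap.adjoint_inner_left, h2, inner_neg_left,
      inner_smul_left, inner_smul_right]
    simp
  rw [hy] at h1
  exact inner_self_eq_zero.1 h1

theorem IsHyperbolic.bijective_diffOp {A : E →L[ℂ] E} (hA : IsHyperbolic A) :
    Function.Bijective (diffOp (constCoeff A)) := by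
  obtain ⟨c₁, hc₁, h₁⟩ := hA.exists_le_norm_diffOp
  obtain ⟨c₂, hc₂, h₂⟩ := hA.neg_adjoint.exists_le_norm_diffOp
  refine NSP.bijective_diffOp (lt_min hc₁ hc₂) (fun q => ?_) (fun q => ?_)
  · exact (mul_le_mul_of_nonneg_right (min_le_left _ _) (norm_nonneg _)).trans (h₁ q)
  · exact (mul_le_mul_of_nonneg_right (min_le_right _ _) (norm_nonneg _)).trans (h₂ q)

end Systems

/-! ### Systems with hyperbolic limits are Fredholm of index zero -/

section Asymptotic

variable {E : Type*} [NormedAddCommGroup E] [InnerProductSpace ℂ E]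

/-- Multiplication by the indicator function of a measurable set. -/
def indicatorCoeff {s : Set ℝ} (hs : MeasurableSet s) : BddCoeff E :=
  ⟨s.indicator fun _ => 1, stronglyMeasurable_const.indicator hs, 1, fun x => by
    refine (norm_indicator_le_norm_self _ _).trans ?_
    exact ContinuousLinearMap.norm_id_le⟩

theorem norm_indicatorCoeff_le {s : Set ℝ} (hs : MeasurableSet s) (x : ℝ) :
    ‖(indicatorCoeff hs : BddCoeff E) x‖ ≤ 1 :=
  (norm_indicator_le_norm_self (fun _ => (1 : E →L[ℂ] E)) x).trans ContinuousLinearMap.norm_id_le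

theorem coeFn_mulOp_indicatorCoeff {s : Set ℝ} (hs : MeasurableSet s)
    (u : Lp E 2 (volume : Measure ℝ)) :
    mulOp (indicatorCoeff hs) u =ᵐ[volume] s.indicator u := by
  filter_upwards [coeFn_mulOp (indicatorCoeff hs) u] with x hx
  rw [hx]
  by_cases h : x ∈ s <;> simp [indicatorCoeff, h]

/-- The coefficient equal to `A` on `(-∞, 0)` and to `B` on `[0, ∞)`. -/
def jumpCoeff (A B : E →L[ℂ] E) : BddCoeff E :=
  ⟨fun x => if x < 0 then A else B,
    StronglyMeasurable.ite measurableSet_Iio stronglyMeasurable_const stronglyMeasurable_const,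
    max ‖A‖ ‖B‖, fun x => by by_cases h : x < 0 <;> simp [h]⟩

theorem jumpCoeff_of_lt (A B : E →L[ℂ] E) {x : ℝ} (hx : x < 0) : jumpCoeff A B x = A := if_pos hx

theorem jumpCoeff_of_le (A B : E →L[ℂ] E) {x : ℝ} (hx : 0 ≤ x) : jumpCoeff A B x = B :=
  if_neg hx.not_gt

/-- The difference of two coefficient matrices. -/
def BddCoeff.sub (M N : BddCoeff E) : BddCoeff E :=
  ⟨fun x => M x - N x, M.2.1.sub N.2.1, by
    obtain ⟨C₁, h₁⟩ := M.2.2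
    obtain ⟨C₂, h₂⟩ := N.2.2
    exact ⟨C₁ + C₂, fun x => (norm_sub_le _ _).trans (add_le_add (h₁ x) (h₂ x))⟩⟩

/-- Cauchy-Schwarz, obtained by pairing `g` with the constant vector `e` on the interval, where `e`
is the integral itself. -/
theorem norm_setIntegral_le [CompleteSpace E] (g : Lp E 2 (volume : Measure ℝ)) (a b : ℝ) :
    ‖∫ t in a..b, g t‖ ≤ Real.sqrt |b - a| * ‖g‖ := by
  rw [intervalIntegral.norm_intervalIntegral_eq]
  have hv : (volume : Measure ℝ) (Set.uIoc a b) ≠ ⊤ := by simp [Set.uIoc]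
  set e := ∫ t in Set.uIoc a b, g t with he
  have h1 := L2.inner_indicatorConstLp_eq_inner_setIntegral ℂ (hs := measurableSet_uIoc) hv e g
  rw [← he] at h1
  have h2 : ‖e‖ * ‖e‖ ≤ ‖e‖ * (Real.sqrt |b - a| * ‖g‖) :=
    calc ‖e‖ * ‖e‖ = ‖(inner ℂ e e : ℂ)‖ := by
          rw [inner_self_eq_norm_sq_to_K]; simp [sq]
      _ ≤ ‖indicatorConstLp 2 measurableSet_uIoc hv e‖ * ‖g‖ := by
          rw [← h1]; exact norm_inner_le_norm _ _
      _ = _ := by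
          rw [norm_indicatorConstLp (by norm_num) (by norm_num), Real.sqrt_eq_rpow]
          have : (volume : Measure ℝ).real (Set.uIoc a b) = |b - a| := by
            simp [Measure.real, Set.uIoc, max_sub_min_eq_abs]
          rw [this]; norm_num [mul_assoc]
  rcases (norm_nonneg e).eq_or_lt with h | h
  · rw [← h]; positivity
  · exact le_of_mul_le_mul_left h2 h

/-- The deformation from the constant coefficient `γ 0` to `M`. -/
def pathCoeff (γ : ℝ → E →L[ℂ] E) (M : BddCoeff E) (t : ℝ) : BddCoeff E :=
  ⟨fun x => jumpCoeff (γ 0) (γ t) x + (t : ℂ) • (M.sub (jumpCoeff (γ 0) (γ 1))) x,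
    (jumpCoeff (γ 0) (γ t)).2.1.add ((M.sub (jumpCoeff (γ 0) (γ 1))).2.1.const_smul (t : ℂ)),
    by
      obtain ⟨C₁, h₁⟩ := (jumpCoeff (γ 0) (γ t)).2.2
      obtain ⟨C₂, h₂⟩ := (M.sub (jumpCoeff (γ 0) (γ 1))).2.2
      refine ⟨C₁ + |t| * C₂, fun x => (norm_add_le _ _).trans (add_le_add (h₁ x) ?_)⟩
      rw [norm_smul, Complex.norm_real, Real.norm_eq_abs]
      gcongr
      exact h₂ x⟩

theorem pathCoeff_apply (γ : ℝ → E →L[ℂ] E) (M : BddCoeff E) (t x : ℝ) :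
    pathCoeff γ M t x
      = jumpCoeff (γ 0) (γ t) x + (t : ℂ) • (M.sub (jumpCoeff (γ 0) (γ 1))) x := rfl

/-- Along the deformation the left limit stays `γ 0` and the right limit is `γ t`. The system
differs from the pure jump system by `t` times `M - jumpCoeff (γ 0) (γ 1)`, which decays at both
ends when `M` has the limits `γ 0` and `γ 1`. -/
theorem diffOp_pathCoeff (γ : ℝ → E →L[ℂ] E) (M : BddCoeff E) (t : ℝ) (q : sobolev E) :
    diffOp (jumpCoeff (γ 0) (γ t)) q = diffOp (pathCoeff γ M t) q
      + (t : ℂ) • mulOp (M.sub (jumpCoeff (γ 0) (γ 1))) q.1.1 := by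
  have e : mulOp (pathCoeff γ M t) q.1.1 = mulOp (jumpCoeff (γ 0) (γ t)) q.1.1
      + (t : ℂ) • mulOp (M.sub (jumpCoeff (γ 0) (γ 1))) q.1.1 := by
    refine Lp.ext ?_
    filter_upwards [coeFn_mulOp (pathCoeff γ M t) q.1.1,
      coeFn_mulOp (jumpCoeff (γ 0) (γ t)) q.1.1,
      coeFn_mulOp (M.sub (jumpCoeff (γ 0) (γ 1))) q.1.1,
      Lp.coeFn_add (mulOp (jumpCoeff (γ 0) (γ t)) q.1.1)
        ((t : ℂ) • mulOp (M.sub (jumpCoeff (γ 0) (γ 1))) q.1.1),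
      Lp.coeFn_smul (t : ℂ) (mulOp (M.sub (jumpCoeff (γ 0) (γ 1))) q.1.1)] with x h1 h2 h3 h4 h5
    rw [h1, h4, Pi.add_apply, h2, h5, Pi.smul_apply, h3]
    rfl
  rw [diffOp_apply, diffOp_apply, e]
  abel

variable [FiniteDimensional ℂ E]

/-- The functions of class `H¹` that vanish at the points `j h`, `-n ≤ j ≤ n`. -/
def gridSubspace (E : Type*) [NormedAddCommGroup E] [InnerProductSpace ℂ E]
    [FiniteDimensional ℂ E] (n : ℕ) (h : ℝ) : Submodule ℂ (sobolev E) :=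
  LinearMap.ker (LinearMap.pi fun j : Fin (2 * n + 1) =>
    (pointEval (E := E) (((j : ℕ) : ℝ) * h - n * h)).toLinearMap)

theorem mem_gridSubspace {n : ℕ} {h : ℝ} {q : sobolev E} :
    q ∈ gridSubspace E n h ↔
      ∀ j : Fin (2 * n + 1), pointEval (((j : ℕ) : ℝ) * h - n * h) q = 0 := by
  rw [gridSubspace, LinearMap.mem_ker, funext_iff]
  rfl

theorem isClosed_gridSubspace (n : ℕ) (h : ℝ) :
    IsClosed (gridSubspace E n h : Set (sobolev E)) := by
  have : (gridSubspace E n h : Set (sobolev E))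
      = ⋂ j : Fin (2 * n + 1), {q | pointEval (((j : ℕ) : ℝ) * h - n * h) q = 0} := by
    ext q
    simp only [Set.mem_iInter]
    exact mem_gridSubspace
  rw [this]
  exact isClosed_iInter fun j => isClosed_eq (pointEval _).continuous continuous_const

instance finiteDimensional_quotient_gridSubspace (n : ℕ) (h : ℝ) :
    FiniteDimensional ℂ (sobolev E ⧸ gridSubspace E n h) :=
  (LinearMap.quotKerEquivRange (LinearMap.pi fun j : Fin (2 * n + 1) =>
    (pointEval (E := E) (((j : ℕ) : ℝ) * h - n * h)).toLinearMap)).symm.finiteDimensional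

theorem pointEval_zero_of_mem_gridSubspace {n : ℕ} {h : ℝ} {q : sobolev E}
    (hq : q ∈ gridSubspace E n h) : pointEval 0 q = 0 := by
  have := mem_gridSubspace.1 hq ⟨n, by omega⟩
  simpa using this

variable [CompleteSpace E]

/-- Cutting at the origin creates no jump because the function vanishes there. -/
theorem indicator_mem_sobolev {q : sobolev E} (hq : pointEval 0 q = 0) :
    ((mulOp (indicatorCoeff (measurableSet_Ici (a := (0 : ℝ)))) q.1.1,
      mulOp (indicatorCoeff (measurableSet_Ici (a := (0 : ℝ)))) q.1.2) :
      Lp E 2 (volume : Measure ℝ) × Lp E 2 (volume : Measure ℝ)) ∈ sobolev E := by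
  refine mem_sobolev_of_primitive (c := 0) ?_
  have hae := ae_eq_pointEval 0 q
  rw [hq] at hae
  have hg := coeFn_mulOp_indicatorCoeff (measurableSet_Ici (a := (0 : ℝ))) q.1.2
  filter_upwards [hae, coeFn_mulOp_indicatorCoeff (measurableSet_Ici (a := (0 : ℝ))) q.1.1]
    with x h1 h2
  have e : ∫ t in (0 : ℝ)..x, mulOp (indicatorCoeff (measurableSet_Ici (a := (0 : ℝ)))) q.1.2 t
      = ∫ t in (0 : ℝ)..x, (Set.Ici (0 : ℝ)).indicator q.1.2 t :=
    intervalIntegral.integral_congr_ae (by filter_upwards [hg] with t ht _; rw [ht])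
  rw [h2, e, zero_add]
  by_cases hx : 0 ≤ x
  · rw [Set.indicator_of_mem (Set.mem_Ici.2 hx), h1, zero_add]
    refine intervalIntegral.integral_congr fun t ht => ?_
    rw [Set.uIcc_of_le hx] at ht
    exact (Set.indicator_of_mem (Set.mem_Ici.2 ht.1) _).symm
  · rw [Set.indicator_of_notMem (by simpa using hx)]
    symm
    refine intervalIntegral.integral_zero_ae ?_
    have : ∀ᵐ t : ℝ, t ≠ 0 := by simp [ae_iff]
    filter_upwards [this] with t ht0 ht
    rw [Set.uIoc_of_ge (not_le.1 hx).le] at ht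
    exact Set.indicator_of_notMem (fun h => ht0 (le_antisymm ht.2 h)) _

/-- A function vanishing at the origin splits into two `H¹` functions supported on the half-lines,
each seeing only one constant matrix. Adding the two estimates costs the factor `1 / 2`. -/
theorem le_norm_diffOp_jumpCoeff {A B : E →L[ℂ] E} {c : ℝ}
    (hA : ∀ q : sobolev E, c * ‖q.1.1‖ ≤ ‖diffOp (constCoeff A) q‖)
    (hB : ∀ q : sobolev E, c * ‖q.1.1‖ ≤ ‖diffOp (constCoeff B) q‖) (hc : 0 < c)
    {q : sobolev E} (hq : pointEval 0 q = 0) :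
    c / 2 * ‖q.1.1‖ ≤ ‖diffOp (jumpCoeff A B) q‖ := by
  set f := diffOp (jumpCoeff A B) q with hf
  let χ : BddCoeff E := indicatorCoeff (measurableSet_Ici (a := (0 : ℝ)))
  let χ' : BddCoeff E := indicatorCoeff (measurableSet_Iio (a := (0 : ℝ)))
  let qp : sobolev E := ⟨_, indicator_mem_sobolev hq⟩
  let qm : sobolev E := q - qp
  have aef : f =ᵐ[volume] fun x => q.1.2 x - jumpCoeff A B x (q.1.1 x) := by
    rw [hf, diffOp_apply]
    filter_upwards [Lp.coeFn_sub q.1.2 (mulOp (jumpCoeff A B) q.1.1),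
      coeFn_mulOp (jumpCoeff A B) q.1.1] with x h1 h2
    rw [h1, Pi.sub_apply, h2]
  have ep1 : qp.1.1 =ᵐ[volume] (Set.Ici (0 : ℝ)).indicator q.1.1 :=
    coeFn_mulOp_indicatorCoeff measurableSet_Ici q.1.1
  have ep2 : qp.1.2 =ᵐ[volume] (Set.Ici (0 : ℝ)).indicator q.1.2 :=
    coeFn_mulOp_indicatorCoeff measurableSet_Ici q.1.2
  have fp : diffOp (constCoeff B) qp = mulOp χ f := by
    rw [diffOp_apply]
    refine Lp.ext ?_
    filter_upwards [ep1, ep2, aef, coeFn_mulOp_indicatorCoeff (measurableSet_Ici (a := (0 : ℝ))) f,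
      coeFn_mulOp (constCoeff B) qp.1.1, Lp.coeFn_sub qp.1.2 (mulOp (constCoeff B) qp.1.1)]
      with x h1 h2 h3 h4 h5 h6
    rw [h6, Pi.sub_apply, h5, h4, h2, h1]
    by_cases hx : 0 ≤ x
    · rw [Set.indicator_of_mem (Set.mem_Ici.2 hx), Set.indicator_of_mem (Set.mem_Ici.2 hx),
        Set.indicator_of_mem (Set.mem_Ici.2 hx), h3, jumpCoeff_of_le _ _ hx]
      rfl
    · have hx' : x ∉ Set.Ici (0 : ℝ) := by simpa using hx
      rw [Set.indicator_of_notMem hx', Set.indicator_of_notMem hx', Set.indicator_of_notMem hx',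
        map_zero, sub_zero]
  have fm : diffOp (constCoeff A) qm = mulOp χ' f := by
    rw [diffOp_apply]
    refine Lp.ext ?_
    filter_upwards [ep1, ep2, aef, coeFn_mulOp_indicatorCoeff (measurableSet_Iio (a := (0 : ℝ))) f,
      coeFn_mulOp (constCoeff A) qm.1.1, Lp.coeFn_sub qm.1.2 (mulOp (constCoeff A) qm.1.1),
      Lp.coeFn_sub q.1.1 qp.1.1, Lp.coeFn_sub q.1.2 qp.1.2]
      with x h1 h2 h3 h4 h5 h6 h7 h8
    have h7' : qm.1.1 x = q.1.1 x - qp.1.1 x := h7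
    have h8' : qm.1.2 x = q.1.2 x - qp.1.2 x := h8
    rw [h6, Pi.sub_apply, h5, h4, h7', h8', h2, h1]
    by_cases hx : 0 ≤ x
    · have hx' : x ∉ Set.Iio (0 : ℝ) := by simpa using hx
      rw [Set.indicator_of_mem (Set.mem_Ici.2 hx), Set.indicator_of_mem (Set.mem_Ici.2 hx),
        Set.indicator_of_notMem hx', sub_self, sub_self, map_zero, sub_zero]
    · have hx' : x ∉ Set.Ici (0 : ℝ) := by simpa using hx
      rw [Set.indicator_of_notMem hx', Set.indicator_of_notMem hx',
        Set.indicator_of_mem (Set.mem_Iio.2 (not_le.1 hx)), h3,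
        jumpCoeff_of_lt _ _ (not_le.1 hx), sub_zero, sub_zero]
      rfl
  have b1 := hB qp
  have b2 := hA qm
  rw [fp] at b1
  rw [fm] at b2
  have b3 := norm_mulOp_le (norm_indicatorCoeff_le (E := E) (measurableSet_Ici (a := (0 : ℝ)))) f
  have b4 := norm_mulOp_le (norm_indicatorCoeff_le (E := E) (measurableSet_Iio (a := (0 : ℝ)))) f
  have e : q.1.1 = qm.1.1 + qp.1.1 := by
    change q.1.1 = (q.1.1 - qp.1.1) + qp.1.1
    abel
  have b5 : ‖q.1.1‖ ≤ ‖qm.1.1‖ + ‖qp.1.1‖ := by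
    rw [e]; exact norm_add_le _ _
  change ‖mulOp χ f‖ ≤ _ at b3
  change ‖mulOp χ' f‖ ≤ _ at b4
  have b6 := mul_le_mul_of_nonneg_left b5 hc.le
  linarith

/-- The function is the integral of its derivative from the nearest grid point on the left, at
distance at most `h`. -/
theorem norm_le_of_mem_gridSubspace {n : ℕ} {h : ℝ} (hh : 0 < h) {q : sobolev E}
    (hq : q ∈ gridSubspace E n h) :
    ∀ᵐ x : ℝ, x ∈ Set.Icc (-(n * h)) (n * h) → ‖q.1.1 x‖ ≤ Real.sqrt h * ‖q.1.2‖ := by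
  have hae : ∀ᵐ x : ℝ, ∀ j : Fin (2 * n + 1), q.1.1 x
      = pointEval (((j : ℕ) : ℝ) * h - n * h) q + ∫ t in (((j : ℕ) : ℝ) * h - n * h)..x, q.1.2 t :=
    ae_all_iff.2 fun j => ae_eq_pointEval _ q
  filter_upwards [hae] with x hx hxm
  have h0 : 0 ≤ (x + n * h) / h := div_nonneg (by linarith [hxm.1]) hh.le
  set j := ⌊(x + n * h) / h⌋₊ with hj
  have h1 : (j : ℝ) ≤ (x + n * h) / h := Nat.floor_le h0
  have h2 : (x + n * h) / h < j + 1 := Nat.lt_floor_add_one _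
  have h3 : (x + n * h) / h ≤ ((2 * n : ℕ) : ℝ) := by
    rw [div_le_iff₀ hh]; push_cast; linarith [hxm.2]
  have h4 : j < 2 * n + 1 := by
    have : (j : ℝ) ≤ ((2 * n : ℕ) : ℝ) := h1.trans h3
    have : j ≤ 2 * n := by exact_mod_cast this
    omega
  rw [le_div_iff₀ hh] at h1
  rw [div_lt_iff₀ hh] at h2
  have h5 := hx ⟨j, h4⟩
  rw [mem_gridSubspace.1 hq ⟨j, h4⟩, zero_add] at h5
  rw [h5]
  refine (norm_setIntegral_le _ _ _).trans
    (mul_le_mul_of_nonneg_right (Real.sqrt_le_sqrt ?_) (norm_nonneg _))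
  rw [abs_le]
  constructor <;> simp only <;> linarith

/-- A coefficient that is small outside `[-n h, n h]` acts on functions vanishing at the grid
points as a small perturbation. -/
theorem norm_mulOp_le_of_mem_gridSubspace {P : BddCoeff E} {n : ℕ} {h κ K : ℝ} (hh : 0 < h)
    (hK : ∀ x, ‖P x‖ ≤ K) (hκ0 : 0 ≤ κ) (hκ : ∀ x, x ∉ Set.Icc (-(n * h)) (n * h) → ‖P x‖ ≤ κ)
    {q : sobolev E} (hq : q ∈ gridSubspace E n h) :
    ‖mulOp P q.1.1‖ ≤ κ * ‖q.1.1‖ + K * Real.sqrt (2 * (n * h) * h) * ‖q.1.2‖ := by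
  set s := Set.Icc (-(n * h)) (n * h)
  have hs : MeasurableSet s := measurableSet_Icc
  have hv : (volume : Measure ℝ) s ≠ ⊤ := by simp [s]
  have hK0 : 0 ≤ K := (norm_nonneg _).trans (hK 0)
  have hnh : 0 ≤ n * h := by positivity
  set C : ℝ := K * (Real.sqrt h * ‖q.1.2‖)
  have hC : 0 ≤ C := by positivity
  -- Outside the interval `P` is at most `κ`. Inside, the pointwise bound of order `√h` over length
  -- `2 n h` gives a factor `√(2 n h · h)`, which is small when the grid is refined with `n h`
  -- fixed.
  have e : mulOp P q.1.1
      = mulOp P (mulOp (indicatorCoeff hs.compl) q.1.1)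
        + mulOp P (mulOp (indicatorCoeff hs) q.1.1) := by
    rw [← map_add]
    congr 1
    refine Lp.ext ?_
    filter_upwards [coeFn_mulOp_indicatorCoeff hs q.1.1,
      coeFn_mulOp_indicatorCoeff hs.compl q.1.1,
      Lp.coeFn_add (mulOp (indicatorCoeff hs.compl) q.1.1) (mulOp (indicatorCoeff hs) q.1.1)]
      with x h1 h2 h3
    rw [h3, Pi.add_apply, h1, h2]
    by_cases hx : x ∈ s <;> simp [hx]
  rw [e]
  refine (norm_add_le _ _).trans (add_le_add ?_ ?_)
  · refine Lp.norm_le_mul_norm_of_ae_le_mul ?_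
    filter_upwards [coeFn_mulOp P (mulOp (indicatorCoeff hs.compl) q.1.1),
      coeFn_mulOp_indicatorCoeff hs.compl q.1.1] with x h1 h2
    rw [h1, h2]
    by_cases hx : x ∈ s
    · rw [Set.indicator_of_notMem (by simpa using hx), map_zero, norm_zero]
      positivity
    · rw [Set.indicator_of_mem (Set.mem_compl hx)]
      exact (P x).le_of_opNorm_le (hκ x hx) _
  · have hle : ‖mulOp P (mulOp (indicatorCoeff hs) q.1.1)‖ ≤ ‖indicatorConstLp 2 hs hv C‖ := by
      refine Lp.norm_le_norm_of_ae_le ?_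
      filter_upwards [coeFn_mulOp P (mulOp (indicatorCoeff hs) q.1.1),
        coeFn_mulOp_indicatorCoeff hs q.1.1, indicatorConstLp_coeFn (p := 2) (hs := hs)
        (hμs := hv) (c := C), norm_le_of_mem_gridSubspace hh hq] with x h1 h2 h3 h4
      rw [h1, h2, h3]
      by_cases hx : x ∈ s
      · rw [Set.indicator_of_mem hx, Set.indicator_of_mem hx, Real.norm_of_nonneg hC]
        exact ((P x).le_of_opNorm_le (hK x) _).trans (mul_le_mul_of_nonneg_left (h4 hx) hK0)
      · rw [Set.indicator_of_notMem hx, Set.indicator_of_notMem hx, map_zero, norm_zero, norm_zero]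
    refine hle.trans (le_of_eq ?_)
    rw [norm_indicatorConstLp (by norm_num) (by norm_num), Real.norm_of_nonneg hC]
    have h5 : (volume : Measure ℝ).real s = 2 * (n * h) := by
      simp only [s, Measure.real, Real.volume_Icc]
      rw [ENNReal.toReal_ofReal (by linarith)]; ring
    rw [h5, Real.sqrt_mul (by positivity)]
    have h6 : (2 * (n * h)) ^ (1 / (2 : ENNReal).toReal) = Real.sqrt (2 * (n * h)) := by
      rw [Real.sqrt_eq_rpow]; norm_num
    rw [h6]
    ring

/-- Compactness: a perturbation of the matrix by less than `c / 2` costs at most half of the lower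
bound, so the bound is locally uniform in `t`. -/
theorem exists_le_norm_diffOp_of_path {γ : ℝ → E →L[ℂ] E} (hγ : Continuous γ)
    (hyp : ∀ t, IsHyperbolic (γ t)) :
    ∃ c, 0 < c ∧ ∀ t ∈ Set.Icc (0 : ℝ) 1, ∀ q : sobolev E,
      c * ‖q.1.1‖ ≤ ‖diffOp (constCoeff (γ t)) q‖ := by
  refine isCompact_Icc.induction_on (p := fun s => ∃ c, 0 < c ∧ ∀ t ∈ s, ∀ q : sobolev E,
      c * ‖q.1.1‖ ≤ ‖diffOp (constCoeff (γ t)) q‖) ⟨1, one_pos, by simp⟩ ?_ ?_ ?_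
  · rintro s s' hss' ⟨c, hc, h⟩
    exact ⟨c, hc, fun t ht => h t (hss' ht)⟩
  · rintro s s' ⟨c, hc, h⟩ ⟨c', hc', h'⟩
    refine ⟨min c c', lt_min hc hc', fun t ht q => ?_⟩
    rcases ht with ht | ht
    · exact (mul_le_mul_of_nonneg_right (min_le_left _ _) (norm_nonneg _)).trans (h t ht q)
    · exact (mul_le_mul_of_nonneg_right (min_le_right _ _) (norm_nonneg _)).trans (h' t ht q)
  · intro t₀ _
    obtain ⟨c, hc, h⟩ := (hyp t₀).exists_le_norm_diffOp
    have hn : {t | ‖γ t - γ t₀‖ < c / 2} ∈ 𝓝 t₀ := by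
      have := (Metric.continuous_iff.1 hγ) t₀ (c / 2) (by positivity)
      obtain ⟨δ, hδ, hd⟩ := this
      filter_upwards [Metric.ball_mem_nhds t₀ hδ] with t ht
      have := hd t ht
      rwa [dist_eq_norm] at this
    refine ⟨_, mem_nhdsWithin_of_mem_nhds hn, c / 2, by positivity, fun t ht q => ?_⟩
    have h1 := norm_mulOp_sub_le (M := constCoeff (γ t)) (N := constCoeff (γ t₀))
      (fun _ => (Set.mem_ofPred.1 ht).le) q.1.1
    have h2 := h q
    have e : diffOp (constCoeff (γ t₀)) q = diffOp (constCoeff (γ t)) q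
        + (mulOp (constCoeff (γ t)) q.1.1 - mulOp (constCoeff (γ t₀)) q.1.1) := by
      rw [diffOp_apply, diffOp_apply]; abel
    rw [e] at h2
    have h3 := norm_add_le (diffOp (constCoeff (γ t)) q)
      (mulOp (constCoeff (γ t)) q.1.1 - mulOp (constCoeff (γ t₀)) q.1.1)
    linarith

/-- A first-order system whose coefficients have hyperbolic limits that are joined by a path of
hyperbolic matrices is Fredholm of index zero. -/
theorem isFredholmZero_diffOp {M : BddCoeff E} {γ : ℝ → E →L[ℂ] E} (hγ : Continuous γ)
    (hyp : ∀ t, IsHyperbolic (γ t)) (hbot : Tendsto M atBot (𝓝 (γ 0)))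
    (htop : Tendsto M atTop (𝓝 (γ 1))) : IsFredholmZero (diffOp M).toLinearMap := by
  obtain ⟨c, hc, hlow⟩ := exists_le_norm_diffOp_of_path hγ hyp
  obtain ⟨KM, hKM⟩ := M.2.2
  obtain ⟨Γ, hΓ⟩ := (isCompact_Icc (a := (0 : ℝ)) (b := 1)).exists_bound_of_continuousOn
    hγ.continuousOn
  set P : BddCoeff E := M.sub (jumpCoeff (γ 0) (γ 1)) with hP
  have m0 : (0 : ℝ) ∈ Set.Icc (0 : ℝ) 1 := ⟨le_rfl, zero_le_one⟩
  have m1 : (1 : ℝ) ∈ Set.Icc (0 : ℝ) 1 := ⟨zero_le_one, le_rfl⟩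
  have hjump : ∀ t ∈ Set.Icc (0 : ℝ) 1, ∀ x, ‖jumpCoeff (γ 0) (γ t) x‖ ≤ Γ := fun t ht x => by
    rcases lt_or_ge x 0 with hx | hx
    · rw [jumpCoeff_of_lt _ _ hx]; exact hΓ 0 m0
    · rw [jumpCoeff_of_le _ _ hx]; exact hΓ t ht
  have hΓ0 : 0 ≤ Γ := (norm_nonneg _).trans (hΓ 0 m0)
  have hKM0 : 0 ≤ KM := (norm_nonneg _).trans (hKM 0)
  set K := KM + Γ with hKdef
  have hPK : ∀ x, ‖P x‖ ≤ K := fun x =>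
    (norm_sub_le _ _).trans (add_le_add (hKM x) (hjump 1 m1 x))
  set K' := Γ + K with hK'def
  have hK0 : 0 ≤ K := by positivity
  have hK'0 : 0 ≤ K' := by positivity
  have hpath : ∀ t ∈ Set.Icc (0 : ℝ) 1, ∀ x, ‖pathCoeff γ M t x‖ ≤ K' := fun t ht x => by
    rw [pathCoeff_apply]
    refine (norm_add_le _ _).trans (add_le_add (hjump t ht x) ?_)
    rw [norm_smul, Complex.norm_real, Real.norm_of_nonneg ht.1]
    exact (mul_le_of_le_one_left (norm_nonneg _) ht.2).trans (hPK x)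
  obtain ⟨R, hR, hPR⟩ : ∃ R : ℝ, 0 < R ∧ ∀ x, x ∉ Set.Icc (-R) R → ‖P x‖ ≤ c / 8 := by
    have hc8 : 0 < c / 8 := by positivity
    obtain ⟨a, ha⟩ := (eventually_atBot.1 (Metric.tendsto_nhds.1 hbot (c / 8) hc8))
    obtain ⟨b, hb⟩ := (eventually_atTop.1 (Metric.tendsto_nhds.1 htop (c / 8) hc8))
    refine ⟨max 1 (max (-a) b), by positivity, fun x hx => ?_⟩
    have hR0 : 0 < max 1 (max (-a) b) := by positivity
    have hRa : -a ≤ max 1 (max (-a) b) := (le_max_left _ _).trans (le_max_right _ _)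
    have hRb : b ≤ max 1 (max (-a) b) := (le_max_right _ _).trans (le_max_right _ _)
    rcases lt_or_ge x (-max 1 (max (-a) b)) with h | h
    · have h1 := ha x (by linarith)
      rw [dist_eq_norm] at h1
      change ‖M x - jumpCoeff (γ 0) (γ 1) x‖ ≤ _
      rw [jumpCoeff_of_lt _ _ (by linarith)]
      exact h1.le
    · have h2 : max 1 (max (-a) b) < x := by
        by_contra! h3; exact hx ⟨h, h3⟩
      have h1 := hb x (by linarith)
      rw [dist_eq_norm] at h1
      change ‖M x - jumpCoeff (γ 0) (γ 1) x‖ ≤ _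
      rw [jumpCoeff_of_le _ _ (by linarith)]
      exact h1.le
  set μ := min 1 (c / (8 * (K' + 1))) with hμ
  have hμ0 : 0 < μ := lt_min one_pos (by positivity)
  obtain ⟨n, hn0, hn⟩ : ∃ n : ℕ, 0 < n ∧ K * Real.sqrt (2 * R * (R / n)) ≤ μ := by
    have h1 : Tendsto (fun n : ℕ => K * Real.sqrt (2 * R * (R / n))) atTop (𝓝 0) := by
      have h2 := (tendsto_const_div_atTop_nhds_zero_nat R).const_mul (2 * R)
      have h3 := ((Real.continuous_sqrt.tendsto _).comp h2).const_mul K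
      simpa using h3
    obtain ⟨n, hn⟩ := ((eventually_gt_atTop 0).and (h1.eventually (ge_mem_nhds hμ0))).exists
    exact ⟨n, hn⟩
  have hn0' : (0 : ℝ) < n := by exact_mod_cast hn0
  set h := R / n with hh
  have hh0 : 0 < h := by positivity
  have hnh : n * h = R := by rw [hh]; field_simp
  -- The jump system contributes `c / 2`; the tails of `P` take `c / 8`, and so does the part inside
  -- `[-R, R]` through `μ K'`. What remains is `c / 4 ‖u‖ ≤ 2 ‖D u‖` for the deformed operator `D`,
  -- the factor two coming from `μ ≤ 1`.
  have hbelow : ∀ t ∈ Set.Icc (0 : ℝ) 1, ∀ q ∈ gridSubspace E n h,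
      c / 8 * ‖q.1.1‖ ≤ ‖diffOp (pathCoeff γ M t) q‖ := by
    intro t ht q hq
    have h1 := le_norm_diffOp_jumpCoeff (hlow 0 m0) (hlow t ht) hc
      (pointEval_zero_of_mem_gridSubspace hq)
    rw [diffOp_pathCoeff γ M t q] at h1
    have h2 := norm_mulOp_le_of_mem_gridSubspace (P := P) (κ := c / 8) hh0 hPK (by positivity)
      (by rw [hnh]; exact hPR) hq
    have h3 : ‖(t : ℂ) • mulOp P q.1.1‖ ≤ ‖mulOp P q.1.1‖ := by
      rw [norm_smul, Complex.norm_real, Real.norm_of_nonneg ht.1]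
      exact mul_le_of_le_one_left (norm_nonneg _) ht.2
    have h4 := norm_add_le (diffOp (pathCoeff γ M t) q) ((t : ℂ) • mulOp P q.1.1)
    have h5 : ‖q.1.2‖ ≤ ‖diffOp (pathCoeff γ M t) q‖ + K' * ‖q.1.1‖ := by
      have e : q.1.2 = diffOp (pathCoeff γ M t) q + mulOp (pathCoeff γ M t) q.1.1 := by
        rw [diffOp_apply]; abel
      calc ‖q.1.2‖ = ‖diffOp (pathCoeff γ M t) q + mulOp (pathCoeff γ M t) q.1.1‖ := by rw [← e]
        _ ≤ _ := (norm_add_le _ _).trans (add_le_add le_rfl (norm_mulOp_le (hpath t ht) _))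
    rw [hnh] at h2
    have h6 : K * Real.sqrt (2 * R * h) * ‖q.1.2‖
        ≤ μ * (‖diffOp (pathCoeff γ M t) q‖ + K' * ‖q.1.1‖) :=
      mul_le_mul hn h5 (norm_nonneg _) hμ0.le
    have h7 : μ * ‖diffOp (pathCoeff γ M t) q‖ ≤ ‖diffOp (pathCoeff γ M t) q‖ :=
      mul_le_of_le_one_left (norm_nonneg _) (min_le_left _ _)
    have h8 : μ * K' ≤ c / 8 := by
      calc μ * K' ≤ c / (8 * (K' + 1)) * (K' + 1) :=
            mul_le_mul (min_le_right _ _) (by linarith) hK'0 (by positivity)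
        _ = c / 8 := by field_simp
    have h9 : μ * K' * ‖q.1.1‖ ≤ c / 8 * ‖q.1.1‖ :=
      mul_le_mul_of_nonneg_right h8 (norm_nonneg _)
    nlinarith
  -- A step of size `c / 16` is half of the lower bound `c / 8`, which gives `θ = 1 / 2` below.
  obtain ⟨N, hN0, hN⟩ : ∃ N : ℕ, 0 < N ∧ ∀ t ∈ Set.Icc (0 : ℝ) 1, ∀ t' ∈ Set.Icc (0 : ℝ) 1,
      |t - t'| ≤ 1 / N → ‖γ t - γ t'‖ + |t - t'| * K ≤ c / 16 := by
    obtain ⟨δ, hδ, hu⟩ := Metric.uniformContinuousOn_iff.1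
      (isCompact_Icc.uniformContinuousOn_of_continuous hγ.continuousOn (s := Set.Icc (0 : ℝ) 1))
      (c / 32) (by positivity)
    have hδ' : 0 < min δ (c / (32 * (K + 1))) := lt_min hδ (by positivity)
    obtain ⟨m, hm⟩ := exists_nat_one_div_lt hδ'
    refine ⟨m + 1, Nat.succ_pos _, fun t ht t' ht' htt => ?_⟩
    push_cast at htt
    have h1 := hu t ht t' ht' (by
      rw [Real.dist_eq]; exact (htt.trans_lt hm).trans_le (min_le_left _ _))
    rw [dist_eq_norm] at h1
    have h2 : |t - t'| * K ≤ c / 32 :=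
      calc |t - t'| * K ≤ c / (32 * (K + 1)) * (K + 1) :=
            mul_le_mul ((htt.trans hm.le).trans (min_le_right _ _)) (by linarith) hK0
              (by positivity)
        _ = c / 32 := by field_simp
    linarith
  have hN0' : (0 : ℝ) < N := by exact_mod_cast hN0
  -- The parameters are capped at one because `isFredholmZero_of_path` asks for bounds at every
  -- natural number; only `k = 0` and `k = N` matter in the end.
  set τ : ℕ → ℝ := fun k => min ((k : ℝ) / N) 1 with hτ
  have hτm : ∀ k, τ k ∈ Set.Icc (0 : ℝ) 1 := fun k =>
    ⟨le_min (by positivity) zero_le_one, min_le_right _ _⟩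
  have hτd : ∀ k, |τ k - τ (k + 1)| ≤ 1 / N := fun k => by
    have h1 := abs_min_sub_min_le_max ((k : ℝ) / N) 1 (((k + 1 : ℕ) : ℝ) / N) 1
    refine h1.trans (max_le ?_ (by simp))
    rw [← sub_div, Nat.cast_add, Nat.cast_one, sub_add_cancel_left, abs_div, abs_neg, abs_one,
      abs_of_pos hN0']
  have hstep : ∀ k, ∀ q : sobolev E,
      ‖diffOp (pathCoeff γ M (τ k)) q - diffOp (pathCoeff γ M (τ (k + 1))) q‖
        ≤ c / 16 * ‖q.1.1‖ := fun k q => by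
    have e : diffOp (pathCoeff γ M (τ k)) q - diffOp (pathCoeff γ M (τ (k + 1))) q
        = mulOp (pathCoeff γ M (τ (k + 1))) q.1.1 - mulOp (pathCoeff γ M (τ k)) q.1.1 := by
      rw [diffOp_apply, diffOp_apply]; abel
    rw [e, norm_sub_rev]
    refine norm_mulOp_sub_le (fun x => ?_) _
    refine le_trans ?_ (hN _ (hτm k) _ (hτm (k + 1)) (hτd k))
    have e2 : pathCoeff γ M (τ k) x - pathCoeff γ M (τ (k + 1)) x
        = (jumpCoeff (γ 0) (γ (τ k)) x - jumpCoeff (γ 0) (γ (τ (k + 1))) x)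
          + ((τ k - τ (k + 1) : ℝ) : ℂ) • P x := by
      rw [pathCoeff_apply, pathCoeff_apply, Complex.ofReal_sub, sub_smul]
      abel
    rw [e2]
    refine (norm_add_le _ _).trans (add_le_add ?_ ?_)
    · rcases lt_or_ge x 0 with hx | hx
      · rw [jumpCoeff_of_lt _ _ hx, jumpCoeff_of_lt _ _ hx, sub_self, norm_zero]
        exact norm_nonneg _
      · rw [jumpCoeff_of_le _ _ hx, jumpCoeff_of_le _ _ hx]
    · rw [norm_smul, Complex.norm_real, Real.norm_eq_abs]
      exact mul_le_mul_of_nonneg_left (hPK x) (abs_nonneg _)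
  have main := isFredholmZero_of_path (T := fun k => diffOp (pathCoeff γ M (τ k)))
    (isClosed_gridSubspace (E := E) n h) (θ := 1 / 2) (by norm_num)
    (fun k q hq => exists_norm_le_diffOp (hpath _ (hτm k)) (c := c / 8) (by positivity)
      (hbelow _ (hτm k) q hq))
    (fun k q hq => (hstep k q).trans (by linarith [hbelow _ (hτm k) q hq]))
    (fun k q hq => (hstep k q).trans (by linarith [hbelow _ (hτm (k + 1)) q hq]))
    (by
      have e : pathCoeff γ M (τ 0) = constCoeff (γ 0) := by
        have h0 : τ 0 = 0 := by simp [hτ]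
        rw [h0]
        refine Subtype.ext (funext fun x => ?_)
        change jumpCoeff (γ 0) (γ 0) x + ((0 : ℝ) : ℂ) • P x = γ 0
        rw [Complex.ofReal_zero, zero_smul, add_zero]
        exact ite_self _
      rw [e]
      exact (hyp 0).bijective_diffOp) N
  have e : pathCoeff γ M (τ N) = M := by
    have h1 : τ N = 1 := by simp [hτ, div_self hN0'.ne']
    rw [h1]
    refine Subtype.ext (funext fun x => ?_)
    change jumpCoeff (γ 0) (γ 1) x + ((1 : ℝ) : ℂ) • (M x - jumpCoeff (γ 0) (γ 1) x) = M x
    rw [Complex.ofReal_one, one_smul, add_sub_cancel]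
  simp only [e] at main
  exact main

end Asymptotic

/-! ### Asymptotics of shock profiles -/

section Profile

/-- The two ends of the line. -/
def IsEnd (l : Filter ℝ) : Prop := l = atTop ∨ l = atBot

theorem IsEnd.neBot {l : Filter ℝ} (hl : IsEnd l) : l.NeBot := by
  rcases hl with rfl | rfl <;> infer_instance

theorem IsEnd.tendsto_add_one {l : Filter ℝ} (hl : IsEnd l) : Tendsto (fun x => x + 1) l l := by
  rcases hl with rfl | rfl
  · exact tendsto_atTop_add_const_right _ _ tendsto_id
  · exact tendsto_atBot_add_const_right _ _ tendsto_id

theorem IsEnd.eventually_Icc {l : Filter ℝ} (hl : IsEnd l) {P : ℝ → Prop}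
    (h : ∀ᶠ y in l, P y) : ∀ᶠ x in l, ∀ y ∈ Set.Icc x (x + 1), P y := by
  rcases hl with rfl | rfl
  · obtain ⟨a, ha⟩ := eventually_atTop.1 h
    exact eventually_atTop.2 ⟨a, fun x hx y hy => ha y (hx.trans hy.1)⟩
  · obtain ⟨a, ha⟩ := eventually_atBot.1 h
    exact eventually_atBot.2 ⟨a - 1, fun x hx y hy => ha y (by linarith [hy.2])⟩

theorem exists_deriv_eq_increment {f f' : ℝ → ℝ} (hf : ∀ x, HasDerivAt f (f' x) x) (x : ℝ) :
    ∃ y ∈ Set.Icc x (x + 1), f' y = f (x + 1) - f x := by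
  obtain ⟨y, hy, h⟩ := exists_hasDerivAt_eq_slope f f' (show x < x + 1 by linarith)
    (fun z _ => (hf z).continuousAt.continuousWithinAt) (fun z _ => hf z)
  refine ⟨y, Set.Ioo_subset_Icc_self hy, ?_⟩
  rw [h]; simp

theorem IsEnd.tendsto_increment {l : Filter ℝ} (hl : IsEnd l) {f : ℝ → ℝ} {L : ℝ}
    (hL : Tendsto f l (𝓝 L)) : Tendsto (fun x => f (x + 1) - f x) l (𝓝 0) := by
  have := (hL.comp hl.tendsto_add_one).sub hL
  rwa [sub_self] at this

theorem IsEnd.eq_zero_of_tendsto_deriv {l : Filter ℝ} (hl : IsEnd l) {f f' : ℝ → ℝ} {L d : ℝ}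
    (hf : ∀ x, HasDerivAt f (f' x) x) (hL : Tendsto f l (𝓝 L)) (hd : Tendsto f' l (𝓝 d)) :
    d = 0 := by
  have := hl.neBot
  by_contra hne
  have hpos : 0 < |d| / 3 := by positivity
  obtain ⟨x, h1, h2⟩ := ((hl.eventually_Icc (Metric.tendsto_nhds.1 hd _ hpos)).and
    (Metric.tendsto_nhds.1 (hl.tendsto_increment hL) _ hpos)).exists
  obtain ⟨y, hy, he⟩ := exists_deriv_eq_increment hf x
  have h3 := h1 y hy
  rw [Real.dist_eq] at h3 h2
  rw [← he, sub_zero] at h2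
  have := abs_sub_abs_le_abs_sub d (f' y)
  rw [abs_sub_comm] at h3
  linarith

/-- Over a unit interval near the end the increment of `f` is small, so by the mean value theorem `v
q` is small at some point, and `v ≥ m` makes `q` small there. As `q'` is small, so is `q` at the
left end of the interval. -/
theorem IsEnd.tendsto_zero_of_deriv {l : Filter ℝ} (hl : IsEnd l) {f v q q' : ℝ → ℝ} {L m : ℝ}
    (hm : 0 < m) (hv : ∀ x, m ≤ v x) (hf : ∀ x, HasDerivAt f (v x * q x) x)
    (hq : ∀ x, HasDerivAt q (q' x) x) (hL : Tendsto f l (𝓝 L)) (hq' : Tendsto q' l (𝓝 0)) :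
    Tendsto q l (𝓝 0) := by
  rw [Metric.tendsto_nhds]
  intro δ hδ
  filter_upwards [hl.eventually_Icc (Metric.tendsto_nhds.1 hq' (δ / 2) (by positivity)),
    Metric.tendsto_nhds.1 (hl.tendsto_increment hL) (m * (δ / 2)) (by positivity)] with x h1 h2
  obtain ⟨y, hy, he⟩ := exists_deriv_eq_increment hf x
  rw [Real.dist_eq, sub_zero, ← he, abs_mul, abs_of_pos (hm.trans_le (hv y))] at h2
  have h3 : |q y| < δ / 2 := by
    by_contra! h
    have := mul_le_mul (hv y) h (by positivity) (hm.le.trans (hv y))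
    linarith
  have h4 : |q y - q x| ≤ δ / 2 * |y - x| := by
    have := (convex_Icc x (x + 1)).norm_image_sub_le_of_norm_hasDerivWithin_le
      (f := q) (f' := q') (C := δ / 2) (fun z _ => (hq z).hasDerivWithinAt)
      (fun z hz => by
        have := h1 z hz
        rw [Real.dist_eq, sub_zero] at this
        exact this.le) (Set.left_mem_Icc.2 (by linarith)) hy
    simpa [Real.norm_eq_abs] using this
  have h5 : |y - x| ≤ 1 := by rw [abs_le]; constructor <;> linarith [hy.1, hy.2]
  have h6 : δ / 2 * |y - x| ≤ δ / 2 := mul_le_of_le_one_right (by positivity) h5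
  rw [Real.dist_eq, sub_zero]
  have h7 := abs_sub_abs_le_abs_sub (q x) (q y)
  rw [abs_sub_comm] at h7
  linarith

theorem exists_norm_le_of_tendsto {F : Type*} [NormedAddCommGroup F] {f : ℝ → F} {a b : F}
    (hf : Continuous f) (ha : Tendsto f atBot (𝓝 a)) (hb : Tendsto f atTop (𝓝 b)) :
    ∃ C, ∀ x, ‖f x‖ ≤ C := by
  obtain ⟨A, hA⟩ := eventually_atBot.1 (ha.norm.eventually (ge_mem_nhds (lt_add_one ‖a‖)))
  obtain ⟨B, hB⟩ := eventually_atTop.1 (hb.norm.eventually (ge_mem_nhds (lt_add_one ‖b‖)))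
  obtain ⟨C, hC⟩ := (isCompact_Icc (a := A) (b := B)).exists_bound_of_continuousOn hf.continuousOn
  refine ⟨max C (max (‖a‖ + 1) (‖b‖ + 1)), fun x => ?_⟩
  rcases le_total x A with h | h
  · exact (hA x h).trans ((le_max_left _ _).trans (le_max_right _ _))
  · rcases le_total x B with h' | h'
    · exact (hC x ⟨h, h'⟩).trans (le_max_left _ _)
    · exact (hB x h').trans ((le_max_right _ _).trans (le_max_right _ _))

variable {T ν ε s vm um vp up : ℝ} {v u φ : ℝ → ℝ}

theorem IsLaxTwoShock.speed_pos (hT : 0 < T) (hvm : 0 < vm) (h : IsLaxTwoShock T s vm um vp up) :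
    0 < s := by
  have := hvm.trans h.lax
  rw [h.speed]
  positivity

namespace IsShockProfile

theorem differentiable_v (h : IsShockProfile T ν ε s vm um vp up v u φ) : Differentiable ℝ v :=
  h.smooth_v.differentiable (by simp)

theorem differentiable_φ (h : IsShockProfile T ν ε s vm um vp up v u φ) : Differentiable ℝ φ :=
  h.smooth_φ.differentiable (by simp)

theorem smooth_deriv_v (h : IsShockProfile T ν ε s vm um vp up v u φ) : ContDiff ℝ ∞ (deriv v) :=
  (contDiff_infty_iff_deriv.1 h.smooth_v).2

theorem smooth_deriv_u (h : IsShockProfile T ν ε s vm um vp up v u φ) : ContDiff ℝ ∞ (deriv u) :=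
  (contDiff_infty_iff_deriv.1 h.smooth_u).2

theorem smooth_deriv_φ (h : IsShockProfile T ν ε s vm um vp up v u φ) : ContDiff ℝ ∞ (deriv φ) :=
  (contDiff_infty_iff_deriv.1 h.smooth_φ).2

theorem smooth_exp (h : IsShockProfile T ν ε s vm um vp up v u φ) :
    ContDiff ℝ ∞ fun x => Real.exp (φ x) :=
  Real.contDiff_exp.comp h.smooth_φ

theorem smooth_div (h : IsShockProfile T ν ε s vm um vp up v u φ) {f : ℝ → ℝ}
    (hf : ContDiff ℝ ∞ f) : ContDiff ℝ ∞ fun x => f x / v x :=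
  hf.div h.smooth_v fun x => (h.pos x).ne'

theorem exists_le_v (h : IsShockProfile T ν ε s vm um vp up v u φ) (hvm : 0 < vm) (hvp : 0 < vp) :
    ∃ m, 0 < m ∧ ∀ x, m ≤ v x := by
  obtain ⟨C, hC⟩ := exists_norm_le_of_tendsto (f := fun x => (v x)⁻¹)
    (h.smooth_v.continuous.inv₀ fun x => (h.pos x).ne') (h.lim_v_bot.inv₀ hvm.ne')
    (h.lim_v_top.inv₀ hvp.ne')
  have hC0 : 0 < C := lt_of_lt_of_le (norm_pos_iff.2 (inv_ne_zero (h.pos 0).ne')) (hC 0)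
  refine ⟨C⁻¹, inv_pos.2 hC0, fun x => ?_⟩
  have h1 := hC x
  rw [Real.norm_of_nonneg (inv_nonneg.2 (h.pos x).le)] at h1
  exact inv_le_of_inv_le₀ (h.pos x) h1

/-- The Poisson equation for `q = φ' / v`. -/
theorem hasDerivAt_field (h : IsShockProfile T ν ε s vm um vp up v u φ) (hε : 0 < ε) (x : ℝ) :
    HasDerivAt (fun y => deriv φ y / v y) ((v x * Real.exp (φ x) - 1) / ε ^ 2) x := by
  have h1 := ((h.smooth_div h.smooth_deriv_φ).differentiable (by simp) x).hasDerivAt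
  refine h1.congr_deriv ?_
  rw [eq_div_iff (by positivity)]
  linarith [h.poisson x]

theorem tendsto_exp (h : IsShockProfile T ν ε s vm um vp up v u φ) (hvm : 0 < vm) (hvp : 0 < vp) :
    Tendsto (fun x => Real.exp (φ x)) atBot (𝓝 vm⁻¹) ∧
      Tendsto (fun x => Real.exp (φ x)) atTop (𝓝 vp⁻¹) := by
  have h1 := (Real.continuous_exp.tendsto _).comp h.lim_φ_bot
  have h2 := (Real.continuous_exp.tendsto _).comp h.lim_φ_top
  rw [Real.exp_neg, Real.exp_log hvm] at h1
  rw [Real.exp_neg, Real.exp_log hvp] at h2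
  exact ⟨h1, h2⟩

/-- The far-field states are neutral, `V e^φ = 1` in the limit, so the Poisson equation gives `q' →
0` for `q = φ' / v`. Convergence of `φ`, whose derivative is `v q`, then forces `q → 0`. -/
theorem tendsto_field_aux (h : IsShockProfile T ν ε s vm um vp up v u φ) (hε : 0 < ε)
    (hvm : 0 < vm) (hvp : 0 < vp) {l : Filter ℝ} (hl : IsEnd l) {V : ℝ} (hV : 0 < V)
    (hv : Tendsto v l (𝓝 V)) (hφ : Tendsto φ l (𝓝 (-Real.log V))) :
    Tendsto (fun x => deriv φ x / v x) l (𝓝 0) := by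
  obtain ⟨m, hm, hmv⟩ := h.exists_le_v hvm hvp
  refine hl.tendsto_zero_of_deriv hm hmv (f := φ) (fun x => ?_) (h.hasDerivAt_field hε) hφ ?_
  · rw [mul_div_cancel₀ _ (h.pos x).ne']
    exact (h.differentiable_φ x).hasDerivAt
  · have h1 := (Real.continuous_exp.tendsto _).comp hφ
    rw [Real.exp_neg, Real.exp_log hV] at h1
    have h2 := ((hv.mul h1).sub_const 1).div_const (ε ^ 2)
    rw [mul_inv_cancel₀ hV.ne', sub_self, zero_div] at h2
    exact h2

/-- The first integral of the profile equations. -/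
theorem exists_first_integral (h : IsShockProfile T ν ε s vm um vp up v u φ) (hε : 0 < ε) :
    ∃ C, ∀ x, ν * s * (deriv v x / v x) + s ^ 2 * v x + T / v x + Real.exp (φ x)
      - ε ^ 2 * (deriv φ x / v x) ^ 2 / 2 = C := by
  set F : ℝ → ℝ := fun x => ν * s * (deriv v x / v x) + s ^ 2 * v x + T / v x + Real.exp (φ x)
      - ε ^ 2 * (deriv φ x / v x) ^ 2 / 2 with hF
  have hu : ∀ x, deriv u x = -s * deriv v x := fun x => by linarith [h.mass x]
  have hd : ∀ x, HasDerivAt F 0 x := fun x => by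
    have dr := ((h.smooth_div h.smooth_deriv_v).differentiable (by simp) x).hasDerivAt
    have dv := (h.differentiable_v x).hasDerivAt
    have dT := ((h.smooth_div (contDiff_const (c := T))).differentiable (by simp) x).hasDerivAt
    have de := (h.differentiable_φ x).hasDerivAt.exp
    have dq := h.hasDerivAt_field hε x
    have hsum := ((((dr.const_mul (ν * s)).add (dv.const_mul (s ^ 2))).add dT).add de).sub
      (((dq.pow 2).const_mul (ε ^ 2)).div_const 2)
    refine hsum.congr_deriv ?_
    have hm := h.momentum x
    have e1 : (fun y => ν * deriv u y / v y) = fun y => -(ν * s) * (deriv v y / v y) := by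
      ext y; rw [hu]; ring
    rw [e1, deriv_const_mul _ dr.differentiableAt, hu] at hm
    have hv0 := (h.pos x).ne'
    -- By the Poisson equation the electric force `φ' / v` is the exact derivative of `e^φ - ε² q² /
    -- 2` with `q = φ' / v`; this makes the momentum equation integrable.
    have e2 : ε ^ 2 * (((2 : ℕ) : ℝ) * (deriv φ x / v x) ^ (2 - 1)
        * ((v x * Real.exp (φ x) - 1) / ε ^ 2)) / 2
        = Real.exp (φ x) * deriv φ x - deriv φ x / v x := by
      rw [Nat.add_one_sub_one, pow_one, Nat.cast_ofNat]
      field_simp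
    rw [e2]
    linarith
  refine ⟨F 0, fun x => ?_⟩
  exact is_const_of_deriv_eq_zero (fun y => (hd y).differentiableAt) (fun y => (hd y).deriv) x 0

/-- The first integral expresses `v'` through functions that have limits. So `v'` converges, and its
limit is zero because `v` converges too. -/
theorem tendsto_deriv_v_aux (h : IsShockProfile T ν ε s vm um vp up v u φ) (hε : 0 < ε)
    (hν : 0 < ν) (hs : 0 < s)
    (hvm : 0 < vm) (hvp : 0 < vp) {l : Filter ℝ} (hl : IsEnd l) {V : ℝ} (hV : 0 < V)
    (hv : Tendsto v l (𝓝 V)) (hφ : Tendsto φ l (𝓝 (-Real.log V))) :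
    Tendsto (deriv v) l (𝓝 0) := by
  obtain ⟨C, hC⟩ := h.exists_first_integral hε
  have hq := h.tendsto_field_aux hε hvm hvp hl hV hv hφ
  have e : deriv v = fun x => (C - s ^ 2 * v x - T / v x - Real.exp (φ x)
      + ε ^ 2 * (deriv φ x / v x) ^ 2 / 2) / (ν * s) * v x := by
    ext x
    have := hC x
    have hv0 := (h.pos x).ne'
    have e2 : C - s ^ 2 * v x - T / v x - Real.exp (φ x) + ε ^ 2 * (deriv φ x / v x) ^ 2 / 2
        = ν * s * (deriv v x / v x) := by linarith
    rw [e2]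
    field_simp
  have hlim : ∃ d, Tendsto (deriv v) l (𝓝 d) := by
    rw [e]
    refine ⟨_, ((((((hv.const_mul (s ^ 2)).const_sub C).sub (tendsto_const_nhds.div hv hV.ne')).sub
      ((Real.continuous_exp.tendsto _).comp hφ)).add
      (((hq.pow 2).const_mul (ε ^ 2)).div_const 2)).div_const (ν * s)).mul hv⟩
  obtain ⟨d, hd⟩ := hlim
  have := hl.eq_zero_of_tendsto_deriv (fun x => (h.differentiable_v x).hasDerivAt) hv hd
  rwa [this] at hd

end IsShockProfile

end Profile

/-! ### The linearized equations as a first-order system -/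

section SystemMatrix

/-- The coefficient matrix of the first-order system for `(w, z, g, p, r)`, where `g` is the second
component of the flux and `r = p' / v - φ' w / v²`. Here `V = v`, `a` is the total coefficient of
`w` in `g`, `b = φ' / v`, `e = e^φ`. -/
def systemMatrix (s ν ε : ℝ) (μ : ℂ) (V a b e : ℝ) : Matrix (Fin 5) (Fin 5) ℂ :=
  let zw : ℂ := -((V * a + ε ^ 2 * b ^ 2) / ν : ℝ)
  let zz : ℂ := -(V * s / ν : ℝ)
  let zg : ℂ := (V / ν : ℝ)
  let zp : ℂ := (V * e / ν : ℝ)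
  let zr : ℂ := -(ε ^ 2 * b * V / ν : ℝ)
  !![(μ - zw) / s, -zz / s, -zg / s, -zp / s, -zr / s;
     zw, zz, zg, zp, zr;
     0, μ, 0, 0, 0;
     (b : ℂ), 0, 0, 0, (V : ℂ);
     ((e / ε ^ 2 : ℝ) : ℂ), 0, 0, ((V * e / ε ^ 2 : ℝ) : ℂ), 0]

/-- The system matrix as an operator on `ℂ⁵`. -/
@[irreducible] def systemCLM (s ν ε : ℝ) (μ : ℂ) (V a b e : ℝ) :
    EuclideanSpace ℂ (Fin 5) →L[ℂ] EuclideanSpace ℂ (Fin 5) :=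
  Matrix.toEuclideanCLM (n := Fin 5) (𝕜 := ℂ) (systemMatrix s ν ε μ V a b e)

theorem continuous_systemCLM (s ν ε : ℝ) (μ : ℂ) :
    Continuous fun P : ℝ × ℝ × ℝ × ℝ => systemCLM s ν ε μ P.1 P.2.1 P.2.2.1 P.2.2.2 := by
  have h1 : Continuous (Matrix.toEuclideanCLM (n := Fin 5) (𝕜 := ℂ)) :=
    LinearMap.continuous_of_finiteDimensional
      (Matrix.toEuclideanCLM (n := Fin 5) (𝕜 := ℂ)).toAlgEquiv.toLinearMap
  simp only [systemCLM]
  refine h1.comp (continuous_matrix fun i j => ?_)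
  fin_cases i <;> fin_cases j <;> simp [systemMatrix] <;> fun_prop

/-- Row 1 is the flux solved for `z'`, row 0 is `s w' + z' = μ w`, row 2 is `g' = μ z`, row 3 is the
definition of `r`, and row 4 is the linearized Poisson equation `ε² r' = v e^φ p + e^φ w`. -/
theorem systemCLM_apply (s ν ε : ℝ) (μ : ℂ) (V a b e : ℝ) (y : EuclideanSpace ℂ (Fin 5)) :
    systemCLM s ν ε μ V a b e y 1
        = (V / ν : ℝ) * (y 2 - a * y 0 - s * y 1 + e * y 3)
          - (ε ^ 2 * b / ν : ℝ) * (V * y 4 + b * y 0) ∧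
      systemCLM s ν ε μ V a b e y 0 = (μ * y 0 - systemCLM s ν ε μ V a b e y 1) / s ∧
      systemCLM s ν ε μ V a b e y 2 = μ * y 1 ∧
      systemCLM s ν ε μ V a b e y 3 = V * y 4 + b * y 0 ∧
      systemCLM s ν ε μ V a b e y 4 = (1 / ε ^ 2 : ℝ) * (V * e * y 3 + e * y 0) := by
  have key : ∀ i, systemCLM s ν ε μ V a b e y i
      = ∑ j, systemMatrix s ν ε μ V a b e i j * y j := fun i => by
    rw [systemCLM, Matrix.ofLp_toEuclideanCLM]; rfl
  simp only [key, Fin.sum_univ_five]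
  refine ⟨?_, ?_, ?_, ?_, ?_⟩ <;> simp [systemMatrix] <;> ring

/-- The imaginary part `m.im (2 m.re + β)` forces a root with `m.re ≥ 0` to be real, and then every
term is nonnegative with `γ > 0`. -/
theorem quadratic_ne_zero {β γ : ℝ} (hβ : 0 < β) (hγ : 0 < γ) {m : ℂ} (hm : 0 ≤ m.re) :
    m ^ 2 + β * m + γ ≠ 0 := by
  intro h
  have h1 := congrArg Complex.re h
  have h2 := congrArg Complex.im h
  simp [pow_two] at h1 h2
  have h3 : m.im * (2 * m.re + β) = 0 := by linarith
  rcases mul_eq_zero.1 h3 with h4 | h4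
  · rw [h4] at h1
    nlinarith
  · linarith

/-- The frozen-coefficient system at a constant state has no imaginary eigenvalues for `Re μ ≥ 0`,
`μ ≠ 0`. -/
theorem isHyperbolic_systemCLM {T ν ε s V : ℝ} (hT : 0 < T) (hν : 0 < ν) (hε : 0 < ε) (hs : 0 < s)
    (hV : 0 < V) {μ : ℂ} (hμ : 0 ≤ μ.re) (hμ0 : μ ≠ 0) :
    IsHyperbolic (systemCLM s ν ε μ V (T / V ^ 2) 0 V⁻¹) := by
  intro t y hy
  obtain ⟨e1, e0, e2, e3, e4⟩ := systemCLM_apply s ν ε μ V (T / V ^ 2) 0 V⁻¹ y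
  rw [hy] at e0 e1 e2 e3 e4
  set k : ℂ := (t : ℂ) * Complex.I with hk
  simp only [PiLp.smul_apply, smul_eq_mul] at e0 e1 e2 e3 e4
  have hVc : (V : ℂ) ≠ 0 := by exact_mod_cast hV.ne'
  have hsc : (s : ℂ) ≠ 0 := by exact_mod_cast hs.ne'
  have hνc : (ν : ℂ) ≠ 0 := by exact_mod_cast hν.ne'
  have hεc : (ε : ℂ) ≠ 0 := by exact_mod_cast hε.ne'
  push_cast at e0 e1 e2 e3 e4
  have hk2 : k ^ 2 = -((t ^ 2 : ℝ) : ℂ) := by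
    rw [hk, mul_pow, Complex.I_sq]; push_cast; ring
  set w := y 0
  set z := y 1
  set g := y 2
  set p := y 3
  set r := y 4
  have f0 : k * z = (μ - k * s) * w := by
    rw [eq_div_iff hsc] at e0
    linear_combination e0
  have f4 : ε ^ 2 * (k * r) * V = V * p + w := by
    rw [e4]; field_simp
  have f3 : k * p = V * r := by rw [e3]; ring
  have f1 : ν * V * (k * z) = V ^ 2 * (g - s * z) - T * w + V * p := by
    rw [e1]; field_simp; ring
  have hw : w = 0 := by
    -- Zero wave number is separate: it leaves `μ w = 0`.
    by_cases hk0 : k = 0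
    · rw [hk0, zero_mul, zero_mul, sub_zero] at f0
      exact (mul_eq_zero.1 f0.symm).resolve_left hμ0
    · have ht : t ≠ 0 := fun h => hk0 (by rw [hk, h]; simp)
      have ht2 : 0 < t ^ 2 := by positivity
      have hd : 0 < V + ε ^ 2 * t ^ 2 := by positivity
      have g1 : ((V + ε ^ 2 * t ^ 2 : ℝ) : ℂ) * p = -w := by
        push_cast
        have : ε ^ 2 * k ^ 2 * p = V * p + w := by
          linear_combination f4 + ε ^ 2 * k * f3
        rw [hk2] at this
        push_cast at this
        linear_combination -this
      -- Passing to the frame at rest removes the convection term; `k` is imaginary, so `m` and `μ`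
      -- have the same real part.
      set m := μ - k * s with hm
      have hmre : 0 ≤ m.re := by
        have : (k * s).re = 0 := by rw [hk]; simp
        rw [hm, Complex.sub_re, this, sub_zero]; exact hμ
      have g2 : k * g = k * s * z + m * z := by rw [e2, hm]; ring
      have g3 : ν * V * (k ^ 2 * m * w) = V ^ 2 * (m * (m * w)) - T * (k ^ 2 * w)
          + V * (k ^ 2 * p) := by
        linear_combination k ^ 2 * f1 + V ^ 2 * k * g2 + (V ^ 2 * m - ν * V * k ^ 2) * f0
      set c : ℝ := (T + V / (V + ε ^ 2 * t ^ 2)) / V ^ 2 * t ^ 2 with hc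
      have hcpos : 0 < c := by positivity
      have hp : p = -w / ((V + ε ^ 2 * t ^ 2 : ℝ) : ℂ) := by
        rw [eq_div_iff (by exact_mod_cast hd.ne'), mul_comm]; exact g1
      have hdc : ((V + ε ^ 2 * t ^ 2 : ℝ) : ℂ) ≠ 0 := by exact_mod_cast hd.ne'
      -- This is the dispersion relation: viscous damping `ν t² / V`, and `c` collects the pressure
      -- and the screened electric force.
      have g4 : (m ^ 2 + ((ν / V * t ^ 2 : ℝ) : ℂ) * m + (c : ℂ)) * w = 0 := by
        rw [hk2, hp] at g3
        rw [hc]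
        push_cast at g3 hdc ⊢
        field_simp at g3 ⊢
        linear_combination -g3
      exact (mul_eq_zero.1 g4).resolve_left (quadratic_ne_zero (by positivity) hcpos hmre)
  have hz : z = 0 := by
    rw [hw, mul_zero] at f0
    rcases mul_eq_zero.1 f0 with h | h
    · rw [h, zero_mul] at e2
      exact (mul_eq_zero.1 e2.symm).resolve_left hμ0
    · exact h
  have hp : p = 0 := by
    have g1 : (((V + ε ^ 2 * t ^ 2 : ℝ) : ℂ)) * p = 0 := by
      have : ε ^ 2 * k ^ 2 * p = V * p + w := by
        linear_combination f4 + ε ^ 2 * k * f3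
      rw [hk2, hw] at this
      push_cast at this ⊢
      linear_combination -this
    exact (mul_eq_zero.1 g1).resolve_left (by
      have : 0 < V + ε ^ 2 * t ^ 2 := by positivity
      exact_mod_cast this.ne')
  have hr : r = 0 := by
    rw [hp, mul_zero] at f3
    exact (mul_eq_zero.1 f3.symm).resolve_left hVc
  have hg : g = 0 := by
    rw [hz, hw, hp] at f1
    have : (V : ℂ) ^ 2 * g = 0 := by linear_combination -f1
    exact (mul_eq_zero.1 this).resolve_left (pow_ne_zero 2 hVc)
  ext i
  fin_cases i
  · exact hw
  · exact hz
  · exact hg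
  · exact hp
  · exact hr

end SystemMatrix

/-! ### The first-order system along a shock profile -/

section ProfileSystem

/-- Smooth functions which are bounded together with their derivative. -/
structure BddSmooth (a : ℝ → ℝ) : Prop where
  smooth : ContDiff ℝ ∞ a
  bdd : ∃ C, ∀ x, |a x| ≤ C
  bdd_deriv : ∃ C, ∀ x, |deriv a x| ≤ C

namespace BddSmooth

variable {a b : ℝ → ℝ}

theorem differentiable (ha : BddSmooth a) : Differentiable ℝ a :=
  ha.smooth.differentiable (by simp)

theorem const (c : ℝ) : BddSmooth fun _ => c :=
  ⟨contDiff_const, ⟨|c|, fun _ => le_rfl⟩, 0, fun x => by simp⟩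

theorem add (ha : BddSmooth a) (hb : BddSmooth b) : BddSmooth fun x => a x + b x := by
  obtain ⟨A, hA⟩ := ha.bdd
  obtain ⟨A', hA'⟩ := ha.bdd_deriv
  obtain ⟨B, hB⟩ := hb.bdd
  obtain ⟨B', hB'⟩ := hb.bdd_deriv
  refine ⟨ha.smooth.add hb.smooth, ⟨A + B, fun x => ?_⟩, A' + B', fun x => ?_⟩
  · exact (abs_add_le _ _).trans (add_le_add (hA x) (hB x))
  · rw [((ha.differentiable x).hasDerivAt.fun_add (hb.differentiable x).hasDerivAt).deriv]
    exact (abs_add_le _ _).trans (add_le_add (hA' x) (hB' x))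

theorem mul (ha : BddSmooth a) (hb : BddSmooth b) : BddSmooth fun x => a x * b x := by
  obtain ⟨A, hA⟩ := ha.bdd
  obtain ⟨A', hA'⟩ := ha.bdd_deriv
  obtain ⟨B, hB⟩ := hb.bdd
  obtain ⟨B', hB'⟩ := hb.bdd_deriv
  refine ⟨ha.smooth.mul hb.smooth, ⟨A * B, fun x => ?_⟩, A' * B + A * B', fun x => ?_⟩
  · rw [abs_mul]
    exact mul_le_mul (hA x) (hB x) (abs_nonneg _) ((abs_nonneg _).trans (hA x))
  · rw [((ha.differentiable x).hasDerivAt.fun_mul (hb.differentiable x).hasDerivAt).deriv]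
    refine (abs_add_le _ _).trans (add_le_add ?_ ?_)
    · rw [abs_mul]
      exact mul_le_mul (hA' x) (hB x) (abs_nonneg _) ((abs_nonneg _).trans (hA' x))
    · rw [abs_mul]
      exact mul_le_mul (hA x) (hB' x) (abs_nonneg _) ((abs_nonneg _).trans (hA x))

theorem inv (ha : BddSmooth a) {m : ℝ} (hm : 0 < m) (h : ∀ x, m ≤ a x) :
    BddSmooth fun x => (a x)⁻¹ := by
  obtain ⟨A', hA'⟩ := ha.bdd_deriv
  have h0 : ∀ x, a x ≠ 0 := fun x => (hm.trans_le (h x)).ne'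
  refine ⟨ha.smooth.inv h0, ⟨m⁻¹, fun x => ?_⟩, A' / m ^ 2, fun x => ?_⟩
  · rw [abs_inv, abs_of_pos (hm.trans_le (h x))]
    exact inv_anti₀ hm (h x)
  · rw [((ha.differentiable x).hasDerivAt.fun_inv (h0 x)).deriv, abs_div, abs_neg, abs_pow,
      abs_of_pos (hm.trans_le (h x))]
    have := h x
    have hA0 : 0 ≤ A' := (abs_nonneg _).trans (hA' x)
    gcongr
    exact hA' x

end BddSmooth

/-- The total coefficient of `w` in the second component of the flux, after the elimination of
`p''` by means of the equation for `p`. -/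
def totalCoef (T ν ε : ℝ) (v u φ : ℝ → ℝ) (x : ℝ) : ℝ :=
  T / v x ^ 2 - ν * deriv u x / v x ^ 2 - ε ^ 2 * (deriv φ x / v x) ^ 2 / v x

/-- The matrix of the first-order system along a profile. -/
def profileMatrix (T ν ε s : ℝ) (μ : ℂ) (v u φ : ℝ → ℝ) (x : ℝ) :
    EuclideanSpace ℂ (Fin 5) →L[ℂ] EuclideanSpace ℂ (Fin 5) :=
  systemCLM s ν ε μ (v x) (totalCoef T ν ε v u φ x) (deriv φ x / v x) (Real.exp (φ x))

variable {T ν ε s vm um vp up : ℝ} {v u φ : ℝ → ℝ}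

namespace IsShockProfile

theorem tendsto_totalCoef_aux (h : IsShockProfile T ν ε s vm um vp up v u φ) (hε : 0 < ε)
    (hν : 0 < ν) (hs : 0 < s) (hvm : 0 < vm) (hvp : 0 < vp) {l : Filter ℝ} (hl : IsEnd l) {V : ℝ}
    (hV : 0 < V) (hv : Tendsto v l (𝓝 V)) (hφ : Tendsto φ l (𝓝 (-Real.log V))) :
    Tendsto (totalCoef T ν ε v u φ) l (𝓝 (T / V ^ 2)) := by
  have hq := h.tendsto_field_aux hε hvm hvp hl hV hv hφ
  have hdv := h.tendsto_deriv_v_aux hε hν hs hvm hvp hl hV hv hφ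
  have hdu : Tendsto (deriv u) l (𝓝 0) := by
    have e : deriv u = fun x => -s * deriv v x := by
      ext x; linarith [h.mass x]
    rw [e]
    simpa using hdv.const_mul (-s)
  have hV2 : V ^ 2 ≠ 0 := by positivity
  have := (((tendsto_const_nhds (x := T)).div (hv.pow 2) hV2).sub
    ((hdu.const_mul ν).div (hv.pow 2) hV2)).sub (((hq.pow 2).const_mul (ε ^ 2)).div hv hV.ne')
  simp only [mul_zero, zero_div, sub_zero, ne_eq, OfNat.ofNat_ne_zero, not_false_eq_true,
    zero_pow] at this
  exact this

theorem tendsto_profileMatrix_aux (h : IsShockProfile T ν ε s vm um vp up v u φ) (hε : 0 < ε)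
    (hν : 0 < ν) (hs : 0 < s) (hvm : 0 < vm) (hvp : 0 < vp) {l : Filter ℝ} (hl : IsEnd l) {V : ℝ}
    (hV : 0 < V) (hv : Tendsto v l (𝓝 V)) (hφ : Tendsto φ l (𝓝 (-Real.log V))) (μ : ℂ) :
    Tendsto (profileMatrix T ν ε s μ v u φ) l (𝓝 (systemCLM s ν ε μ V (T / V ^ 2) 0 V⁻¹)) := by
  have he := (Real.continuous_exp.tendsto _).comp hφ
  rw [Real.exp_neg, Real.exp_log hV] at he
  exact ((continuous_systemCLM s ν ε μ).tendsto (V, T / V ^ 2, 0, V⁻¹)).comp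
    (hv.prodMk_nhds ((h.tendsto_totalCoef_aux hε hν hs hvm hvp hl hV hv hφ).prodMk_nhds
      ((h.tendsto_field_aux hε hvm hvp hl hV hv hφ).prodMk_nhds he)))

theorem continuous_profileMatrix (h : IsShockProfile T ν ε s vm um vp up v u φ) (μ : ℂ) :
    Continuous (profileMatrix T ν ε s μ v u φ) := by
  have hv := h.smooth_v.continuous
  have hq := (h.smooth_div h.smooth_deriv_φ).continuous
  have hdu := h.smooth_deriv_u.continuous
  have he := h.smooth_exp.continuous
  have ha : Continuous (totalCoef T ν ε v u φ) := by
    have hp : ∀ x, v x ≠ 0 := fun x => (h.pos x).ne'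
    exact ((continuous_const.div (hv.pow 2) fun x => pow_ne_zero 2 (hp x)).sub
      ((continuous_const.mul hdu).div (hv.pow 2) fun x => pow_ne_zero 2 (hp x))).sub
      ((continuous_const.mul (hq.pow 2)).div hv hp)
  exact (continuous_systemCLM s ν ε μ).comp (hv.prodMk (ha.prodMk (hq.prodMk he)))

/-- The first-order system along a profile, as a bounded coefficient; for `Re μ ≥ 0` and `μ ≠ 0`
the differential operator which it defines is Fredholm of index zero. -/
theorem exists_coeff (h : IsShockProfile T ν ε s vm um vp up v u φ) (hT : 0 < T) (hε : 0 < ε)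
    (hν : 0 < ν) (hs : 0 < s) (hvm : 0 < vm) (hvp : 0 < vp) (μ : ℂ) :
    ∃ M : BddCoeff (EuclideanSpace ℂ (Fin 5)),
      (∀ x, M x = profileMatrix T ν ε s μ v u φ x) ∧
      (0 ≤ μ.re → μ ≠ 0 → IsFredholmZero (diffOp M).toLinearMap) := by
  have hc := h.continuous_profileMatrix μ
  have hbot := h.tendsto_profileMatrix_aux hε hν hs hvm hvp (.inr rfl) hvm h.lim_v_bot h.lim_φ_bot μ
  have htop := h.tendsto_profileMatrix_aux hε hν hs hvm hvp (.inl rfl) hvp h.lim_v_top h.lim_φ_top μ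
  refine ⟨⟨_, hc.stronglyMeasurable, exists_norm_le_of_tendsto hc hbot htop⟩, fun x => rfl,
    fun hμ hμ0 => ?_⟩
  have hm : 0 < min vm vp := lt_min hvm hvp
  -- The lower cutoff keeps the state positive for all real `t` and changes nothing on `[0, 1]`.
  set V : ℝ → ℝ := fun t => max (min vm vp) (vm + t * (vp - vm)) with hV
  have hVpos : ∀ t, 0 < V t := fun t => hm.trans_le (le_max_left _ _)
  have hV0 : V 0 = vm := by simp [hV]
  have hV1 : V 1 = vp := by simp [hV]
  have hVc : Continuous V := by fun_prop
  have hγ : Continuous fun t => systemCLM s ν ε μ (V t) (T / V t ^ 2) 0 (V t)⁻¹ :=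
    (continuous_systemCLM s ν ε μ).comp (hVc.prodMk ((continuous_const.div (hVc.pow 2) fun t =>
      pow_ne_zero 2 (hVpos t).ne').prodMk (continuous_const.prodMk
        (hVc.inv₀ fun t => (hVpos t).ne'))))
  refine isFredholmZero_diffOp hγ
    (fun t => isHyperbolic_systemCLM hT hν hε hs (hVpos t) hμ hμ0) ?_ ?_
  · rw [hV0]; exact hbot
  · rw [hV1]; exact htop

/-! ### Boundedness of the profile coefficients and of their derivatives. -/

section Bounds

theorem bddSmooth_v (h : IsShockProfile T ν ε s vm um vp up v u φ) (hε : 0 < ε)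
    (hν : 0 < ν) (hs : 0 < s) (hvm : 0 < vm) (hvp : 0 < vp) : BddSmooth v :=
  ⟨h.smooth_v, exists_norm_le_of_tendsto h.smooth_v.continuous h.lim_v_bot h.lim_v_top,
    exists_norm_le_of_tendsto h.smooth_deriv_v.continuous
      (h.tendsto_deriv_v_aux hε hν hs hvm hvp (.inr rfl) hvm h.lim_v_bot h.lim_φ_bot)
      (h.tendsto_deriv_v_aux hε hν hs hvm hvp (.inl rfl) hvp h.lim_v_top h.lim_φ_top)⟩

theorem bddSmooth_inv (h : IsShockProfile T ν ε s vm um vp up v u φ) (hε : 0 < ε)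
    (hν : 0 < ν) (hs : 0 < s) (hvm : 0 < vm) (hvp : 0 < vp) : BddSmooth fun x => (v x)⁻¹ := by
  obtain ⟨m, hm, hmv⟩ := h.exists_le_v hvm hvp
  exact (h.bddSmooth_v hε hν hs hvm hvp).inv hm hmv

theorem bddSmooth_field (h : IsShockProfile T ν ε s vm um vp up v u φ) (hε : 0 < ε)
    (hvm : 0 < vm) (hvp : 0 < vp) : BddSmooth fun x => deriv φ x / v x := by
  have hq := h.smooth_div h.smooth_deriv_φ
  refine ⟨hq, exists_norm_le_of_tendsto hq.continuous
    (h.tendsto_field_aux hε hvm hvp (.inr rfl) hvm h.lim_v_bot h.lim_φ_bot)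
    (h.tendsto_field_aux hε hvm hvp (.inl rfl) hvp h.lim_v_top h.lim_φ_top), ?_⟩
  simp only [(h.hasDerivAt_field hε _).deriv]
  have he := h.tendsto_exp hvm hvp
  exact exists_norm_le_of_tendsto
    (((h.smooth_v.continuous.mul h.smooth_exp.continuous).sub continuous_const).div_const _)
    (((h.lim_v_bot.mul he.1).sub_const 1).div_const _)
    (((h.lim_v_top.mul he.2).sub_const 1).div_const _)

theorem bddSmooth_exp (h : IsShockProfile T ν ε s vm um vp up v u φ) (hε : 0 < ε)
    (hvm : 0 < vm) (hvp : 0 < vp) : BddSmooth fun x => Real.exp (φ x) := by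
  have he := h.tendsto_exp hvm hvp
  have e : deriv (fun x => Real.exp (φ x)) = fun x => Real.exp (φ x) * (v x * (deriv φ x / v x)) := by
    ext x
    rw [(h.differentiable_φ x).hasDerivAt.exp.deriv, mul_div_cancel₀ _ (h.pos x).ne']
  refine ⟨h.smooth_exp, exists_norm_le_of_tendsto h.smooth_exp.continuous he.1 he.2, ?_⟩
  rw [e]
  exact exists_norm_le_of_tendsto (h.smooth_exp.continuous.mul (h.smooth_v.continuous.mul
      (h.smooth_div h.smooth_deriv_φ).continuous))
    (he.1.mul (h.lim_v_bot.mul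
      (h.tendsto_field_aux hε hvm hvp (.inr rfl) hvm h.lim_v_bot h.lim_φ_bot)))
    (he.2.mul (h.lim_v_top.mul
      (h.tendsto_field_aux hε hvm hvp (.inl rfl) hvp h.lim_v_top h.lim_φ_top)))

/-- The definition contains `u' = -s v'`, whose derivative would require a bound on `v''`. The first
integral rewrites the coefficient algebraically in `v`, `e^φ` and `φ' / v`, so first derivatives
suffice. -/
theorem bddSmooth_totalCoef (h : IsShockProfile T ν ε s vm um vp up v u φ) (hε : 0 < ε)
    (hν : 0 < ν) (hs : 0 < s) (hvm : 0 < vm) (hvp : 0 < vp) :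
    BddSmooth (totalCoef T ν ε v u φ) := by
  obtain ⟨C, hC⟩ := h.exists_first_integral hε
  have hq := h.bddSmooth_field hε hvm hvp
  have e : totalCoef T ν ε v u φ = fun x => (C + (-s ^ 2) * v x + (-1) * Real.exp (φ x)
      + (-ε ^ 2 / 2) * ((deriv φ x / v x) * (deriv φ x / v x))) * (v x)⁻¹ := by
    ext x
    have hu : deriv u x = -s * deriv v x := by linarith [h.mass x]
    have hv0 := (h.pos x).ne'
    rw [totalCoef, hu, ← hC x]
    field_simp
    ring
  rw [e]
  exact ((((BddSmooth.const C).add ((BddSmooth.const _).mul (h.bddSmooth_v hε hν hs hvm hvp))).add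
    ((BddSmooth.const _).mul (h.bddSmooth_exp hε hvm hvp))).add
    ((BddSmooth.const _).mul (hq.mul hq))).mul (h.bddSmooth_inv hε hν hs hvm hvp)

end Bounds

end IsShockProfile

end ProfileSystem

/-! ### Components of vector-valued functions -/

section Components

variable {ι : Type*} [Fintype ι]

/-- The `i`-th component of a vector-valued function in `L²`. -/
def component (i : ι) : Lp (EuclideanSpace ℂ ι) 2 (volume : Measure ℝ) →L[ℂ] L2 :=
  (EuclideanSpace.proj (𝕜 := ℂ) i).compLpL 2 volume

theorem coeFn_component (i : ι) (u : Lp (EuclideanSpace ℂ ι) 2 (volume : Measure ℝ)) :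
    component i u =ᵐ[volume] fun x => u x i :=
  (EuclideanSpace.proj (𝕜 := ℂ) i).coeFn_compLp u

theorem hasWeakDeriv_component (i : ι) (q : sobolev (EuclideanSpace ℂ ι)) :
    HasWeakDeriv (component i q.1.1) (component i q.1.2) :=
  hasWeakDeriv_iff_weakDeriv.2 (compLp_mem_sobolev (EuclideanSpace.proj (𝕜 := ℂ) i) q)

variable [DecidableEq ι]

/-- The function in `L²` whose `i`-th component is given and whose other components vanish. -/
def ofComponent (i : ι) : L2 →L[ℂ] Lp (EuclideanSpace ℂ ι) 2 (volume : Measure ℝ) :=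
  (ContinuousLinearMap.toSpanSingleton ℂ (EuclideanSpace.single i (1 : ℂ))).compLpL 2 volume

theorem coeFn_ofComponent (i : ι) (f : L2) :
    ofComponent i f =ᵐ[volume] fun x => EuclideanSpace.single i (f x) := by
  filter_upwards [(ContinuousLinearMap.toSpanSingleton ℂ
    (EuclideanSpace.single i (1 : ℂ))).coeFn_compLp f] with x hx
  refine hx.trans ?_
  ext j
  by_cases hj : j = i <;> simp [hj]

/-- The function in `L²` with given components. -/
def assemble (y : ι → L2) : Lp (EuclideanSpace ℂ ι) 2 (volume : Measure ℝ) :=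
  ∑ i, ofComponent i (y i)

theorem coeFn_assemble (y : ι → L2) : ∀ᵐ x : ℝ, ∀ i, assemble y x i = y i x := by
  filter_upwards [Lp.coeFn_fun_finsetSum Finset.univ fun i => ofComponent i (y i),
    ae_all_iff.2 fun i => coeFn_ofComponent i (y i)] with x h1 h2 j
  rw [assemble, h1, WithLp.ofLp_sum, Finset.sum_apply, Finset.sum_eq_single j]
  · rw [h2]; simp
  · intro i _ hij
    rw [h2]; simp [hij.symm]
  · simp

theorem component_assemble (y : ι → L2) (i : ι) : component i (assemble y) = y i := by
  refine Lp.ext ?_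
  filter_upwards [coeFn_component i (assemble y), coeFn_assemble y] with x h1 h2
  rw [h1, h2]

theorem assemble_mem_sobolev {y y' : ι → L2} (h : ∀ i, HasWeakDeriv (y i) (y' i)) :
    (assemble y, assemble y') ∈ sobolev (EuclideanSpace ℂ ι) := by
  have e : (assemble y, assemble y') = ∑ i, (ofComponent i (y i), ofComponent i (y' i)) := by
    ext1
    · rw [Prod.fst_sum]; rfl
    · rw [Prod.snd_sum]; rfl
  rw [e]
  exact Submodule.sum_mem _ fun i _ => compLp_mem_sobolev
    (ContinuousLinearMap.toSpanSingleton ℂ (EuclideanSpace.single i (1 : ℂ)))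
    ⟨(y i, y' i), hasWeakDeriv_iff_weakDeriv.1 (h i)⟩

end Components

theorem diffOp_eq_iff {E : Type*} [NormedAddCommGroup E] [InnerProductSpace ℂ E] {M : BddCoeff E}
    {q : sobolev E} {G : Lp E 2 (volume : Measure ℝ)} :
    diffOp M q = G ↔ ∀ᵐ x : ℝ, q.1.2 x = M x (q.1.1 x) + G x := by
  rw [diffOp_apply, sub_eq_iff_eq_add', Lp.ext_iff]
  constructor <;> intro h
  · filter_upwards [h, Lp.coeFn_add (mulOp M q.1.1) G, coeFn_mulOp M q.1.1] with x h1 h2 h3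
    rw [h1, h2, Pi.add_apply, h3]
  · filter_upwards [h, Lp.coeFn_add (mulOp M q.1.1) G, coeFn_mulOp M q.1.1] with x h1 h2 h3
    rw [h1, h2, Pi.add_apply, h3]

/-! ### Multiplication by bounded smooth functions on `L²` and `H¹`. -/

section Multiplication

variable {a : ℝ → ℝ} {f g : ℝ → ℂ}

theorem BddSmooth.memLp_mul (ha : BddSmooth a) (hf : MemLp f 2 (volume : Measure ℝ)) :
    MemLp (fun x => (a x : ℂ) * f x) 2 (volume : Measure ℝ) := by
  obtain ⟨C, hC⟩ := ha.bdd
  refine hf.of_le_mul (c := C) ?_ (Eventually.of_forall fun x => ?_)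
  · exact (Complex.continuous_ofReal.comp ha.smooth.continuous).aestronglyMeasurable.mul hf.1
  · rw [norm_mul, Complex.norm_real]
    exact mul_le_mul_of_nonneg_right (hC x) (norm_nonneg _)

theorem BddSmooth.memLp_deriv_mul (ha : BddSmooth a) (hf : MemLp f 2 (volume : Measure ℝ)) :
    MemLp (fun x => ((deriv a x : ℝ) : ℂ) * f x) 2 (volume : Measure ℝ) := by
  obtain ⟨C, hC⟩ := ha.bdd_deriv
  refine hf.of_le_mul (c := C) ?_ (Eventually.of_forall fun x => ?_)
  · exact (Complex.continuous_ofReal.comp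
      (continuous_deriv_of_contDiff ha.smooth)).aestronglyMeasurable.mul hf.1
  · rw [norm_mul, Complex.norm_real]
    exact mul_le_mul_of_nonneg_right (hC x) (norm_nonneg _)

theorem HasWeakDeriv.smooth_mul (h : HasWeakDeriv f g) (ha : ContDiff ℝ ∞ a) :
    HasWeakDeriv (fun x => (a x : ℂ) * f x) fun x => ((deriv a x : ℝ) : ℂ) * f x + (a x : ℂ) * g x :=
  hasWeakDeriv_iff_weakDeriv.2 <| by
    simpa only [Complex.real_smul] using (hasWeakDeriv_iff_weakDeriv.1 h).smul_smooth ha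

theorem HasWeakDeriv.unique {g' : ℝ → ℂ} (h : HasWeakDeriv f g) (h' : HasWeakDeriv f g') :
    g =ᵐ[volume] g' :=
  (hasWeakDeriv_iff_weakDeriv.1 h).unique (hasWeakDeriv_iff_weakDeriv.1 h')

/-- Membership in `H¹(ℝ)`. -/
def InH1 (f : ℝ → ℂ) : Prop :=
  MemLp f 2 (volume : Measure ℝ) ∧ ∃ g, HasWeakDeriv f g ∧ MemLp g 2 (volume : Measure ℝ)

theorem InH1.of_hasWeakDeriv {f g : L2} (h : HasWeakDeriv f g) : InH1 f :=
  ⟨Lp.memLp f, g, h, Lp.memLp g⟩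

theorem InH1.add {f₁ f₂ : ℝ → ℂ} (h₁ : InH1 f₁) (h₂ : InH1 f₂) :
    InH1 fun x => f₁ x + f₂ x := by
  obtain ⟨m₁, g₁, d₁, l₁⟩ := h₁
  obtain ⟨m₂, g₂, d₂, l₂⟩ := h₂
  exact ⟨m₁.add m₂, _, d₁.add d₂, l₁.add l₂⟩

theorem InH1.smooth_mul (h : InH1 f) (ha : BddSmooth a) : InH1 fun x => (a x : ℂ) * f x := by
  obtain ⟨m, g, d, l⟩ := h
  exact ⟨ha.memLp_mul m, _, d.smooth_mul ha.smooth, (ha.memLp_deriv_mul m).add (ha.memLp_mul l)⟩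

theorem InH1.exists_hasWeakDeriv {F : L2} (h : InH1 f) (e : f =ᵐ[volume] F) :
    ∃ G : L2, HasWeakDeriv F G := by
  obtain ⟨-, g, d, l⟩ := h
  exact ⟨l.toLp g, d.congr e l.coeFn_toLp.symm⟩

end Multiplication

/-! ### Equivalence of the linearized operator and the first-order system -/

section Transport

variable {T ν ε s vm um vp up : ℝ} {v u φ : ℝ → ℝ}

namespace IsShockProfile

theorem deriv_field (h : IsShockProfile T ν ε s vm um vp up v u φ) (x : ℝ) :
    deriv (fun y => deriv φ y / v y) x
      = (deriv (deriv φ) x * v x - deriv φ x * deriv v x) / v x ^ 2 :=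
  deriv_fun_div (h.smooth_deriv_φ.differentiable (by simp) x) (h.differentiable_v x) (h.pos x).ne'

theorem deriv_field_div (h : IsShockProfile T ν ε s vm um vp up v u φ) (x : ℝ) :
    deriv (fun y => deriv φ y / v y ^ 2) x
      = deriv (deriv φ) x / v x ^ 2 - 2 * deriv φ x * deriv v x / v x ^ 3 := by
  have hv := (h.pos x).ne'
  rw [deriv_fun_div (h.smooth_deriv_φ.differentiable (by simp) x) ((h.differentiable_v x).fun_pow 2)
    (pow_ne_zero 2 hv), ((h.differentiable_v x).hasDerivAt.fun_pow 2).deriv]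
  field_simp
  push_cast
  ring

theorem deriv_inv (h : IsShockProfile T ν ε s vm um vp up v u φ) (x : ℝ) :
    deriv (fun y => (v y)⁻¹) x = -deriv v x / v x ^ 2 :=
  ((h.differentiable_v x).hasDerivAt.fun_inv (h.pos x).ne').deriv

/-- The second component of the flux after elimination of `p''`. -/
theorem flux₂_eq (h : IsShockProfile T ν ε s vm um vp up v u φ) (hε : 0 < ε)
    {w w' z z' p p' p'' : ℝ → ℂ} {x : ℝ} (hx : opA ε v φ p p' p'' x = opB ε v φ w w' x) :
    flux₂ T ν ε s v u φ w w' z z' p' p'' x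
      = (totalCoef T ν ε v u φ x : ℂ) * w x + s * z x + ((ν * (v x)⁻¹ : ℝ) : ℂ) * z' x
        + ((ε ^ 2 * (deriv φ x / v x * (v x)⁻¹) : ℝ) : ℂ) * p' x
        + ((-1 * Real.exp (φ x) : ℝ) : ℂ) * p x := by
  have hP := (h.hasDerivAt_field hε x).deriv
  rw [h.deriv_field] at hP
  have hv := (h.pos x).ne'
  have hvc : (v x : ℂ) ≠ 0 := by exact_mod_cast hv
  have hεc : (ε : ℂ) ≠ 0 := by exact_mod_cast hε.ne'
  -- The profile Poisson equation removes `φ''`, so that no second derivative of the profile is left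
  -- in the coefficients.
  have hP' : deriv (deriv φ) x = (v x * (v x * Real.exp (φ x) - 1)) / ε ^ 2
      + deriv φ x * deriv v x / v x := by
    field_simp at hP ⊢
    linarith
  simp only [flux₂, opA, opB, coefA, coefB, coefD, coefE, totalCoef, h.deriv_field_div,
    h.deriv_field, hP'] at hx ⊢
  generalize Real.exp (φ x) = e at *
  generalize deriv v x = dv at *
  generalize deriv φ x = dφ at *
  generalize v x = V at *
  push_cast at hx ⊢
  -- Dividing `𝒜 p = ℬ w` by `v` expresses `E₂₁ p''`, and its `w'` term cancels `B₂₁ w'`. Hence the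
  -- flux contains no `w'`.
  linear_combination (norm := skip) (1 / (V : ℂ)) * hx
  field_simp
  ring

end IsShockProfile

/-- The inclusion of right-hand sides of the resolvent equation into those of the first-order
system. -/
def source (s : ℝ) : (L2 × L2) →L[ℂ] Lp (EuclideanSpace ℂ (Fin 5)) 2 (volume : Measure ℝ) :=
  (s⁻¹ : ℂ) • (ofComponent 0).comp (ContinuousLinearMap.fst ℂ L2 L2)
    + (ofComponent 2).comp (ContinuousLinearMap.snd ℂ L2 L2)

theorem coeFn_source (s : ℝ) (F : L2 × L2) :
    ∀ᵐ x : ℝ, source s F x 0 = F.1 x / s ∧ source s F x 1 = 0 ∧ source s F x 2 = F.2 x ∧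
      source s F x 3 = 0 ∧ source s F x 4 = 0 := by
  filter_upwards [Lp.coeFn_add ((s⁻¹ : ℂ) • ofComponent (0 : Fin 5) F.1) (ofComponent 2 F.2),
    Lp.coeFn_smul (s⁻¹ : ℂ) (ofComponent (0 : Fin 5) F.1), coeFn_ofComponent (0 : Fin 5) F.1,
    coeFn_ofComponent (2 : Fin 5) F.2] with x h1 h2 h3 h4
  have e : source s F x = (s⁻¹ : ℂ) • EuclideanSpace.single 0 (F.1 x)
      + EuclideanSpace.single 2 (F.2 x) := by
    refine h1.trans ?_
    rw [Pi.add_apply, h2, Pi.smul_apply, h3, h4]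
  rw [e]
  simp [div_eq_inv_mul]

end Transport

/-! ### Passage between the resolvent equation and the first-order system. -/

section TransportIff

/-- The pointwise algebra for both directions of the equivalence: the system, with sources only in
rows 0 and 2, is the flux formula together with the equations for mass, momentum, `r` and `r'`. -/
theorem eq_systemCLM_add_iff {s ν ε V : ℝ} (hs : 0 < s) (hν : 0 < ν) (hε : 0 < ε) (hV : 0 < V)
    {μ : ℂ} {a b e : ℝ} {y dy G : EuclideanSpace ℂ (Fin 5)} (h1 : G 1 = 0) (h3 : G 3 = 0)
    (h4 : G 4 = 0) :
    dy = systemCLM s ν ε μ V a b e y + G ↔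
      y 2 = (a : ℂ) * y 0 + s * y 1 + ((ν * V⁻¹ : ℝ) : ℂ) * dy 1
          + ((ε ^ 2 * (b * V⁻¹) : ℝ) : ℂ) * dy 3 + ((-1 * e : ℝ) : ℂ) * y 3 ∧
      s * dy 0 + dy 1 = μ * y 0 + s * G 0 ∧ dy 2 = μ * y 1 + G 2 ∧
      dy 3 = V * y 4 + b * y 0 ∧
      dy 4 = ((ε ^ 2)⁻¹ : ℝ) * (V * e * y 3 + e * y 0) := by
  obtain ⟨e1, e0, e2, e3, e4⟩ := systemCLM_apply s ν ε μ V a b e y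
  have hsc : (s : ℂ) ≠ 0 := by exact_mod_cast hs.ne'
  have hνc : (ν : ℂ) ≠ 0 := by exact_mod_cast hν.ne'
  have hεc : (ε : ℂ) ≠ 0 := by exact_mod_cast hε.ne'
  have hVc : (V : ℂ) ≠ 0 := by exact_mod_cast hV.ne'
  have hext : dy = systemCLM s ν ε μ V a b e y + G ↔
      ∀ i, dy i = systemCLM s ν ε μ V a b e y i + G i :=
    ⟨fun h i => by rw [h]; rfl, fun h => by ext i; exact h i⟩
  rw [hext]
  generalize systemCLM s ν ε μ V a b e y = N at *
  push_cast at *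
  constructor
  · intro h
    have d3 := h 3
    have d1 := h 1
    rw [h1, add_zero] at d1
    rw [h3, add_zero] at d3
    refine ⟨?_, ?_, ?_, d3.trans e3, ?_⟩
    · rw [d3, d1, e1, e3]
      field_simp
      ring
    · rw [h 0, e0, d1]
      field_simp
      ring
    · rw [h 2, e2]
    · rw [h 4, e4, h4]
      ring
  · rintro ⟨d1, d0, d2, d3, d4⟩ i
    have g1 : dy 1 = N 1 := by
      rw [e1, d1, d3]
      field_simp
      ring
    fin_cases i
    · change dy 0 = N 0 + G 0
      rw [e0, ← g1]
      field_simp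
      linear_combination d0
    · change dy 1 = N 1 + G 1
      rw [g1, h1, add_zero]
    · change dy 2 = N 2 + G 2
      rw [d2, e2]
    · change dy 3 = N 3 + G 3
      rw [d3, e3, h3, add_zero]
    · change dy 4 = N 4 + G 4
      rw [d4, e4, h4]
      ring

variable {T ν ε s vm um vp up : ℝ} {v u φ : ℝ → ℝ}

theorem IsShockProfile.smooth_inv (h : IsShockProfile T ν ε s vm um vp up v u φ) :
    ContDiff ℝ ∞ fun x => (v x)⁻¹ :=
  h.smooth_v.inv fun x => (h.pos x).ne'

theorem IsShockProfile.smooth_field_div (h : IsShockProfile T ν ε s vm um vp up v u φ) :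
    ContDiff ℝ ∞ fun x => -(deriv φ x / v x ^ 2) :=
  (h.smooth_deriv_φ.div (h.smooth_v.pow 2) fun x => pow_ne_zero 2 (h.pos x).ne').neg

theorem coeFn_source_sub (s : ℝ) (μ : ℂ) (F U : L2 × L2) :
    ∀ᵐ x : ℝ, source s (F - μ • U) x 0 = (F.1 x - μ * U.1 x) / s ∧
      source s (F - μ • U) x 1 = 0 ∧ source s (F - μ • U) x 2 = F.2 x - μ * U.2 x ∧
      source s (F - μ • U) x 3 = 0 ∧ source s (F - μ • U) x 4 = 0 := by
  filter_upwards [coeFn_source s (F - μ • U), Lp.coeFn_sub F.1 (μ • U.1),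
    Lp.coeFn_sub F.2 (μ • U.2), Lp.coeFn_smul μ U.1, Lp.coeFn_smul μ U.2] with x h1 h2 h3 h4 h5
  rw [Prod.fst_sub, Prod.snd_sub, Prod.smul_fst, Prod.smul_snd, h2, h3, Pi.sub_apply,
    Pi.sub_apply, h4, h5] at h1
  exact h1

/-- The vector `Y = (w, z, g, p, r)` belongs to `H¹`: `g` is differentiable as a whole because its
weak derivative is the second component of `F`, and `r` because `p'` and `w` are in `H¹`. -/
theorem exists_diffOp_eq_source (h : IsShockProfile T ν ε s vm um vp up v u φ) (hε : 0 < ε)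
    (hν : 0 < ν) (hs : 0 < s) (hvm : 0 < vm) (hvp : 0 < vp) {μ : ℂ}
    {M : BddCoeff (EuclideanSpace ℂ (Fin 5))} (hM : ∀ x, M x = profileMatrix T ν ε s μ v u φ x)
    {U F : L2 × L2} (hUF : LinearizedRel T ν ε s v u φ U F) :
    ∃ Y : sobolev (EuclideanSpace ℂ (Fin 5)), component 0 Y.1.1 = U.1 ∧ component 1 Y.1.1 = U.2 ∧
      diffOp M Y = source s (F - μ • U) := by
  obtain ⟨w', z', z'', p, p', p'', hw, hz, hz', hp, hp', hop, hF1, hF2⟩ := hUF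
  have bi := h.bddSmooth_inv hε hν hs hvm hvp
  have bq := h.bddSmooth_field hε hvm hvp
  have be := h.bddSmooth_exp hε hvm hvp
  have bv := h.bddSmooth_v hε hν hs hvm hvp
  have hg : MemLp (fun x => (totalCoef T ν ε v u φ x : ℂ) * U.1 x + ((s : ℝ) : ℂ) * U.2 x
      + ((ν * (v x)⁻¹ : ℝ) : ℂ) * z' x + ((ε ^ 2 * (deriv φ x / v x * (v x)⁻¹) : ℝ) : ℂ) * p' x
      + ((-1 * Real.exp (φ x) : ℝ) : ℂ) * p x) 2 (volume : Measure ℝ) :=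
    (((((h.bddSmooth_totalCoef hε hν hs hvm hvp).memLp_mul (Lp.memLp _)).add
      ((BddSmooth.const s).memLp_mul (Lp.memLp _))).add
      (((BddSmooth.const ν).mul bi).memLp_mul (Lp.memLp _))).add
      (((BddSmooth.const (ε ^ 2)).mul (bq.mul bi)).memLp_mul (Lp.memLp _))).add
      (((BddSmooth.const (-1)).mul be).memLp_mul (Lp.memLp _))
  have bβ : BddSmooth fun x => -(deriv φ x / v x ^ 2) := by
    have e : (fun x => -(deriv φ x / v x ^ 2)) = fun x => -1 * (deriv φ x / v x * (v x)⁻¹) := by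
      ext x
      have := (h.pos x).ne'
      field_simp
    rw [e]
    exact (BddSmooth.const (-1)).mul (bq.mul bi)
  have hr : MemLp (fun x => (((v x)⁻¹ : ℝ) : ℂ) * p' x
      + ((-(deriv φ x / v x ^ 2) : ℝ) : ℂ) * U.1 x) 2 (volume : Measure ℝ) :=
    (bi.memLp_mul (Lp.memLp _)).add (bβ.memLp_mul (Lp.memLp _))
  have hr' : MemLp (fun x => (((ε ^ 2)⁻¹ * (v x * Real.exp (φ x)) : ℝ) : ℂ) * p x
      + (((ε ^ 2)⁻¹ * Real.exp (φ x) : ℝ) : ℂ) * U.1 x) 2 (volume : Measure ℝ) :=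
    (((BddSmooth.const _).mul (bv.mul be)).memLp_mul (Lp.memLp _)).add
      (((BddSmooth.const _).mul be).memLp_mul (Lp.memLp _))
  have hgd : HasWeakDeriv (hg.toLp _) F.2 := by
    refine hF2.congr ?_ EventuallyEq.rfl
    filter_upwards [hg.coeFn_toLp, hop] with x hx hox
    rw [hx, h.flux₂_eq hε hox]
  -- The product rule produces `p''` and `w'`; the equation `𝒜 p = ℬ w` replaces them by the
  -- undifferentiated `p` and `w`.
  have hrd : HasWeakDeriv (hr.toLp _) (hr'.toLp _) := by
    refine ((hp'.smooth_mul h.smooth_inv).add (hw.smooth_mul h.smooth_field_div)).congr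
      hr.coeFn_toLp.symm ?_
    filter_upwards [hr'.coeFn_toLp, hop] with x hx hox
    rw [hx, h.deriv_inv, deriv.fun_neg, h.deriv_field_div]
    simp only [opA, opB] at hox
    have hvc : (v x : ℂ) ≠ 0 := by exact_mod_cast (h.pos x).ne'
    have hεc : (ε : ℂ) ≠ 0 := by exact_mod_cast hε.ne'
    generalize Real.exp (φ x) = e at *
    push_cast at hox ⊢
    linear_combination (norm := skip) (-1 / (ε : ℂ) ^ 2) * hox
    field_simp
    ring
  have hF1' : (fun x => (s : ℂ) * w' x + z' x) =ᵐ[volume] F.1 :=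
    ((hw.const_mul (s : ℂ)).add hz).unique hF1
  set y : Fin 5 → L2 := ![U.1, U.2, hg.toLp _, p, hr.toLp _] with hy
  set y' : Fin 5 → L2 := ![w', z', F.2, p', hr'.toLp _] with hy'
  have hd : ∀ i, HasWeakDeriv (y i) (y' i) := by
    intro i
    fin_cases i
    · exact hw
    · exact hz
    · exact hgd
    · exact hp
    · exact hrd
  refine ⟨⟨_, assemble_mem_sobolev hd⟩, component_assemble y 0, component_assemble y 1, ?_⟩
  rw [diffOp_eq_iff]
  filter_upwards [coeFn_assemble y, coeFn_assemble y', coeFn_source_sub s μ F U, hF1',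
    hg.coeFn_toLp, hr.coeFn_toLp, hr'.coeFn_toLp] with x a1 a2 ⟨s0, s1, s2, s3, s4⟩ f1 eg er er'
  rw [hM, profileMatrix, eq_systemCLM_add_iff hs hν hε (h.pos x) s1 s3 s4]
  simp only [a1, a2, s0, s2]
  have hvc : (v x : ℂ) ≠ 0 := by exact_mod_cast (h.pos x).ne'
  have hsc : (s : ℂ) ≠ 0 := by exact_mod_cast hs.ne'
  refine ⟨?_, ?_, ?_, ?_, ?_⟩
  · exact eg
  · change (s : ℂ) * w' x + z' x = _
    rw [f1, mul_div_cancel₀ _ hsc]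
    simp [hy]
  · simp [hy, hy']
  · change p' x = v x * hr.toLp _ x + _ * U.1 x
    rw [er]
    push_cast
    field_simp
    ring
  · change hr'.toLp _ x = _ * (_ * p x + _ * U.1 x)
    rw [er']
    push_cast
    ring

/-- The missing regularity comes from the rows of the system: `p'` and `z'` are combinations of
components of `Y` in `H¹` with coefficients bounded together with their derivatives, so `p` and `z`
are in `H²`. -/
theorem linearizedRel_of_diffOp_eq_source (h : IsShockProfile T ν ε s vm um vp up v u φ)
    (hε : 0 < ε) (hν : 0 < ν) (hs : 0 < s) (hvm : 0 < vm) (hvp : 0 < vp) {μ : ℂ}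
    {M : BddCoeff (EuclideanSpace ℂ (Fin 5))} (hM : ∀ x, M x = profileMatrix T ν ε s μ v u φ x)
    {U F : L2 × L2} {Y : sobolev (EuclideanSpace ℂ (Fin 5))} (h0 : component 0 Y.1.1 = U.1)
    (h1 : component 1 Y.1.1 = U.2) (hY : diffOp M Y = source s (F - μ • U)) :
    LinearizedRel T ν ε s v u φ U F := by
  have bi := h.bddSmooth_inv hε hν hs hvm hvp
  have bq := h.bddSmooth_field hε hvm hvp
  have be := h.bddSmooth_exp hε hvm hvp
  have bv := h.bddSmooth_v hε hν hs hvm hvp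
  have ba := h.bddSmooth_totalCoef hε hν hs hvm hvp
  have hd := fun i => hasWeakDeriv_component i Y
  set y : Fin 5 → L2 := fun i => component i Y.1.1 with hy
  set y' : Fin 5 → L2 := fun i => component i Y.1.2 with hy'
  have hH1 : ∀ i, InH1 (y i) := fun i => .of_hasWeakDeriv (hd i)
  have key : ∀ᵐ x : ℝ, y 2 x = (totalCoef T ν ε v u φ x : ℂ) * y 0 x + s * y 1 x
        + ((ν * (v x)⁻¹ : ℝ) : ℂ) * y' 1 x
        + ((ε ^ 2 * (deriv φ x / v x * (v x)⁻¹) : ℝ) : ℂ) * y' 3 x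
        + ((-1 * Real.exp (φ x) : ℝ) : ℂ) * y 3 x ∧
      s * y' 0 x + y' 1 x = F.1 x ∧ y' 2 x = F.2 x ∧
      y' 3 x = v x * y 4 x + (deriv φ x / v x : ℝ) * y 0 x ∧
      y' 4 x = ((ε ^ 2)⁻¹ : ℝ) * (v x * Real.exp (φ x) * y 3 x + Real.exp (φ x) * y 0 x) := by
    filter_upwards [diffOp_eq_iff.1 hY, coeFn_source_sub s μ F U,
      ae_all_iff.2 fun i => coeFn_component i Y.1.1, ae_all_iff.2 fun i => coeFn_component i Y.1.2]
      with x hx ⟨s0, s1, s2, s3, s4⟩ a1 a2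
    rw [hM, profileMatrix, eq_systemCLM_add_iff hs hν hε (h.pos x) s1 s3 s4, s0, s2] at hx
    simp only [← a1, ← a2, ← h0, ← h1] at hx
    have hsc : (s : ℂ) ≠ 0 := by exact_mod_cast hs.ne'
    obtain ⟨c2, c0, c1, c3, c4⟩ := hx
    refine ⟨c2, ?_, ?_, c3, c4⟩
    · rw [mul_div_cancel₀ _ hsc] at c0
      exact c0.trans (by ring)
    · exact c1.trans (by ring)
  -- `z'` and `p'` have weak derivatives in `L²`
  have hp1 : HasWeakDeriv (y' 3)
      (fun x => ((deriv v x : ℝ) : ℂ) * y 4 x + (v x : ℂ) * y' 4 x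
        + (((deriv (fun y => deriv φ y / v y) x : ℝ) : ℂ) * y 0 x
          + ((deriv φ x / v x : ℝ) : ℂ) * y' 0 x)) := by
    refine (((hd 4).smooth_mul bv.smooth).add ((hd 0).smooth_mul bq.smooth)).congr ?_
      EventuallyEq.rfl
    filter_upwards [key] with x hx
    exact hx.2.2.2.1.symm
  have hp2 : MemLp (fun x => ((deriv v x : ℝ) : ℂ) * y 4 x + (v x : ℂ) * y' 4 x
        + (((deriv (fun y => deriv φ y / v y) x : ℝ) : ℂ) * y 0 x
          + ((deriv φ x / v x : ℝ) : ℂ) * y' 0 x)) 2 (volume : Measure ℝ) :=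
    ((bv.memLp_deriv_mul (Lp.memLp _)).add (bv.memLp_mul (Lp.memLp _))).add
      ((bq.memLp_deriv_mul (Lp.memLp _)).add (bq.memLp_mul (Lp.memLp _)))
  obtain ⟨z'', hz''⟩ : ∃ z'' : L2, HasWeakDeriv (y' 1) z'' := by
    refine InH1.exists_hasWeakDeriv (f := fun x => ((ν⁻¹ * v x : ℝ) : ℂ) * (y 2 x
      + ((-1 * totalCoef T ν ε v u φ x : ℝ) : ℂ) * y 0 x + ((-s : ℝ) : ℂ) * y 1 x
      + (Real.exp (φ x) : ℂ) * y 3 x)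
      + ((-ε ^ 2 / ν * (deriv φ x / v x) : ℝ) : ℂ) * ((v x : ℂ) * y 4 x
        + ((deriv φ x / v x : ℝ) : ℂ) * y 0 x)) ?_ ?_
    · exact (((((hH1 2).add ((hH1 0).smooth_mul ((BddSmooth.const (-1)).mul ba))).add
        ((hH1 1).smooth_mul (BddSmooth.const (-s)))).add ((hH1 3).smooth_mul be)).smooth_mul
        ((BddSmooth.const ν⁻¹).mul bv)).add
        ((((hH1 4).smooth_mul bv).add ((hH1 0).smooth_mul bq)).smooth_mul
          ((BddSmooth.const (-ε ^ 2 / ν)).mul bq))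
    · filter_upwards [key] with x hx
      rw [hx.1, ← hx.2.2.2.1]
      have hvc : (v x : ℂ) ≠ 0 := by exact_mod_cast (h.pos x).ne'
      have hνc : (ν : ℂ) ≠ 0 := by exact_mod_cast hν.ne'
      push_cast
      field_simp
      ring
  have hop : ∀ᵐ x : ℝ, opA ε v φ (y 3) (y' 3) (hp2.toLp _) x = opB ε v φ (y 0) (y' 0) x := by
    filter_upwards [key, hp2.coeFn_toLp] with x hx ex
    simp only [opA, opB]
    rw [ex, h.deriv_field, hx.2.2.2.1, hx.2.2.2.2]
    have hvc : (v x : ℂ) ≠ 0 := by exact_mod_cast (h.pos x).ne'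
    have hεc : (ε : ℂ) ≠ 0 := by exact_mod_cast hε.ne'
    generalize Real.exp (φ x) = e
    push_cast
    field_simp
    ring
  obtain ⟨U1, U2⟩ := U
  simp only at h0 h1
  subst h0 h1
  refine ⟨y' 0, y' 1, z'', y 3, y' 3, hp2.toLp _, hd 0, hd 1, hz'', hd 3,
    hp1.congr EventuallyEq.rfl hp2.coeFn_toLp.symm, hop, ?_, ?_⟩
  · refine (((hd 0).const_mul (s : ℂ)).add (hd 1)).congr EventuallyEq.rfl ?_
    filter_upwards [key] with x hx
    exact hx.2.1
  · refine (hd 2).congr ?_ ?_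
    · filter_upwards [key, hop] with x hx ox
      rw [h.flux₂_eq hε ox]
      exact hx.1
    · filter_upwards [key] with x hx
      exact hx.2.2.1

end TransportIff

/-! ### Transfer of the Fredholm property -/

section Transfer

variable {X Y Z : Type*} [NormedAddCommGroup X] [NormedSpace ℂ X] [AddCommGroup Y] [Module ℂ Y]
  [NormedAddCommGroup Z] [NormedSpace ℂ Z]

/-- Here `T` is the system, `S` the shifted operator, `J` the inclusion of sources and `π` the
projection to the original unknowns. By `ha` and `hb` the range of `S` is the preimage of that of
`T`, and with `hc` the map `π` identifies the kernels. By `hd` every right-hand side is a source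
modulo the range of `T`, so the cokernels agree as well. -/
theorem IsFredholmZero.transfer {T : Y →ₗ[ℂ] Z} (hT : IsFredholmZero T) {D : Submodule ℂ X}
    {S : D →ₗ[ℂ] X} {J : X →L[ℂ] Z} {π : Y →ₗ[ℂ] X}
    (ha : ∀ U : D, ∃ y, π y = U ∧ T y = J (S U))
    (hb : ∀ y G, T y = J G → ∃ U : D, (U : X) = π y ∧ S U = G)
    (hc : ∀ y G, π y = 0 → T y = J G → y = 0) (hd : ∀ g, ∃ y G, T y = g + J G) :
    IsFredholmOp S ∧ fredholmIndex S = 0 := by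
  have hr : LinearMap.range S = (LinearMap.range T).comap J.toLinearMap := by
    ext G
    constructor
    · rintro ⟨U, rfl⟩
      obtain ⟨y, -, hy⟩ := ha U
      exact ⟨y, hy⟩
    · rintro ⟨y, hy⟩
      obtain ⟨U, -, hU⟩ := hb y G hy
      exact ⟨U, hU⟩
  have hmap : (LinearMap.ker T).map π = (LinearMap.ker S).map D.subtype := by
    ext x
    constructor
    · rintro ⟨y, hy, rfl⟩
      obtain ⟨U, hU, hSU⟩ := hb y 0 (by rw [map_zero]; exact hy)
      exact ⟨U, hSU, hU⟩
    · rintro ⟨U, hU, rfl⟩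
      obtain ⟨y, hy, hTy⟩ := ha U
      refine ⟨y, ?_, hy⟩
      have hU' : S U = 0 := hU
      rw [hU', map_zero] at hTy
      exact hTy
  have hπ : Function.Injective (π.domRestrict (LinearMap.ker T)) := by
    rw [← LinearMap.ker_eq_bot, LinearMap.ker_eq_bot']
    intro y hy
    exact Subtype.ext (hc y 0 hy (by rw [map_zero]; exact y.2))
  let e₁ : LinearMap.ker T ≃ₗ[ℂ] LinearMap.ker S :=
    (LinearEquiv.ofInjective _ hπ).trans <|
      (LinearEquiv.ofEq _ _ (by rw [LinearMap.range_domRestrict, hmap])).trans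
        (Submodule.equivMapOfInjective D.subtype D.injective_subtype (LinearMap.ker S)).symm
  let k : (X ⧸ LinearMap.range S) →ₗ[ℂ] Z ⧸ LinearMap.range T :=
    (LinearMap.range S).mapQ (LinearMap.range T) J.toLinearMap hr.le
  have hk : Function.Bijective k := by
    constructor
    · rw [← LinearMap.ker_eq_bot, Submodule.ker_mapQ, ← hr, Submodule.mkQ_map_self]
    · intro g
      obtain ⟨g, rfl⟩ := Submodule.Quotient.mk_surjective _ g
      obtain ⟨y, G, hy⟩ := hd g
      refine ⟨Submodule.Quotient.mk (-G), ?_⟩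
      rw [Submodule.mapQ_apply, Submodule.Quotient.eq]
      refine ⟨-y, ?_⟩
      rw [map_neg, hy]
      simp only [ContinuousLinearMap.coe_coe, map_neg]
      abel
  let e₂ := LinearEquiv.ofBijective k hk
  have := hT.finite_ker
  have := hT.finite_coker
  refine ⟨⟨Module.Finite.equiv e₁, ?_, Module.Finite.equiv e₂.symm⟩, ?_⟩
  · rw [hr]
    exact hT.isClosed_range.preimage J.continuous
  · rw [fredholmIndex, ← e₁.finrank_eq, e₂.finrank_eq, hT.finrank_eq, sub_self]

end Transfer

/-! ### Solvability of the damped equations -/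

section Coercive

/-- The matrix with off-diagonal entries `b` and `c`. -/
@[irreducible] def offDiagCLM (b c : ℝ) : EuclideanSpace ℂ (Fin 2) →L[ℂ] EuclideanSpace ℂ (Fin 2) :=
  Matrix.toEuclideanCLM (n := Fin 2) (𝕜 := ℂ) !![0, (b : ℂ); (c : ℂ), 0]

theorem offDiagCLM_apply (b c : ℝ) (y : EuclideanSpace ℂ (Fin 2)) :
    offDiagCLM b c y 0 = b * y 1 ∧ offDiagCLM b c y 1 = c * y 0 := by
  have key : ∀ i, offDiagCLM b c y i
      = ∑ j, (!![0, (b : ℂ); (c : ℂ), 0] : Matrix (Fin 2) (Fin 2) ℂ) i j * y j := fun i => by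
    rw [offDiagCLM, Matrix.ofLp_toEuclideanCLM]; rfl
  constructor <;> simp [key]

theorem continuous_offDiagCLM : Continuous fun P : ℝ × ℝ => offDiagCLM P.1 P.2 := by
  have h1 : Continuous (Matrix.toEuclideanCLM (n := Fin 2) (𝕜 := ℂ)) :=
    LinearMap.continuous_of_finiteDimensional
      (Matrix.toEuclideanCLM (n := Fin 2) (𝕜 := ℂ)).toAlgEquiv.toLinearMap
  simp only [offDiagCLM]
  refine h1.comp (continuous_matrix fun i j => ?_)
  fin_cases i <;> fin_cases j <;> simp <;> fun_prop

theorem inner_eq_two (x y : EuclideanSpace ℂ (Fin 2)) :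
    inner ℂ x y = y 0 * (starRingEnd ℂ) (x 0) + y 1 * (starRingEnd ℂ) (x 1) := by
  simp [PiLp.inner_apply, Fin.sum_univ_two]

theorem norm_sq_eq_two (y : EuclideanSpace ℂ (Fin 2)) : ‖y‖ ^ 2 = ‖y 0‖ ^ 2 + ‖y 1‖ ^ 2 := by
  rw [EuclideanSpace.norm_sq_eq, Fin.sum_univ_two]

theorem re_ofReal_mul_mul_conj (b : ℝ) (z : ℂ) :
    ((b : ℂ) * z * (starRingEnd ℂ) z).re = b * ‖z‖ ^ 2 := by
  rw [mul_assoc, Complex.mul_conj, ← Complex.ofReal_mul, Complex.ofReal_re,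
    Complex.normSq_eq_norm_sq]

variable {b c : ℝ → ℝ}

/-- With `H` the exchange of the two components, `Re ⟪H e, M e⟫ = b |e₁|² + c |e₀|²` is coercive;
`-H` does the same for the adjoint system. This handles the elliptic equation for `p`, written as
`p' = b r`, `r' = c p`. -/
theorem exists_offDiag_coeff (hb : BddSmooth b) (hc : BddSmooth c) {m : ℝ} (hm : 0 < m)
    (hbm : ∀ x, m ≤ b x) (hcm : ∀ x, m ≤ c x) :
    ∃ M : BddCoeff (EuclideanSpace ℂ (Fin 2)), (∀ x, M x = offDiagCLM (b x) (c x)) ∧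
      Function.Bijective (diffOp M) := by
  obtain ⟨B, hB⟩ := hb.bdd
  obtain ⟨C, hC⟩ := hc.bdd
  have hcont : Continuous fun x => offDiagCLM (b x) (c x) :=
    continuous_offDiagCLM.comp (hb.smooth.continuous.prodMk hc.smooth.continuous)
  have hK : IsCompact (Set.Icc (-B) B ×ˢ Set.Icc (-C) C) := isCompact_Icc.prod isCompact_Icc
  obtain ⟨K, hK⟩ := hK.exists_bound_of_continuousOn continuous_offDiagCLM.continuousOn
  have hsymm : ∀ x y, inner ℂ (offDiagCLM 1 1 x) y = inner ℂ x (offDiagCLM 1 1 y) := by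
    intro x y
    rw [inner_eq_two, inner_eq_two, (offDiagCLM_apply 1 1 x).1, (offDiagCLM_apply 1 1 x).2,
      (offDiagCLM_apply 1 1 y).1, (offDiagCLM_apply 1 1 y).2]
    simp
    ring
  refine ⟨⟨_, hcont.stronglyMeasurable, K, fun x => hK (b x, c x)
    ⟨abs_le.1 (hB x), abs_le.1 (hC x)⟩⟩, fun x => rfl, ?_⟩
  refine bijective_diffOp_of_coercive hm (H := offDiagCLM 1 1) (H' := -offDiagCLM 1 1) hsymm
    (fun x y => by simp [hsymm]) (fun x e => ?_) (fun x e => ?_)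
  · change _ ≤ (inner ℂ (offDiagCLM 1 1 e) (offDiagCLM (b x) (c x) e)).re
    rw [inner_eq_two, (offDiagCLM_apply 1 1 e).1, (offDiagCLM_apply 1 1 e).2,
      (offDiagCLM_apply _ _ e).1, (offDiagCLM_apply _ _ e).2, Complex.ofReal_one, one_mul, one_mul,
      Complex.add_re, re_ofReal_mul_mul_conj, re_ofReal_mul_mul_conj, norm_sq_eq_two]
    nlinarith [mul_le_mul_of_nonneg_right (hbm x) (sq_nonneg ‖e 1‖),
      mul_le_mul_of_nonneg_right (hcm x) (sq_nonneg ‖e 0‖)]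
  · change _ ≤ (inner ℂ ((-offDiagCLM 1 1) e)
      ((-ContinuousLinearMap.adjoint (offDiagCLM (b x) (c x))) e)).re
    have e1 : inner ℂ ((-offDiagCLM 1 1) e)
        ((-ContinuousLinearMap.adjoint (offDiagCLM (b x) (c x))) e)
        = (b x : ℂ) * e 0 * (starRingEnd ℂ) (e 0) + (c x : ℂ) * e 1 * (starRingEnd ℂ) (e 1) := by
      rw [neg_apply, neg_apply, inner_neg_neg, ContinuousLinearMap.adjoint_inner_right,
        inner_eq_two, (offDiagCLM_apply _ _ (offDiagCLM 1 1 e)).1,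
        (offDiagCLM_apply _ _ (offDiagCLM 1 1 e)).2, (offDiagCLM_apply 1 1 e).1,
        (offDiagCLM_apply 1 1 e).2]
      simp only [Complex.ofReal_one, one_mul, map_mul, Complex.conj_ofReal]
      ring
    rw [e1, Complex.add_re, re_ofReal_mul_mul_conj, re_ofReal_mul_mul_conj, norm_sq_eq_two]
    nlinarith [mul_le_mul_of_nonneg_right (hbm x) (sq_nonneg ‖e 0‖),
      mul_le_mul_of_nonneg_right (hcm x) (sq_nonneg ‖e 1‖)]

theorem exists_solution_offDiag (hb : BddSmooth b) (hc : BddSmooth c) {m : ℝ} (hm : 0 < m)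
    (hbm : ∀ x, m ≤ b x) (hcm : ∀ x, m ≤ c x) (f g : L2) :
    ∃ p p' r r' : L2, HasWeakDeriv p p' ∧ HasWeakDeriv r r' ∧
      (∀ᵐ x : ℝ, p' x = b x * r x + f x) ∧ ∀ᵐ x : ℝ, r' x = c x * p x + g x := by
  obtain ⟨M, hM, hbij⟩ := exists_offDiag_coeff hb hc hm hbm hcm
  obtain ⟨q, hq⟩ := hbij.2 (assemble ![f, g])
  have key : ∀ᵐ x : ℝ, component 0 q.1.2 x = b x * component 1 q.1.1 x + f x ∧
      component 1 q.1.2 x = c x * component 0 q.1.1 x + g x := by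
    filter_upwards [diffOp_eq_iff.1 hq, coeFn_assemble ![f, g], coeFn_component 0 q.1.1,
      coeFn_component 1 q.1.1, coeFn_component 0 q.1.2, coeFn_component 1 q.1.2]
      with x hx h0 h1 h2 h3 h4
    rw [h1, h2, h3, h4, hx, hM]
    have := offDiagCLM_apply (b x) (c x) (q.1.1 x)
    constructor
    · rw [PiLp.add_apply, this.1, h0]; rfl
    · rw [PiLp.add_apply, this.2, h0]; rfl
  exact ⟨_, _, _, _, hasWeakDeriv_component 0 q, hasWeakDeriv_component 1 q,
    key.mono fun x hx => hx.1, key.mono fun x hx => hx.2⟩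

theorem eq_zero_of_offDiag (hb : BddSmooth b) (hc : BddSmooth c) {m : ℝ} (hm : 0 < m)
    (hbm : ∀ x, m ≤ b x) (hcm : ∀ x, m ≤ c x) {p p' r r' : L2} (hp : HasWeakDeriv p p')
    (hr : HasWeakDeriv r r') (h₁ : ∀ᵐ x : ℝ, p' x = b x * r x) (h₂ : ∀ᵐ x : ℝ, r' x = c x * p x) :
    p = 0 ∧ r = 0 := by
  obtain ⟨M, hM, hbij⟩ := exists_offDiag_coeff hb hc hm hbm hcm
  have hd : ∀ i, HasWeakDeriv ((![p, r] : Fin 2 → L2) i) ((![p', r'] : Fin 2 → L2) i) := by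
    intro i
    fin_cases i
    · exact hp
    · exact hr
  set q : sobolev (EuclideanSpace ℂ (Fin 2)) := ⟨_, assemble_mem_sobolev hd⟩ with hq
  have hz : diffOp M q = 0 := by
    rw [diffOp_eq_iff]
    filter_upwards [h₁, h₂, coeFn_assemble ![p, r], coeFn_assemble ![p', r'],
      Lp.coeFn_zero (EuclideanSpace ℂ (Fin 2)) 2 (volume : Measure ℝ)] with x e1 e2 h3 h4 h5
    have := offDiagCLM_apply (b x) (c x) (assemble ![p, r] x)
    rw [h5, hM, Pi.zero_apply, add_zero]
    ext i
    fin_cases i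
    · refine (h4 0).trans (Eq.trans ?_ this.1.symm)
      rw [h3]; exact e1
    · refine (h4 1).trans (Eq.trans ?_ this.2.symm)
      rw [h3]; exact e2
  have hq0 : q = 0 := hbij.1 (hz.trans (map_zero _).symm)
  have h0 : assemble ![p, r] = 0 := congrArg (fun q : sobolev _ => q.1.1) hq0
  constructor
  · have := component_assemble ![p, r] 0
    rw [h0, map_zero] at this
    exact this.symm
  · have := component_assemble ![p, r] 1
    rw [h0, map_zero] at this
    exact this.symm

/-- The energy form is `-|z|²` for the equation and `|z|²` for its adjoint. The result solves the
row for `z` when `w = g = 0`. -/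
theorem exists_solution_damped (hb : BddSmooth b) {m : ℝ} (hm : 0 < m) (hbm : ∀ x, m ≤ b x)
    (f : L2) : ∃ z z' : L2, HasWeakDeriv z z' ∧ ∀ᵐ x : ℝ, z' x = -(b x * z x) + f x := by
  obtain ⟨B, hB⟩ := hb.bdd
  have hcont : Continuous fun x => -(b x : ℂ) • ContinuousLinearMap.id ℂ ℂ :=
    (Complex.continuous_ofReal.comp hb.smooth.continuous).neg.smul continuous_const
  let M : BddCoeff ℂ := ⟨_, hcont.stronglyMeasurable, B, fun x => by
    rw [norm_smul, norm_neg, Complex.norm_real, ContinuousLinearMap.norm_id, mul_one]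
    exact hB x⟩
  have hM : ∀ x e, M x e = -((b x : ℂ) * e) := fun x e => by
    change (-(b x : ℂ)) * e = _
    ring
  have hre : ∀ x (e : ℂ), m * ‖e‖ ^ 2 ≤ ((b x : ℂ) * e * (starRingEnd ℂ) e).re := fun x e => by
    rw [re_ofReal_mul_mul_conj]
    exact mul_le_mul_of_nonneg_right (hbm x) (sq_nonneg _)
  have hbij : Function.Bijective (diffOp M) := by
    refine bijective_diffOp_of_coercive hm (H := -ContinuousLinearMap.id ℂ ℂ)
      (H' := ContinuousLinearMap.id ℂ ℂ) (fun x y => by simp) (fun x y => rfl)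
      (fun x e => ?_) (fun x e => ?_)
    · rw [hM, neg_apply, inner_neg_neg]
      exact hre x e
    · change _ ≤ (inner ℂ e ((-ContinuousLinearMap.adjoint (M x)) e)).re
      rw [neg_apply, inner_neg_right, ContinuousLinearMap.adjoint_inner_right, hM, inner_neg_left,
        neg_neg]
      have : inner ℂ ((b x : ℂ) * e) e = (b x : ℂ) * e * (starRingEnd ℂ) e := by
        change e * (starRingEnd ℂ) ((b x : ℂ) * e) = _
        rw [map_mul, Complex.conj_ofReal]
        ring
      rw [this]
      exact hre x e
  obtain ⟨q, hq⟩ := hbij.2 f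
  refine ⟨q.1.1, q.1.2, hasWeakDeriv_iff_weakDeriv.2 q.2, ?_⟩
  filter_upwards [diffOp_eq_iff.1 hq] with x hx
  rw [hx, hM]

end Coercive

/-! ### Solving the system modulo sources, and the Fredholm property of `L - μ`. -/

section SystemSolvability

theorem eq_zero_of_component {ι : Type*} [Fintype ι]
    {u : Lp (EuclideanSpace ℂ ι) 2 (volume : Measure ℝ)} (h : ∀ i, component i u = 0) : u = 0 := by
  refine Lp.ext ?_
  filter_upwards [ae_all_iff.2 fun i => coeFn_component i u, Lp.coeFn_zero ℂ 2 (volume : Measure ℝ),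
    Lp.coeFn_zero (EuclideanSpace ℂ ι) 2 (volume : Measure ℝ)] with x h1 h2 h3
  rw [h3]
  ext i
  rw [← h1 i, h i, h2]
  rfl

theorem sobolev_eq_zero {E : Type*} [NormedAddCommGroup E] [InnerProductSpace ℂ E]
    [CompleteSpace E] {q : sobolev E} (h : q.1.1 = 0) : q = 0 := by
  refine Subtype.ext (Prod.ext h (Lp.ext ?_))
  have h1 := q.2
  rw [mem_sobolev_iff, h] at h1
  exact h1.unique (sobolev E).zero_mem

theorem HasWeakDeriv.eq_zero {f g : L2} (h : HasWeakDeriv f g) (hf : f = 0) : g = 0 := by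
  have h0 : (fun _ : ℝ => (0 : ℂ)) =ᵐ[volume] ((0 : L2) : ℝ → ℂ) :=
    (Lp.coeFn_zero ℂ 2 volume).symm
  rw [hf] at h
  exact Lp.ext (h.unique (hasWeakDeriv_zero.congr h0 h0))

theorem eq_source {s : ℝ} (hs : 0 < s) {K : Lp (EuclideanSpace ℂ (Fin 5)) 2 (volume : Measure ℝ)}
    (h1 : ∀ᵐ x : ℝ, K x 1 = 0) (h3 : ∀ᵐ x : ℝ, K x 3 = 0) (h4 : ∀ᵐ x : ℝ, K x 4 = 0) :
    K = source s ((s : ℂ) • component 0 K, component 2 K) := by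
  refine Lp.ext ?_
  filter_upwards [h1, h3, h4, coeFn_source s ((s : ℂ) • component 0 K, component 2 K),
    Lp.coeFn_smul (s : ℂ) (component 0 K), coeFn_component 0 K, coeFn_component 2 K]
    with x e1 e3 e4 ⟨s0, s1, s2, s3, s4⟩ a b c
  have hsc : (s : ℂ) ≠ 0 := by exact_mod_cast hs.ne'
  rw [a, Pi.smul_apply, b, smul_eq_mul, mul_div_cancel_left₀ _ hsc] at s0
  rw [c] at s2
  ext i
  fin_cases i
  · exact s0.symm
  · exact e1.trans s1.symm
  · exact s2.symm
  · exact e3.trans s3.symm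
  · exact e4.trans s4.symm

theorem source_eq_zero {s : ℝ} (hs : 0 < s) {F : L2 × L2} (h : source s F = 0) : F = 0 := by
  have key : ∀ᵐ x : ℝ, F.1 x = 0 ∧ F.2 x = 0 := by
    filter_upwards [coeFn_source s F,
      Lp.coeFn_zero (EuclideanSpace ℂ (Fin 5)) 2 (volume : Measure ℝ)] with x ⟨s0, _, s2, _, _⟩ e
    rw [h, e] at s0 s2
    have hsc : (s : ℂ) ≠ 0 := by exact_mod_cast hs.ne'
    refine ⟨?_, s2.symm⟩
    rcases div_eq_zero_iff.1 s0.symm with h | h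
    · exact h
    · exact absurd h hsc
  refine Prod.ext (Lp.ext ?_) (Lp.ext ?_)
  · filter_upwards [key, Lp.coeFn_zero ℂ 2 (volume : Measure ℝ)] with x h1 h2
    exact h1.1.trans h2.symm
  · filter_upwards [key, Lp.coeFn_zero ℂ 2 (volume : Measure ℝ)] with x h1 h2
    exact h1.2.trans h2.symm

variable {T ν ε s vm um vp up : ℝ} {v u φ : ℝ → ℝ}

theorem IsShockProfile.exists_le_exp (h : IsShockProfile T ν ε s vm um vp up v u φ) :
    ∃ m, 0 < m ∧ ∀ x, m ≤ Real.exp (φ x) := by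
  obtain ⟨C, hC⟩ := exists_norm_le_of_tendsto h.smooth_φ.continuous h.lim_φ_bot h.lim_φ_top
  exact ⟨Real.exp (-C), Real.exp_pos _, fun x => Real.exp_le_exp.2 (abs_le.1 (hC x)).1⟩

theorem IsShockProfile.exists_le_potential (h : IsShockProfile T ν ε s vm um vp up v u φ)
    (hε : 0 < ε) (hvm : 0 < vm) (hvp : 0 < vp) :
    ∃ m, 0 < m ∧ (∀ x, m ≤ v x) ∧ ∀ x, m ≤ (ε ^ 2)⁻¹ * (v x * Real.exp (φ x)) := by
  obtain ⟨m, hm, hmv⟩ := h.exists_le_v hvm hvp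
  obtain ⟨k, hk, hke⟩ := h.exists_le_exp
  refine ⟨min m ((ε ^ 2)⁻¹ * (m * k)), lt_min hm (by positivity),
    fun x => (min_le_left _ _).trans (hmv x), fun x => (min_le_right _ _).trans ?_⟩
  have := hmv x
  have := hke x
  have := h.pos x
  gcongr

/-- When `w = z = 0` the pair `(p, r)` solves a homogeneous system with positive off-diagonal
coefficients, hence vanishes; then `g` vanishes by the flux formula. -/
theorem eq_zero_of_diffOp_eq_source (h : IsShockProfile T ν ε s vm um vp up v u φ) (hε : 0 < ε)
    (hν : 0 < ν) (hs : 0 < s) (hvm : 0 < vm) (hvp : 0 < vp) {μ : ℂ}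
    {M : BddCoeff (EuclideanSpace ℂ (Fin 5))} (hM : ∀ x, M x = profileMatrix T ν ε s μ v u φ x)
    {Y : sobolev (EuclideanSpace ℂ (Fin 5))} {G : L2 × L2} (h0 : component 0 Y.1.1 = 0)
    (h1 : component 1 Y.1.1 = 0) (hY : diffOp M Y = source s G) : Y = 0 := by
  obtain ⟨m, hm, hmv, hmc⟩ := h.exists_le_potential hε hvm hvp
  have bv := h.bddSmooth_v hε hν hs hvm hvp
  have hd := fun i => hasWeakDeriv_component i Y
  have d1 : component 1 Y.1.2 = 0 := (hd 1).eq_zero h1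
  have hz := Lp.coeFn_zero ℂ 2 (volume : Measure ℝ)
  have key : ∀ᵐ x : ℝ, component 2 Y.1.1 x = ((ε ^ 2 * (deriv φ x / v x * (v x)⁻¹) : ℝ) : ℂ)
        * component 3 Y.1.2 x + ((-1 * Real.exp (φ x) : ℝ) : ℂ) * component 3 Y.1.1 x ∧
      component 3 Y.1.2 x = v x * component 4 Y.1.1 x ∧
      component 4 Y.1.2 x
        = (((ε ^ 2)⁻¹ * (v x * Real.exp (φ x)) : ℝ) : ℂ) * component 3 Y.1.1 x := by
    filter_upwards [diffOp_eq_iff.1 hY, coeFn_source s G, hz,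
      ae_all_iff.2 fun i => coeFn_component i Y.1.1, ae_all_iff.2 fun i => coeFn_component i Y.1.2]
      with x hx ⟨s0, s1, s2, s3, s4⟩ z0 a1 a2
    rw [hM, profileMatrix, eq_systemCLM_add_iff hs hν hε (h.pos x) s1 s3 s4] at hx
    simp only [← a1, ← a2, h0, h1, d1, z0, Pi.zero_apply, mul_zero, add_zero, zero_add] at hx
    obtain ⟨c2, -, -, c3, c4⟩ := hx
    refine ⟨c2, c3, c4.trans ?_⟩
    push_cast
    ring
  obtain ⟨h3, h4⟩ := eq_zero_of_offDiag bv
    ((BddSmooth.const _).mul (bv.mul (h.bddSmooth_exp hε hvm hvp))) hm hmv hmc (hd 3) (hd 4)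
    (key.mono fun x hx => hx.2.1) (key.mono fun x hx => hx.2.2)
  have d3 : component 3 Y.1.2 = 0 := (hd 3).eq_zero h3
  have h2 : component 2 Y.1.1 = 0 := by
    refine Lp.ext ?_
    filter_upwards [key, hz] with x hx z0
    rw [hx.1, h3, d3, z0]
    simp
  refine sobolev_eq_zero (eq_zero_of_component fun i => ?_)
  fin_cases i
  · exact h0
  · exact h1
  · exact h2
  · exact h3
  · exact h4

/-- With `w = g = 0` rows 3 and 4 determine `(p, r)`, and row 1 is then a damped equation for `z`
with rate `s v / ν`. The remaining mismatch lies in rows 0 and 2, which are exactly the rows that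
sources fill. -/
theorem exists_diffOp_eq_add_source (h : IsShockProfile T ν ε s vm um vp up v u φ) (hε : 0 < ε)
    (hν : 0 < ν) (hs : 0 < s) (hvm : 0 < vm) (hvp : 0 < vp) {μ : ℂ}
    {M : BddCoeff (EuclideanSpace ℂ (Fin 5))} (hM : ∀ x, M x = profileMatrix T ν ε s μ v u φ x)
    (G : Lp (EuclideanSpace ℂ (Fin 5)) 2 (volume : Measure ℝ)) :
    ∃ (Y : sobolev (EuclideanSpace ℂ (Fin 5))) (H : L2 × L2), diffOp M Y = G + source s H := by
  obtain ⟨m, hm, hmv, hmc⟩ := h.exists_le_potential hε hvm hvp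
  have bv := h.bddSmooth_v hε hν hs hvm hvp
  have be := h.bddSmooth_exp hε hvm hvp
  have bq := h.bddSmooth_field hε hvm hvp
  obtain ⟨p, p', r, r', hp, hr, ep, er⟩ := exists_solution_offDiag bv
    ((BddSmooth.const (ε ^ 2)⁻¹).mul (bv.mul be)) hm hmv hmc (component 3 G) (component 4 G)
  have hf : MemLp (fun x => ((ν⁻¹ * (v x * Real.exp (φ x)) : ℝ) : ℂ) * p x
      + ((-ε ^ 2 / ν * (deriv φ x / v x * v x) : ℝ) : ℂ) * r x + component 1 G x) 2
      (volume : Measure ℝ) :=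
    ((((BddSmooth.const ν⁻¹).mul (bv.mul be)).memLp_mul (Lp.memLp _)).add
      (((BddSmooth.const (-ε ^ 2 / ν)).mul (bq.mul bv)).memLp_mul (Lp.memLp _))).add (Lp.memLp _)
  obtain ⟨z, z', hz, ez⟩ := exists_solution_damped (b := fun x => s / ν * v x)
    ((BddSmooth.const (s / ν)).mul bv) (m := s / ν * m) (by positivity)
    (fun x => mul_le_mul_of_nonneg_left (hmv x) (by positivity)) (hf.toLp _)
  have h00 : HasWeakDeriv (0 : L2) (0 : L2) :=
    hasWeakDeriv_iff_weakDeriv.2 (sobolev ℂ).zero_mem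
  set y : Fin 5 → L2 := ![0, z, 0, p, r] with hy
  set y' : Fin 5 → L2 := ![0, z', 0, p', r'] with hy'
  have hd : ∀ i, HasWeakDeriv (y i) (y' i) := by
    intro i
    fin_cases i
    · exact h00
    · exact hz
    · exact h00
    · exact hp
    · exact hr
  set Y : sobolev (EuclideanSpace ℂ (Fin 5)) := ⟨_, assemble_mem_sobolev hd⟩ with hYdef
  have key : ∀ᵐ x : ℝ, (diffOp M Y - G) x 1 = 0 ∧ (diffOp M Y - G) x 3 = 0 ∧
      (diffOp M Y - G) x 4 = 0 := by
    filter_upwards [diffOp_eq_iff.1 (Eq.refl (diffOp M Y)), Lp.coeFn_sub (diffOp M Y) G,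
      coeFn_assemble y, coeFn_assemble y', ep, er, ez, hf.coeFn_toLp,
      Lp.coeFn_zero ℂ 2 (volume : Measure ℝ), ae_all_iff.2 fun i => coeFn_component i G]
      with x hx hsub a1 a2 ep er ez ef z0 aG
    obtain ⟨e1, e0, e2, e3, e4⟩ := systemCLM_apply s ν ε μ (v x) (totalCoef T ν ε v u φ x)
      (deriv φ x / v x) (Real.exp (φ x)) (assemble y x)
    rw [hM, profileMatrix] at hx
    have y0 : assemble y x 0 = 0 := (a1 0).trans (by rw [← Pi.zero_apply (M := fun _ => ℂ) x, ← z0]; rfl)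
    have y1 : assemble y x 1 = z x := a1 1
    have y2 : assemble y x 2 = 0 := (a1 2).trans (by rw [← Pi.zero_apply (M := fun _ => ℂ) x, ← z0]; rfl)
    have y3 : assemble y x 3 = p x := a1 3
    have y4 : assemble y x 4 = r x := a1 4
    rw [y0, y1, y2, y3, y4] at e1
    rw [y0, y4] at e3
    rw [y0, y3] at e4
    have hx' : ∀ i, assemble y' x i = systemCLM s ν ε μ (v x) (totalCoef T ν ε v u φ x)
      (deriv φ x / v x) (Real.exp (φ x)) (assemble y x) i + diffOp M Y x i := fun i => by
      have := congrArg (fun w : EuclideanSpace ℂ (Fin 5) => w i) hx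
      exact this
    have g1 := (a2 1).symm.trans (hx' 1)
    have g3 := (a2 3).symm.trans (hx' 3)
    have g4 := (a2 4).symm.trans (hx' 4)
    rw [e1] at g1
    rw [e3] at g3
    rw [e4] at g4
    change z' x = _ at g1
    change p' x = _ at g3
    change r' x = _ at g4
    rw [hsub]
    simp only [Pi.sub_apply, PiLp.sub_apply]
    rw [ez, ef, aG] at g1
    rw [ep, aG] at g3
    rw [er, aG] at g4
    push_cast at g1 g3 g4
    refine ⟨?_, ?_, ?_⟩
    · linear_combination -g1
    · linear_combination -g3
    · linear_combination -g4
  exact ⟨Y, _, sub_eq_iff_eq_add'.1 (eq_source hs (key.mono fun x hx => hx.1)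
    (key.mono fun x hx => hx.2.1) (key.mono fun x hx => hx.2.2))⟩

/-- The first two components of a function in `H¹(ℝ, ℂ⁵)`. -/
def firstComponents : sobolev (EuclideanSpace ℂ (Fin 5)) →ₗ[ℂ] L2 × L2 :=
  ((component 0).toLinearMap.prod (component 1).toLinearMap).comp
    ((LinearMap.fst ℂ _ _).comp (sobolev (EuclideanSpace ℂ (Fin 5))).subtype)

/-- Without this `toLinearPMap` would not have the prescribed graph. If `U = 0`, the associated `Y`
vanishes, and so does its source. -/
theorem linearizedGraph_single_valued (h : IsShockProfile T ν ε s vm um vp up v u φ) (hT : 0 < T)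
    (hε : 0 < ε) (hν : 0 < ν) (hs : 0 < s) (hvm : 0 < vm) (hvp : 0 < vp)
    (q : (L2 × L2) × (L2 × L2)) (hq : q ∈ linearizedGraph T ν ε s v u φ) (hq0 : q.1 = 0) :
    q.2 = 0 := by
  obtain ⟨M, hM, -⟩ := h.exists_coeff hT hε hν hs hvm hvp 0
  obtain ⟨Y, h0, h1, hY⟩ := exists_diffOp_eq_source h hε hν hs hvm hvp hM hq
  rw [hq0] at h0 h1
  have hY0 := eq_zero_of_diffOp_eq_source h hε hν hs hvm hvp hM h0 h1 hY
  rw [hY0, map_zero, zero_smul, sub_zero] at hY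
  exact source_eq_zero hs hY.symm

theorem mem_linearizedGraph_iff (h : IsShockProfile T ν ε s vm um vp up v u φ) (hT : 0 < T)
    (hε : 0 < ε) (hν : 0 < ν) (hs : 0 < s) (hvm : 0 < vm) (hvp : 0 < vp) {U F : L2 × L2} :
    LinearizedRel T ν ε s v u φ U F ↔
      ∃ U' : (linearizedOperator T ν ε s v u φ).domain,
        (U' : L2 × L2) = U ∧ linearizedOperator T ν ε s v u φ U' = F := by
  have hg := Submodule.toLinearPMap_graph_eq (linearizedGraph T ν ε s v u φ)
    (linearizedGraph_single_valued h hT hε hν hs hvm hvp)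
  have h1 := LinearPMap.mem_graph_iff (linearizedOperator T ν ε s v u φ) (x := (U, F))
  rw [linearizedOperator, hg] at h1
  exact h1

theorem isFredholmOp_shifted (h : IsShockProfile T ν ε s vm um vp up v u φ) (hT : 0 < T)
    (hε : 0 < ε) (hν : 0 < ν) (hs : 0 < s) (hvm : 0 < vm) (hvp : 0 < vp) {μ : ℂ}
    (hμ : 0 ≤ μ.re) (hμ0 : μ ≠ 0) :
    IsFredholmOp (shifted (linearizedOperator T ν ε s v u φ) μ) ∧
      fredholmIndex (shifted (linearizedOperator T ν ε s v u φ) μ) = 0 := by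
  obtain ⟨M, hM, hF⟩ := h.exists_coeff hT hε hν hs hvm hvp μ
  have hrel := fun U F => mem_linearizedGraph_iff h hT hε hν hs hvm hvp (U := U) (F := F)
  refine (hF hμ hμ0).transfer (J := source s) (π := firstComponents) (fun U => ?_)
    (fun Y G hY => ?_) (fun Y G h0 hY => ?_) (fun G => ?_)
  · obtain ⟨Y, h0, h1, hY⟩ := exists_diffOp_eq_source h hε hν hs hvm hvp hM
      ((hrel _ _).2 ⟨U, rfl, rfl⟩)
    exact ⟨Y, Prod.ext h0 h1, hY⟩
  · obtain ⟨U, hU, hLU⟩ := (hrel (firstComponents Y) (G + μ • firstComponents Y)).1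
      (linearizedRel_of_diffOp_eq_source h hε hν hs hvm hvp hM rfl rfl
        (by rw [add_sub_cancel_right]; exact hY))
    refine ⟨U, hU, ?_⟩
    change linearizedOperator T ν ε s v u φ U - μ • (U : L2 × L2) = G
    rw [hLU, hU, add_sub_cancel_right]
  · exact eq_zero_of_diffOp_eq_source h hε hν hs hvm hvp hM (congrArg Prod.fst h0)
      (congrArg Prod.snd h0) hY
  · exact exists_diffOp_eq_add_source h hε hν hs hvm hvp hM G

end SystemSolvability

/-! ### The origin belongs to the essential spectrum -/

section Origin

/-- The functions in `L²` which are weak derivatives of functions in `L²`. -/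
def derivativeRange : Submodule ℂ L2 := (sobolev ℂ).map (LinearMap.snd ℂ L2 L2)

theorem HasWeakDeriv.mem_derivativeRange {f g : L2} (h : HasWeakDeriv f g) :
    g ∈ derivativeRange :=
  ⟨(f, g), hasWeakDeriv_iff_weakDeriv.1 h, rfl⟩

/-- A function orthogonal to all derivatives of test functions is constant, and the only constant in
`L²(ℝ)` is zero. -/
theorem derivativeRange_orthogonal : derivativeRangeᗮ = ⊥ := by
  rw [Submodule.eq_bot_iff]
  intro f hf
  obtain ⟨c, hc⟩ := ae_eq_const_of_weakDeriv_zero (locallyIntegrable_coe f) fun η hη hηc => by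
    have hd := continuous_deriv_of_contDiff hη
    have hi := integrable_test_smul (locallyIntegrable_coe f) hd hηc.deriv
    have h1 := hf _ ⟨_, test_mem_sobolev hη hηc (1 : ℂ), rfl⟩
    rw [LinearMap.snd_apply, inner_toLp_smul _ _ hi] at h1
    simpa using h1
  have hL : MemLp (fun _ : ℝ => c) 2 (volume : Measure ℝ) := (Lp.memLp f).ae_eq hc
  rw [memLp_const_iff two_ne_zero ENNReal.ofNat_ne_top] at hL
  have hc0 : c = 0 := hL.resolve_right (by simp)
  refine Lp.ext ?_
  filter_upwards [hc, Lp.coeFn_zero ℂ 2 (volume : Measure ℝ)] with x h1 h2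
  rw [h1, h2, hc0]; rfl

/-- The indicator function of `[0, 1]` has no primitive in `L²`. -/
theorem derivativeRange_ne_top : derivativeRange ≠ ⊤ := by
  intro htop
  have hχ : MemLp ((Set.Icc (0 : ℝ) 1).indicator fun _ => (1 : ℂ)) 2 (volume : Measure ℝ) :=
    memLp_indicator_const 2 measurableSet_Icc 1 (.inr (by simp))
  obtain ⟨q, hq, hq2⟩ : hχ.toLp _ ∈ derivativeRange := htop ▸ Submodule.mem_top
  obtain ⟨c, hc⟩ := exists_primitive_of_mem_sobolev hq
  rw [LinearMap.snd_apply] at hq2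
  have hint : ∀ x : ℝ, ∫ t in (0 : ℝ)..x, q.2 t
      = ∫ t in (0 : ℝ)..x, (Set.Icc (0 : ℝ) 1).indicator (fun _ => (1 : ℂ)) t := fun x => by
    refine intervalIntegral.integral_congr_ae ?_
    rw [hq2]
    filter_upwards [hχ.coeFn_toLp] with t ht _
    exact ht
  have hneg : ∀ x < (0 : ℝ), ∫ t in (0 : ℝ)..x, q.2 t = 0 := fun x hx => by
    rw [hint, intervalIntegral.integral_symm, neg_eq_zero]
    rw [intervalIntegral.integral_of_le hx.le, integral_Ioc_eq_integral_Ioo]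
    refine setIntegral_eq_zero_of_forall_eq_zero fun t ht => ?_
    exact Set.indicator_of_notMem (fun h => absurd h.1 (not_le.2 ht.2)) _
  have hpos : ∀ x > (1 : ℝ), ∫ t in (0 : ℝ)..x, q.2 t = 1 := fun x hx => by
    rw [hint, intervalIntegral.integral_of_le (zero_le_one.trans hx.le),
      ← integral_Icc_eq_integral_Ioc, setIntegral_indicator measurableSet_Icc,
      Set.inter_eq_self_of_subset_right (Set.Icc_subset_Icc_right hx.le)]
    simp
  have h1 : MemLp (fun _ : ℝ => c) 2 ((volume : Measure ℝ).restrict (Set.Iio 0)) := by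
    refine ((Lp.memLp q.1).restrict (Set.Iio 0)).ae_eq ?_
    filter_upwards [ae_restrict_of_ae hc, ae_restrict_mem measurableSet_Iio] with x hx hx0
    rw [hx, hneg x hx0, add_zero]
  have h2 : MemLp (fun _ : ℝ => c + 1) 2 ((volume : Measure ℝ).restrict (Set.Ioi 1)) := by
    refine ((Lp.memLp q.1).restrict (Set.Ioi 1)).ae_eq ?_
    filter_upwards [ae_restrict_of_ae hc, ae_restrict_mem measurableSet_Ioi] with x hx hx0
    rw [hx, hpos x hx0]
  rw [memLp_const_iff two_ne_zero ENNReal.ofNat_ne_top] at h1 h2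
  have c0 : c = 0 := h1.resolve_right (by simp)
  have c1 : c + 1 = 0 := h2.resolve_right (by simp)
  rw [c0, zero_add] at c1
  exact one_ne_zero c1

theorem derivativeRange_not_isClosed : ¬ IsClosed (derivativeRange : Set L2) := by
  intro h
  have : CompleteSpace derivativeRange := h.completeSpace_coe
  exact derivativeRange_ne_top
    ((Submodule.orthogonal_eq_bot_iff).1 derivativeRange_orthogonal)

variable {T ν ε s vm um vp up : ℝ} {v u φ : ℝ → ℝ}

theorem LinearizedRel.mem_derivativeRange {U F : L2 × L2}
    (h : LinearizedRel T ν ε s v u φ U F) : F.1 ∈ derivativeRange := by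
  obtain ⟨w', z', z'', p, p', p'', -, -, -, -, -, -, hF, -⟩ := h
  refine HasWeakDeriv.mem_derivativeRange (f := (s : ℂ) • U.1 + U.2) (hF.congr ?_ EventuallyEq.rfl)
  filter_upwards [Lp.coeFn_add ((s : ℂ) • U.1) U.2, Lp.coeFn_smul (s : ℂ) U.1] with x h1 h2
  rw [h1, Pi.add_apply, h2]
  rfl

theorem zero_mem_essentialSpectrum (h : IsShockProfile T ν ε s vm um vp up v u φ) (hT : 0 < T)
    (hε : 0 < ε) (hν : 0 < ν) (hs : 0 < s) (hvm : 0 < vm) (hvp : 0 < vp) :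
    0 ∈ essentialSpectrum (linearizedOperator T ν ε s v u φ) := by
  refine .inl fun hF => ?_
  have := hF.finite_coker
  have hle : LinearMap.range (shifted (linearizedOperator T ν ε s v u φ) 0)
      ≤ derivativeRange.prod ⊤ := by
    rintro _ ⟨U, rfl⟩
    refine ⟨?_, trivial⟩
    have h1 := (mem_linearizedGraph_iff h hT hε hν hs hvm hvp).2 ⟨U, rfl, rfl⟩
    change (linearizedOperator T ν ε s v u φ U - (0 : ℂ) • (U : L2 × L2)).1 ∈ _
    rw [zero_smul, sub_zero]
    exact h1.mem_derivativeRange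
  -- If `L` were Fredholm, any subspace containing its range would be closed, in particular
  -- `derivativeRange × L²`, and hence its slice `derivativeRange`.
  have hcl := Submodule.isClosed_mono_of_finiteDimensional_quotient hF.isClosed_range hle
  refine derivativeRange_not_isClosed ?_
  have hpre := hcl.preimage (Continuous.prodMk_left (0 : L2))
  convert hpre using 1
  ext f
  simp

end Origin

end NSP

end

/-! ### The essential spectrum in the closed right half-plane. -/

theorem proposition3p1 (T ν ε : ℝ) (hT : 0 < T) (hν : 0 < ν) (hε : 0 < ε)
    (vm um : ℝ) (hvm : 0 < vm) :
    ∃ δ₁ : ℝ, 0 < δ₁ ∧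
      ∀ vp up s : ℝ, NSP.IsLaxTwoShock T s vm um vp up → |vp - vm| < δ₁ →
        ∀ v u φ : ℝ → ℝ, NSP.IsShockProfile T ν ε s vm um vp up v u φ →
          NSP.essentialSpectrum (NSP.linearizedOperator T ν ε s v u φ) ∩ {μ : ℂ | 0 ≤ μ.re}
            = {0} := by
  refine ⟨1, one_pos, fun vp up s hshock _ v u φ h => ?_⟩
  have hs := hshock.speed_pos hT hvm
  have hvp := hvm.trans hshock.lax
  ext μ
  constructor
  · rintro ⟨hess, hμ⟩
    by_contra hμ0
    have hF := NSP.isFredholmOp_shifted h hT hε hν hs hvm hvp hμ hμ0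
    rcases hess with h1 | h1
    · exact h1 hF.1
    · exact h1 hF.2
  · rintro rfl
    exact ⟨NSP.zero_mem_essentialSpectrum h hT hε hν hs hvm hvp, by simp⟩
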